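/- Let $N\ge 3$, let $\mu_N\subset\mathbb C$ be the group of $N$-th roots of unity, $\zeta_N=e^{2\pi i/N}$, and let $\mathbb Q(\mu_N)$ be the cyclotomic field. For a set $A$ let $R\langle\langle A\rangle\rangle$ be the algebra of noncommutative formal power series in $A$ over $R$, and write $(f\mid w)$ for the coefficient of the word $w$ in $f$ (extended linearly in $w$). Morphisms and derivations below are continuous and are given by their values on letters. **Cyclotomic side.** Let $X=\{x_0\}\cup\{x_\zeta\mid\zeta\in\mu_N\}$ and $Y=\{y_{k,\zeta}\mid k\ge1,\ \zeta\in\mu_N\}$, with $\mathbb Q\langle\langle Y\rangle\rangle\subset\mathbb Q\langle\langle X\rangle\rangle$ through $y_{k,\zeta}=x_0^{k-1}x_\zeta$. Let $\pi_Y$ be the projection onto the first summand of $\mathbb Q\langle\langle X\rangle\rangle=\mathbb Q\langle\langle Y\rangle\rangle\oplus\mathbb Q\langle\langle X\rangle\rangle x_0$. Let $\mathbf p$ be the linear automorphism of $\mathbb Q\langle\langle X\rangle\rangle$ with $\mathbf p(x_0^{k_1-1}x_{\zeta_1}x_0^{k_2-1}x_{\zeta_2}\cdots x_0^{k_r-1}x_{\zeta_r}x_0^{k_{r+1}-1})=x_0^{k_1-1}x_{\zeta_1}x_0^{k_2-1}x_{\zeta_1\zeta_2}\cdots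 x_0^{k_r-1}x_{\zeta_1\cdots\zeta_r}x_0^{k_{r+1}-1}$. Let $\widehat\Delta_{\mathrm{sh}}$ be the algebra morphism for which all letters of $X$ are primitive, and let $\widehat\Delta_*$ be the algebra morphism on $\mathbb Q\langle\langle Y\rangle\rangle$ with $y_{k,\zeta}\mapsto y_{k,\zeta}\otimes1+1\otimes y_{k,\zeta}+\sum_{k_1+k_2=k,\ \zeta_1\zeta_2=\zeta}y_{k_1,\zeta_1}\otimes y_{k_2,\zeta_2}$. Put $$\psi_*=\pi_Y(\mathbf p^{-1}(\psi))+\sum_{n\ge2}\frac{(-1)^{n-1}}{n}(\psi\mid x_0^{n-1}x_1)\,y_{1,1}^n .$$ Then $\mathfrak{dmr}_0^{\mu_N}$ is the set of $\psi\in\mathbb Q\langle\langle X\rangle\rangle$ such that $(\psi\mid x_0)=(\psi\mid x_1)=0$; $\psi$ is primitive for $\widehat\Delta_{\mathrm{sh}}$; $(\psi\mid x_\zeta-x_{\zeta^{-1}})=0$ for all $\zeta\in\mu_N$; and $\psi_*$ is primitive for $\widehat\Delta_*$. For $d\mid N$ let $X_d=\{x_0\}\cup\{x_\zeta\mid\zeta\in\mu_{N/d}\}\subset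 X$, and let $p^d_*,i_d^*:\mathbb Q\langle\langle X\rangle\rangle\to\mathbb Q\langle\langle X_d\rangle\rangle$ be the algebra morphisms with $p^d_*(x_0)=d\,x_0$, $p^d_*(x_\zeta)=x_{\zeta^d}$, and $i_d^*(x_0)=x_0$, $i_d^*(x_\zeta)=x_\zeta$ if $\zeta\in\mu_{N/d}$, $i_d^*(x_\zeta)=0$ otherwise. The double shuffle and distribution Lie algebra is $$\mathfrak{dmrd}_0^{\mu_N}=\Big\{\psi\in\mathfrak{dmr}_0^{\mu_N}\ \Big|\ \forall d\mid N:\ p^d_*(\psi)=i_d^*(\psi)+\sum_{\zeta\in\mu_{N/d}}(\psi\mid x_\zeta)\,x_1\Big\}.$$ Its bracket is $\langle\psi_1,\psi_2\rangle=d_{\psi_1}(\psi_2)-d_{\psi_2}(\psi_1)+[\psi_1,\psi_2]$, where $d_\psi$ is the derivation with $x_0\mapsto0$, $x_\zeta\mapsto[x_\zeta,t_\zeta(\psi)]$, and $t_\zeta$ is the algebra automorphism with $x_0\mapsto x_0$, $x_\eta\mapsto x_{\zeta\eta}$. **Congruent side.** Let $\widetilde X=\{\tilde x\}\cup\{\tilde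 x_\alpha\mid\alpha\in\mathbb Z/N\}$ and $\widetilde Y=\{\tilde y_{k,\alpha}\mid k\ge1,\ \alpha\in\mathbb Z/N\}$, with $\tilde y_{k,\alpha}=\tilde x^{k-1}\tilde x_\alpha$, and let $\pi_{\widetilde Y}$ be the projection onto the first summand of $\mathbb Q\langle\langle\widetilde X\rangle\rangle=\mathbb Q\langle\langle\widetilde Y\rangle\rangle\oplus\mathbb Q\langle\langle\widetilde X\rangle\rangle\tilde x$. Let $\widetilde{\mathbf q}$ be the linear automorphism of $\mathbb Q\langle\langle\widetilde X\rangle\rangle$ with $\widetilde{\mathbf q}(\tilde x^{k_1-1}\tilde x_{\alpha_1}\cdots\tilde x^{k_r-1}\tilde x_{\alpha_r}\tilde x^{k_{r+1}-1})=\tilde x^{k_1-1}\tilde x_{\alpha_1-\alpha_2}\cdots\tilde x^{k_{r-1}-1}\tilde x_{\alpha_{r-1}-\alpha_r}\tilde x^{k_r-1}\tilde x_{\alpha_r}\tilde x^{k_{r+1}-1}$. Let $\widehat\Delta_{\widetilde{\mathrm{sh}}}$ be the algebra morphism for which all letters of $\widetilde X$ are primitive, and let $\widehat\Delta_{\tilde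 *}$ be the algebra morphism with $\tilde y_{k,\alpha}\mapsto\tilde y_{k,\alpha}\otimes1+1\otimes\tilde y_{k,\alpha}+\sum_{k_1+k_2=k}\tilde y_{k_1,\alpha}\otimes\tilde y_{k_2,\alpha}$. Put $$\tilde\psi_{\tilde *}=\pi_{\widetilde Y}(\widetilde{\mathbf q}^{-1}(\tilde\psi))+\sum_{n\ge2}\ \sum_{\alpha,\beta_1,\dots,\beta_n\in\mathbb Z/N}\frac{(-1)^{n-1}}{n\,N^{n}}(\tilde\psi\mid\tilde x^{n-1}\tilde x_\alpha)\,\tilde y_{1,\beta_1}\cdots\tilde y_{1,\beta_n}.$$ Then $\mathfrak{dmr}_0^{[N]}$ is the set of $\tilde\psi\in\mathbb Q\langle\langle\widetilde X\rangle\rangle$ such that $(\tilde\psi\mid\tilde x)=\sum_\alpha(\tilde\psi\mid\tilde x_\alpha)=0$; $\tilde\psi$ is primitive for $\widehat\Delta_{\widetilde{\mathrm{sh}}}$; $(\tilde\psi\mid\tilde x_\alpha-\tilde x_{-\alpha})=0$ for all $\alpha$; and $\tilde\psi_{\tilde *}$ is primitive for $\widehat\Delta_{\tilde *}$. For $d\mid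 N$ let $\widetilde X_d=\{\tilde x\}\cup\{\tilde x_\alpha\mid\alpha\in d\mathbb Z/N\mathbb Z\}\subset\widetilde X$ (so that its indices form a copy of $\mathbb Z/\tfrac Nd\mathbb Z$, through multiplication by $d$), and let $\tilde p^d_*,\tilde i_d^*:\mathbb Q\langle\langle\widetilde X\rangle\rangle\to\mathbb Q\langle\langle\widetilde X_d\rangle\rangle$ be the algebra morphisms with $\tilde p^d_*(\tilde x)=d\,\tilde x$, $\tilde p^d_*(\tilde x_\alpha)=d\,\tilde x_\alpha$ if $\alpha\in d\mathbb Z/N\mathbb Z$, $\tilde p^d_*(\tilde x_\alpha)=0$ otherwise, and $\tilde i_d^*(\tilde x)=\tilde x$, $\tilde i_d^*(\tilde x_\alpha)=\tilde x_{d\alpha}$. Put $$\mathfrak{dmrd}_0^{[N]}=\Big\{\tilde\psi\in\mathfrak{dmr}_0^{[N]}\ \Big|\ \forall d\mid N:\ \tilde p^d_*(\tilde\psi)=\tilde i_d^*(\tilde\psi)+(\tilde\psi\mid\tilde x_0)\sum_{\alpha\in d\mathbb Z/N\mathbb Z}\tilde x_\alpha\Big\},$$ where $\tilde x_0$ is the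 letter $\tilde x_\alpha$ with $\alpha=0$. Its bracket is $\langle\tilde\psi_1,\tilde\psi_2\rangle^{\widetilde{}}=\tilde d_{\tilde\psi_1}(\tilde\psi_2)-\tilde d_{\tilde\psi_2}(\tilde\psi_1)+[\tilde\psi_1,\tilde\psi_2]$, where $\tilde d_{\tilde\psi}$ is the derivation with $\tilde x\mapsto0$, $\tilde x_\alpha\mapsto\widetilde T_\alpha\big(\big[\sum_\beta\tilde x_\beta,\tilde\psi\big]\big)$, and $\widetilde T_\alpha=\frac1N\sum_{m=1}^N\zeta_N^{-m\alpha}\,\tilde t_m$ with $\tilde t_m$ the algebra automorphism $\tilde x\mapsto\tilde x$, $\tilde x_\beta\mapsto\zeta_N^{m\beta}\tilde x_\beta$; the operator $\widetilde T_\alpha$ preserves $\mathbb Q\langle\langle\widetilde X\rangle\rangle$. **Statement.** $\mathfrak{dmrd}_0^{[N]}$ and $\mathfrak{dmrd}_0^{\mu_N}$ are $\mathbb Q$-Lie algebras for these brackets, and the algebra morphism $$\mathcal F:\mathbb Q(\mu_N)\langle\langle\widetilde X\rangle\rangle\to\mathbb Q(\mu_N)\langle\langle X\rangle\rangle,\qquad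 \tilde x\mapsto x_0,\quad \tilde x_\alpha\mapsto\sum_{m=1}^N\zeta_N^{-m\alpha}x_{\zeta_N^m},$$ induces a $\mathbb Q(\mu_N)$-Lie algebra isomorphism $$\big(\mathbb Q(\mu_N)\,\hat\otimes_{\mathbb Q}\,\mathfrak{dmrd}_0^{[N]},\langle-,-\rangle^{\widetilde{}}\big)\xrightarrow{\ \simeq\ }\big(\mathbb Q(\mu_N)\,\hat\otimes_{\mathbb Q}\,\mathfrak{dmrd}_0^{\mu_N},\langle-,-\rangle\big).$$ (As $\mathbb Q(\mu_N)$ is finite over $\mathbb Q$, the completed tensor products are ordinary ones.) -/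

import Mathlib

open scoped TensorProduct

noncomputable section

/-! ## Noncommutative formal power series -/

/-- `NCSeries R A` is the algebra `R⟨⟨A⟩⟩` of noncommutative formal power series over the alphabet
`A`: a series is the family of its coefficients, indexed by the words in `A`.  The pairing
`(f | w)` is the evaluation `f w`. -/
def NCSeries (R A : Type*) : Type _ := List A → R

namespace NCSeries

@[ext] protected theorem ext {R A : Type*} {f g : NCSeries R A} (h : ∀ w, f w = g w) : f = g := funext h

/-- The series `∂_u f`, whose coefficient at `v` is the coefficient of `f` at `u v`. -/
def tail {R A : Type*} (u : List A) (f : NCSeries R A) : NCSeries R A := fun v => f (u ++ v)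

@[simp] theorem tail_apply {R A : Type*} (u v : List A) (f : NCSeries R A) :
    tail u f v = f (u ++ v) := rfl

section Basic

variable {R A : Type*} [CommRing R]

instance : AddCommGroup (NCSeries R A) := inferInstanceAs (AddCommGroup (List A → R))
instance {S : Type*} [Semiring S] [Module S R] : Module S (NCSeries R A) :=
  inferInstanceAs (Module S (List A → R))
instance {S T : Type*} [Semiring S] [Semiring T] [SMul S T] [Module S R] [Module T R]
    [IsScalarTower S T R] : IsScalarTower S T (NCSeries R A) :=
  inferInstanceAs (IsScalarTower S T (List A → R))

@[simp] protected theorem add_apply (f g : NCSeries R A) (w : List A) : (f + g) w = f w + g w := rfl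
@[simp] protected theorem sub_apply (f g : NCSeries R A) (w : List A) : (f - g) w = f w - g w := rfl
@[simp] protected theorem neg_apply (f : NCSeries R A) (w : List A) : (-f) w = -f w := rfl
@[simp] protected theorem zero_apply (w : List A) : (0 : NCSeries R A) w = 0 := rfl
@[simp] protected theorem smul_apply (r : R) (f : NCSeries R A) (w : List A) : (r • f) w = r * f w := rfl

@[simp] protected theorem sum_apply {ι : Type*} (s : Finset ι) (f : ι → NCSeries R A) (w : List A) :
    (∑ i ∈ s, f i) w = ∑ i ∈ s, f i w := by
  induction s using Finset.cons_induction with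
  | empty => simp
  | cons a s ha ih => simp [Finset.sum_cons, ih]

/-- The concatenation product: the coefficient of `w` in `f * g` is the sum of `f u * g v` over
all factorizations `w = u v`. -/
instance : Mul (NCSeries R A) where
  mul f g := fun w => ∑ i ∈ Finset.range (w.length + 1), f (w.take i) * g (w.drop i)

instance : One (NCSeries R A) where
  one := fun w => match w with
    | [] => 1
    | _ :: _ => 0

protected theorem mul_apply (f g : NCSeries R A) (w : List A) :
    (f * g) w = ∑ i ∈ Finset.range (w.length + 1), f (w.take i) * g (w.drop i) := rfl

@[simp] theorem one_nil : (1 : NCSeries R A) [] = 1 := rfl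
@[simp] theorem one_cons (a : A) (w : List A) : (1 : NCSeries R A) (a :: w) = 0 := rfl

theorem mul_nil (f g : NCSeries R A) : (f * g) [] = f [] * g [] := by
  simp [NCSeries.mul_apply]

theorem mul_cons (f g : NCSeries R A) (a : A) (w : List A) :
    (f * g) (a :: w) = f [] * g (a :: w) + (tail [a] f * g) w := by
  rw [NCSeries.mul_apply, List.length_cons, Finset.sum_range_succ', add_comm]
  simp [NCSeries.mul_apply]

protected theorem add_mul' (f g h : NCSeries R A) : (f + g) * h = f * h + g * h := by
  ext w; simp [NCSeries.mul_apply, add_mul, Finset.sum_add_distrib]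

protected theorem mul_add' (f g h : NCSeries R A) : f * (g + h) = f * g + f * h := by
  ext w; simp [NCSeries.mul_apply, mul_add, Finset.sum_add_distrib]

theorem smul_mul_series (r : R) (f g : NCSeries R A) : (r • f) * g = r • (f * g) := by
  ext w; simp [NCSeries.mul_apply, mul_assoc, Finset.mul_sum]

theorem mul_smul_series (r : R) (f g : NCSeries R A) : f * (r • g) = r • (f * g) := by
  ext w; simp [NCSeries.mul_apply, mul_left_comm, Finset.mul_sum]

theorem tail_mul (f g : NCSeries R A) (a : A) :
    tail [a] (f * g) = f [] • tail [a] g + tail [a] f * g := by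
  ext w; simp [mul_cons]

protected theorem zero_mul' (f : NCSeries R A) : 0 * f = 0 := by
  ext w; simp [NCSeries.mul_apply]

protected theorem mul_zero' (f : NCSeries R A) : f * 0 = 0 := by
  ext w; simp [NCSeries.mul_apply]

protected theorem mul_assoc' (f g h : NCSeries R A) : f * g * h = f * (g * h) := by
  ext w
  induction w generalizing f with
  | nil => simp [mul_nil, mul_assoc]
  | cons a w ih =>
    rw [mul_cons, mul_cons, mul_cons, tail_mul, NCSeries.add_mul', NCSeries.add_apply, ih, smul_mul_series, mul_nil]
    simp only [NCSeries.smul_apply]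
    ring

protected theorem one_mul' (f : NCSeries R A) : 1 * f = f := by
  ext w
  cases w with
  | nil => simp [mul_nil]
  | cons a w =>
    have : tail [a] (1 : NCSeries R A) = 0 := by ext v; rfl
    rw [mul_cons, this, NCSeries.zero_mul']; simp

protected theorem mul_one' (f : NCSeries R A) : f * 1 = f := by
  ext w
  induction w generalizing f with
  | nil => simp [mul_nil]
  | cons a w ih => rw [mul_cons, ih]; simp

instance : Ring (NCSeries R A) where
  left_distrib := NCSeries.mul_add'
  right_distrib := NCSeries.add_mul'
  zero_mul := NCSeries.zero_mul'
  mul_zero := NCSeries.mul_zero'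
  mul_assoc := NCSeries.mul_assoc'
  one_mul := NCSeries.one_mul'
  mul_one := NCSeries.mul_one'
  zsmul := (inferInstance : AddCommGroup (NCSeries R A)).zsmul
  zsmul_zero' := (inferInstance : AddCommGroup (NCSeries R A)).zsmul_zero'
  zsmul_succ' := (inferInstance : AddCommGroup (NCSeries R A)).zsmul_succ'
  zsmul_neg' := (inferInstance : AddCommGroup (NCSeries R A)).zsmul_neg'
  neg_add_cancel := neg_add_cancel
  sub_eq_add_neg := sub_eq_add_neg

/-- The letter `a`, as a series. -/
def X (a : A) : NCSeries R A := open Classical in fun w => if w = [a] then 1 else 0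

theorem X_nil (a : A) : (X a : NCSeries R A) [] = 0 := by simp [X]

theorem tail_X (a b : A) :
    tail [b] (X a : NCSeries R A) = open Classical in if b = a then 1 else 0 := by
  classical
  ext w
  by_cases h : b = a
  · subst h; cases w <;> simp [X]
  · simp [X, h]

theorem X_mul_nil (a : A) (f : NCSeries R A) : ((X a : NCSeries R A) * f) [] = 0 := by
  simp [mul_nil, X_nil]

theorem X_mul_cons (a b : A) (f : NCSeries R A) (w : List A) :
    ((X a : NCSeries R A) * f) (b :: w) = open Classical in if b = a then f w else 0 := by
  classical
  rw [mul_cons, X_nil, tail_X]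
  split_ifs <;> simp

theorem eq_add_sum [Fintype A] (f : NCSeries R A) :
    f = f [] • 1 + ∑ a, X a * tail [a] f := by
  classical
  ext w
  cases w with
  | nil => simp [X_mul_nil]
  | cons b w => simp [X_mul_cons]

end Basic

/-! ### Derivations given on the letters -/

section Derivation

variable {R A : Type*} [CommRing R] [Fintype A]

/-- The derivation of `R⟨⟨A⟩⟩` with `a ↦ c a` for every letter `a`, as a function.  It replaces, in
all possible ways, one letter `a` of a word by `c a`; hence its coefficient at `w` is the sum of
`f (u a v) * c a m` over all letters `a` and all factorizations `w = u m v`. -/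
def derFun (c : A → NCSeries R A) (f : NCSeries R A) : NCSeries R A :=
  fun w => ∑ i ∈ Finset.range (w.length + 1), ∑ a : A,
    (c a * tail (w.take i ++ [a]) f) (w.drop i)

theorem derFun_apply (c : A → NCSeries R A) (f : NCSeries R A) (w : List A) :
    derFun c f w = ∑ i ∈ Finset.range (w.length + 1), ∑ a : A,
      (c a * tail (w.take i ++ [a]) f) (w.drop i) := rfl

/-- The derivation of `R⟨⟨A⟩⟩` with `a ↦ c a` for every letter `a`; see `der_X`, `der_mul` and
`eq_der`. -/
def der (c : A → NCSeries R A) : NCSeries R A →ₗ[R] NCSeries R A where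
  toFun := derFun c
  map_add' f g := by
    ext w
    have h : ∀ u, tail u (f + g) = tail u f + tail u g := fun u => rfl
    simp [derFun_apply, h, mul_add, Finset.sum_add_distrib]
  map_smul' r f := by
    ext w
    have h : ∀ u, tail u (r • f) = r • tail u f := fun u => rfl
    simp [derFun_apply, h, mul_smul_series, Finset.mul_sum]

theorem der_apply (c : A → NCSeries R A) (f : NCSeries R A) (w : List A) :
    der c f w = ∑ i ∈ Finset.range (w.length + 1), ∑ a : A,
      (c a * tail (w.take i ++ [a]) f) (w.drop i) := rfl

theorem der_nil (c : A → NCSeries R A) (f : NCSeries R A) :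
    der c f [] = ∑ a, (c a * tail [a] f) [] := by
  simp [der_apply]

theorem der_cons (c : A → NCSeries R A) (f : NCSeries R A) (b : A) (w : List A) :
    der c f (b :: w) = ∑ a, (c a * tail [a] f) (b :: w) + der c (tail [b] f) w := by
  rw [der_apply, List.length_cons, Finset.sum_range_succ', add_comm]
  have h : ∀ u, tail u (tail [b] f) = tail (b :: u) f := fun u => rfl
  simp [der_apply, h]

theorem der_eq (c : A → NCSeries R A) (f : NCSeries R A) :
    der c f = ∑ a, c a * tail [a] f + ∑ a, X a * der c (tail [a] f) := by
  classical
  ext w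
  cases w with
  | nil => simp [der_nil, X_mul_nil]
  | cons b w => simp [der_cons, X_mul_cons]

theorem der_one (c : A → NCSeries R A) : der c 1 = 0 := by
  have h : ∀ a : A, tail [a] (1 : NCSeries R A) = 0 := fun a => by ext v; rfl
  rw [der_eq]; simp [h]

theorem der_X (c : A → NCSeries R A) (b : A) : der c (X b) = c b := by
  classical
  rw [der_eq]
  simp [tail_X, apply_ite, der_one]

theorem der_mul (c : A → NCSeries R A) (f g : NCSeries R A) :
    der c (f * g) = der c f * g + f * der c g := by
  ext w
  induction w generalizing f with
  | nil =>
    rw [NCSeries.add_apply, mul_nil, mul_nil, der_nil, der_nil, der_nil]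
    simp only [tail_mul, mul_add, NCSeries.add_apply, mul_nil, NCSeries.smul_apply,
      Finset.sum_add_distrib, Finset.mul_sum, Finset.sum_mul]
    rw [add_comm]
    simp only [mul_assoc, mul_left_comm]
  | cons b w ih =>
    have h1 : tail [b] (der c f) = ∑ a, tail [b] (c a * tail [a] f) + der c (tail [b] f) := by
      ext v; simp [der_cons]
    rw [NCSeries.add_apply, mul_cons, mul_cons, der_cons, h1, tail_mul, map_add, NCSeries.add_apply, ih, NCSeries.add_apply,
      der_cons, der_nil]
    simp only [map_smul, NCSeries.smul_apply, tail_mul, mul_add, mul_smul_series, NCSeries.add_apply, add_mul,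
      Finset.sum_add_distrib, Finset.mul_sum, Finset.sum_mul, NCSeries.sum_apply, smul_mul_series, ← mul_assoc]
    simp only [mul_cons (_ * _) g, mul_nil, tail_mul, Finset.sum_add_distrib, add_mul, NCSeries.add_apply,
      smul_mul_series, NCSeries.smul_apply]
    ring

/-- A linear map satisfying the Leibniz rule is determined by its values on the letters. -/
theorem eq_der (E : NCSeries R A →ₗ[R] NCSeries R A) (c : A → NCSeries R A)
    (hE : ∀ f g, E (f * g) = E f * g + f * E g) (hX : ∀ a, E (X a) = c a) : E = der c := by
  classical
  have h1 : E 1 = 0 := by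
    have := hE 1 1
    simpa using this
  have key : ∀ f, E f = ∑ a, c a * tail [a] f + ∑ a, X a * E (tail [a] f) := fun f => by
    conv_lhs => rw [eq_add_sum f]
    simp [h1, hE, hX, Finset.sum_add_distrib]
  refine LinearMap.ext fun f => ?_
  ext w
  induction w generalizing f with
  | nil => rw [key, der_eq]; simp [X_mul_nil]
  | cons b w ih => rw [key, der_eq]; simp [X_mul_cons, ih]

theorem der_add (c c' : A → NCSeries R A) : der (c + c') = der c + der c' := by
  refine (eq_der _ _ (fun f g => ?_) fun a => ?_).symm
  · simp only [LinearMap.add_apply, der_mul]; noncomm_ring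
  · simp [der_X]

theorem der_smul (r : R) (c : A → NCSeries R A) : der (r • c) = r • der c := by
  refine (eq_der _ _ (fun f g => ?_) fun a => ?_).symm
  · simp only [LinearMap.smul_apply, der_mul, smul_add, smul_mul_series, mul_smul_series]
  · simp [der_X]

theorem der_comm (c c' : A → NCSeries R A) (f : NCSeries R A) :
    der c (der c' f) - der c' (der c f) = der (fun a => der c (c' a) - der c' (c a)) f := by
  have := eq_der (der c ∘ₗ der c' - der c' ∘ₗ der c) (fun a => der c (c' a) - der c' (c a))
    (fun f g => by
      simp only [LinearMap.sub_apply, LinearMap.comp_apply, der_mul, map_add]; noncomm_ring)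
    (fun a => by simp [der_X])
  rw [← this]; rfl

end Derivation

/-! ### Continuous extension of algebra morphisms given on the letters -/

section Morphism

variable {R A M : Type*} [CommRing R] [Monoid M]

/-- Let `φ a`, for every letter `a`, be an element of the monoid algebra `R[M]`.  For a series
`f = ∑_w (f | w) w`, this is the formal sum `∑_w (f | w) φ(w)`, where `φ` is extended
multiplicatively to words, given by its coefficients at the elements of `M`.  Below it is only used
when, for each `p`, finitely many words `w` are such that `p` occurs in `φ(w)`; it is then the
(continuous) algebra morphism with `a ↦ φ a`. -/
def morphism (φ : A → MonoidAlgebra R M) (f : NCSeries R A) : M → R :=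
  fun p => ∑ᶠ w : FreeMonoid A, f w.toList * (FreeMonoid.lift φ w).coeff p

/-- The (continuous) algebra morphism `R⟨⟨A⟩⟩ → R⟨⟨B⟩⟩` that sends every letter `a` to the linear
combination `φ a` of letters of the finite alphabet `B`. -/
def letterMorphism {B : Type*} [Fintype B] (φ : A → B → R) (f : NCSeries R A) : NCSeries R B :=
  fun v => morphism (fun a => ∑ b : B, MonoidAlgebra.single (FreeMonoid.of b) (φ a b)) f
    (FreeMonoid.ofList v)

/-- An element of the completed tensor square `R⟨⟨A⟩⟩ ⊗̂ R⟨⟨A⟩⟩` is given by its coefficients at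
the pairs `(u, v)`, standing for `u ⊗ v`, of words; this is the element `f ⊗ g`. -/
def tmul (f g : NCSeries R A) : FreeMonoid A × FreeMonoid A → R :=
  fun p => f p.1.toList * g p.2.toList

/-- `f` is primitive for the coproduct which is the (continuous) algebra morphism
`Δ : R⟨⟨A⟩⟩ → R⟨⟨A⟩⟩ ⊗̂ R⟨⟨A⟩⟩` with `a ↦ Δ a`, that is, `Δ(f) = f ⊗ 1 + 1 ⊗ f`. -/
def IsPrimitive (Δ : A → MonoidAlgebra R (FreeMonoid A × FreeMonoid A)) (f : NCSeries R A) : Prop :=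
  morphism Δ f = tmul f 1 + tmul 1 f

/-- The shuffle coproduct on letters: `a ↦ a ⊗ 1 + 1 ⊗ a`. -/
def shuffleCoprod (a : A) : MonoidAlgebra R (FreeMonoid A × FreeMonoid A) :=
  MonoidAlgebra.single (FreeMonoid.of a, 1) 1 + MonoidAlgebra.single (1, FreeMonoid.of a) 1

/-- Extension of scalars `S ⊗ ℚ⟨⟨A⟩⟩ → S⟨⟨A⟩⟩`, `s ⊗ f ↦ s f`. -/
def scalarExt (S A : Type*) [CommRing S] [Algebra ℚ S] :
    S ⊗[ℚ] NCSeries ℚ A →ₗ[S] NCSeries S A :=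
  LinearMap.liftBaseChange S
    { toFun := fun f => (fun w => algebraMap ℚ S (f w) : NCSeries S A)
      map_add' := fun f g => funext fun w => map_add (algebraMap ℚ S) (f w) (g w)
      map_smul' := fun q f => funext fun w => by
        change algebraMap ℚ S (q * f w) = q • algebraMap ℚ S (f w)
        rw [map_mul, Algebra.smul_def] }

end Morphism

theorem letterMorphism_diag {R A : Type*} [CommRing R] [Fintype A] (c : A → R)
    (f : NCSeries R A) (v : List A) :
    letterMorphism (fun a b => open Classical in if b = a then c a else 0) f v =
      (v.map c).prod * f v := by
  classical
  have h1 : ∀ w : FreeMonoid A, FreeMonoid.lift (fun a => ∑ b : A,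
      MonoidAlgebra.single (FreeMonoid.of b) (if b = a then c a else 0)) w =
      MonoidAlgebra.single w (w.toList.map c).prod := by
    intro w
    have h2 : (fun a => ∑ b : A,
      MonoidAlgebra.single (FreeMonoid.of b) (if b = a then c a else 0)) =
      fun a => MonoidAlgebra.single (FreeMonoid.of a) (c a) := by
      funext a
      rw [Finset.sum_eq_single a] <;> simp +contextual
    rw [h2]
    induction w using FreeMonoid.inductionOn' with
    | one => simp [MonoidAlgebra.one_def]
    | of_mul a w ih => simp [ih, MonoidAlgebra.single_mul_single]
  rw [letterMorphism, morphism, finsum_eq_single _ (FreeMonoid.ofList v)]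
  · rw [h1]; simp [mul_comm]
  · intro w hw
    rw [h1]; simp [MonoidAlgebra.coeff_single, hw]

/-- If `d` is a linear map to derivations with `[d x, d y] = d (d x y - d y x + [x, y])`, then
`(x, y) ↦ d x y - d y x + [x, y]` satisfies the Jacobi identity. -/
theorem jacobi_aux {S : Type*} [Ring S] (d : S → S →+ S)
    (hd : ∀ x f g, d x (f * g) = d x f * g + f * d x g)
    (hc : ∀ x y f, d (d x y - d y x + (x * y - y * x)) f = d x (d y f) - d y (d x f))
    (x y z : S) :
    let B : S → S → S := fun x y => d x y - d y x + (x * y - y * x)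
    B x (B y z) = B (B x y) z + B y (B x z) := by
  intro B
  have hB : ∀ x y, B x y = d x y - d y x + (x * y - y * x) := fun _ _ => rfl
  have hc' : ∀ x y f, d (B x y) f = d x (d y f) - d y (d x f) := hc
  rw [hB x (B y z), hB (B x y) z, hB y (B x z), hc', hc', hc']
  simp only [hB, map_add, map_sub, hd]
  noncomm_ring

end NCSeries

section Main

open NCSeries

/-! ## Alphabets -/

/-- The group `μ_N` of complex `N`-th roots of unity. -/
abbrev Mu (N : ℕ) : Type := rootsOfUnity N ℂ

instance (N : ℕ) [NeZero N] : Fintype (Mu N) := Fintype.ofFinite _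

/-- The alphabet `X = {x₀, x_ζ | ζ ∈ μ_N}`; `none` is `x₀` and `some ζ` is `x_ζ`. -/
abbrev CycX (N : ℕ) := Option (Mu N)

/-- The alphabet `Y = {y_{k,ζ} | k > 0, ζ ∈ μ_N}`. -/
abbrev CycY (N : ℕ) := ℕ+ × Mu N

/-- The alphabet `X̃ = {x̃, x̃_α | α ∈ ℤ/N}`; `none` is `x̃` and `some α` is `x̃_α`. -/
abbrev CongX (N : ℕ) := Option (ZMod N)

/-- The alphabet `Ỹ = {ỹ_{k,α} | k > 0, α ∈ ℤ/N}`. -/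
abbrev CongY (N : ℕ) := ℕ+ × ZMod N

/-- The word in `X` (resp. `X̃`) corresponding to a word in `Y` (resp. `Ỹ`), through
`y_{k,ζ} ↦ x₀^{k-1} x_ζ`. -/
def yWord {G : Type*} (w : List (ℕ+ × G)) : List (Option G) :=
  w.flatMap fun y => List.replicate ((y.1 : ℕ) - 1) none ++ [some y.2]

/-- The projection `π_Y : R⟨⟨X⟩⟩ = R⟨⟨Y⟩⟩ ⊕ R⟨⟨X⟩⟩ x₀ → R⟨⟨Y⟩⟩`: it keeps the coefficients of the
words in `Y` and discards the words ending in `x₀`. -/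
def piY {R G : Type*} (f : NCSeries R (Option G)) : NCSeries R (ℕ+ × G) := fun w => f (yWord w)

/-! ## The cyclotomic side -/

section Cyclotomic

variable {R : Type*} [CommRing R] {N : ℕ}

/-- The automorphism `t_ζ` of `R⟨⟨X⟩⟩`: `x₀ ↦ x₀`, `x_η ↦ x_{ζη}`; see `tCyc_X`, `tCyc_mul`. -/
def tCyc (ζ : Mu N) : NCSeries R (CycX N) →ₗ[R] NCSeries R (CycX N) where
  toFun f := (fun w => f (w.map (Option.map (ζ⁻¹ * ·))) : NCSeries R (CycX N))
  map_add' _ _ := rfl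
  map_smul' _ _ := rfl

theorem tCyc_apply (ζ : Mu N) (f : NCSeries R (CycX N)) (w : List (CycX N)) :
    tCyc ζ f w = f (w.map (Option.map (ζ⁻¹ * ·))) := rfl

theorem tCyc_X (ζ : Mu N) (a : CycX N) :
    tCyc ζ (X a : NCSeries R (CycX N)) = X (a.map (ζ * ·)) := by
  classical
  ext w
  rw [tCyc_apply, X, X]
  congr 1
  rcases w with _ | ⟨b, _ | ⟨b', w⟩⟩
  · simp
  · cases a <;> cases b <;> simp [inv_mul_eq_iff_eq_mul]
  · simp

theorem tCyc_mul (ζ : Mu N) (f g : NCSeries R (CycX N)) :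
    tCyc ζ (f * g) = tCyc ζ f * tCyc ζ g := by
  ext w
  simp [tCyc_apply, NCSeries.mul_apply]

theorem tCyc_tCyc (ζ η : Mu N) (f : NCSeries R (CycX N)) :
    tCyc ζ (tCyc η f) = tCyc (ζ * η) f := by
  ext w
  have : (Option.map (η⁻¹ * ·) ∘ Option.map (ζ⁻¹ * ·) : CycX N → CycX N) =
      Option.map ((ζ * η)⁻¹ * ·) := by
    funext a; cases a <;> simp [mul_assoc]
  simp only [tCyc_apply, List.map_map, this]

theorem tCyc_one (f : NCSeries R (CycX N)) : tCyc 1 f = f := by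
  ext w
  simp [tCyc_apply]

/-- The values on the letters of the derivation `d_ψ`: `x₀ ↦ 0`, `x_ζ ↦ [x_ζ, t_ζ(ψ)]`. -/
def dCycLetter (ψ : NCSeries R (CycX N)) : CycX N → NCSeries R (CycX N)
  | none => 0
  | some ζ => X (some ζ) * tCyc ζ ψ - tCyc ζ ψ * X (some ζ)

theorem dCycLetter_add (ψ φ : NCSeries R (CycX N)) :
    dCycLetter (ψ + φ) = dCycLetter ψ + dCycLetter φ := by
  funext a
  cases a with
  | none => simp [dCycLetter]
  | some ζ => simp only [dCycLetter, map_add, Pi.add_apply]; noncomm_ring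

theorem dCycLetter_smul (r : R) (ψ : NCSeries R (CycX N)) :
    dCycLetter (r • ψ) = r • dCycLetter ψ := by
  funext a
  cases a with
  | none => simp [dCycLetter]
  | some ζ => simp only [dCycLetter, map_smul, Pi.smul_apply, mul_smul_series, smul_mul_series, smul_sub]

variable [NeZero N]

/-- The derivation `d_ψ` of `R⟨⟨X⟩⟩`. -/
def dCyc (ψ : NCSeries R (CycX N)) : NCSeries R (CycX N) →ₗ[R] NCSeries R (CycX N) :=
  der (dCycLetter ψ)

theorem dCyc_tCyc (ψ : NCSeries R (CycX N)) (ζ : Mu N) (f : NCSeries R (CycX N)) :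
    dCyc ψ (tCyc ζ f) = tCyc ζ (dCyc ψ f) := by
  have h := eq_der (tCyc ζ⁻¹ ∘ₗ dCyc ψ ∘ₗ tCyc ζ) (dCycLetter ψ)
    (fun f g => by
      simp only [LinearMap.comp_apply, tCyc_mul, dCyc, der_mul, map_add, tCyc_tCyc,
        inv_mul_cancel, tCyc_one])
    (fun a => by
      simp only [LinearMap.comp_apply, tCyc_X, dCyc, der_X]
      cases a with
      | none => simp [dCycLetter]
      | some η =>
        simp [dCycLetter, tCyc_mul, tCyc_tCyc, tCyc_X])
  have h2 := congrArg (tCyc ζ) (LinearMap.congr_fun h f)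
  simp only [LinearMap.comp_apply, tCyc_tCyc, mul_inv_cancel, tCyc_one] at h2
  exact h2

/-- The bracket `⟨ψ₁, ψ₂⟩ = d_{ψ₁}(ψ₂) - d_{ψ₂}(ψ₁) + [ψ₁, ψ₂]` on `R⟨⟨X⟩⟩`. -/
def bracketCyc (ψ₁ ψ₂ : NCSeries R (CycX N)) : NCSeries R (CycX N) :=
  dCyc ψ₁ ψ₂ - dCyc ψ₂ ψ₁ + (ψ₁ * ψ₂ - ψ₂ * ψ₁)

theorem dCyc_bracketCyc (x y f : NCSeries R (CycX N)) :
    dCyc (bracketCyc x y) f = dCyc x (dCyc y f) - dCyc y (dCyc x f) := by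
  unfold dCyc
  rw [der_comm]
  congr 2
  funext a
  cases a with
  | none => simp [dCycLetter]
  | some ζ =>
    have hx : ∀ g, der (dCycLetter x) (tCyc ζ g) = tCyc ζ (dCyc x g) := dCyc_tCyc x ζ
    have hy : ∀ g, der (dCycLetter y) (tCyc ζ g) = tCyc ζ (dCyc y g) := dCyc_tCyc y ζ
    simp only [dCycLetter, map_sub, der_mul, der_X, hx, hy, bracketCyc, map_add, tCyc_mul]
    noncomm_ring

end Cyclotomic

/-- `R⟨⟨X⟩⟩` as the Lie algebra with the bracket `⟨-,-⟩` (and not the commutator). -/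
def CycLie (R : Type*) (N : ℕ) : Type _ := NCSeries R (CycX N)

namespace CycLie

variable {R : Type*} [CommRing R] {N : ℕ}

instance : AddCommGroup (CycLie R N) := inferInstanceAs (AddCommGroup (NCSeries R (CycX N)))
instance : Module R (CycLie R N) := inferInstanceAs (Module R (NCSeries R (CycX N)))

/-- The underlying series. -/
def toSeries : CycLie R N ≃ₗ[R] NCSeries R (CycX N) := LinearEquiv.refl R (NCSeries R (CycX N))

variable [NeZero N]

instance : Bracket (CycLie R N) (CycLie R N) where
  bracket x y := toSeries.symm (bracketCyc (toSeries x) (toSeries y))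

theorem toSeries_lie (x y : CycLie R N) :
    toSeries ⁅x, y⁆ = bracketCyc (toSeries x) (toSeries y) := rfl

instance : LieRing (CycLie R N) where
  add_lie x y z := toSeries.injective <| by
    simp only [map_add, toSeries_lie, bracketCyc, dCyc, dCycLetter_add, der_add,
      LinearMap.add_apply]
    noncomm_ring
  lie_add x y z := toSeries.injective <| by
    simp only [map_add, toSeries_lie, bracketCyc, dCyc, dCycLetter_add, der_add,
      LinearMap.add_apply]
    noncomm_ring
  lie_self x := toSeries.injective <| by simp [toSeries_lie, bracketCyc]
  leibniz_lie x y z := toSeries.injective <| by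
    simp only [map_add, toSeries_lie]
    exact jacobi_aux (fun ψ => (dCyc ψ).toAddMonoidHom) (fun ψ f g => der_mul _ f g)
      (fun x y f => dCyc_bracketCyc x y f) (toSeries x) (toSeries y) (toSeries z)

instance : LieAlgebra R (CycLie R N) where
  lie_smul r x y := toSeries.injective <| by
    simp only [map_smul, toSeries_lie, bracketCyc, dCyc, dCycLetter_smul, der_smul,
      LinearMap.smul_apply, mul_smul_series, smul_mul_series, smul_add, smul_sub]

end CycLie

section CyclotomicDoubleShuffle

variable {N : ℕ}

/-- The action of the linear automorphism `𝐩` on words, where `ζ` is the product of the previous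
indices: `x₀^{k₁-1} x_{ζ₁} x₀^{k₂-1} x_{ζ₂} ⋯ ↦ x₀^{k₁-1} x_{ζζ₁} x₀^{k₂-1} x_{ζζ₁ζ₂} ⋯`. -/
def pWord (ζ : Mu N) : List (CycX N) → List (CycX N)
  | [] => []
  | none :: w => none :: pWord ζ w
  | some η :: w => some (ζ * η) :: pWord (ζ * η) w

/-- The inverse of `𝐩`: as `𝐩` permutes the words, the coefficient of `𝐩⁻¹(f)` at `w` is the
coefficient of `f` at `𝐩(w)`. -/
def pInv (f : NCSeries ℚ (CycX N)) : NCSeries ℚ (CycX N) := fun w => f (pWord 1 w)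

/-- `ψ_* = π_Y(𝐩⁻¹(ψ)) + ∑_{n ≥ 2} ((-1)^{n-1}/n) (ψ | x₀^{n-1} x₁) y_{1,1}^n`. -/
def starCyc (ψ : NCSeries ℚ (CycX N)) : NCSeries ℚ (CycY N) := fun w =>
  piY (pInv ψ) w + open Classical in
    if 2 ≤ w.length ∧ ∀ y ∈ w, y = ((1, 1) : CycY N) then
      (-1) ^ (w.length - 1) / (w.length : ℚ) *
        ψ (List.replicate (w.length - 1) none ++ [some 1])
    else 0

variable [NeZero N]

/-- The harmonic coproduct on letters:
`y_{k,ζ} ↦ y_{k,ζ} ⊗ 1 + 1 ⊗ y_{k,ζ} + ∑_{k₁+k₂=k, ζ₁ζ₂=ζ} y_{k₁,ζ₁} ⊗ y_{k₂,ζ₂}`. -/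
def harmonicCyc (y : CycY N) :
    MonoidAlgebra ℚ (FreeMonoid (CycY N) × FreeMonoid (CycY N)) :=
  MonoidAlgebra.single (FreeMonoid.of y, 1) 1 + MonoidAlgebra.single (1, FreeMonoid.of y) 1 +
    open Classical in
    ∑ k ∈ Finset.Icc 1 y.1 ×ˢ Finset.Icc 1 y.1 with k.1 + k.2 = y.1,
      ∑ ζ : Mu N × Mu N with ζ.1 * ζ.2 = y.2,
        MonoidAlgebra.single (FreeMonoid.of (k.1, ζ.1), FreeMonoid.of (k.2, ζ.2)) 1

/-- The cyclotomic double shuffle Lie algebra `𝔡𝔪𝔯₀^{μ_N}`, as a set of series. -/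
def dmrCyc (N : ℕ) [NeZero N] : Set (NCSeries ℚ (CycX N)) :=
  {ψ | (ψ [none] = 0 ∧ ψ [some 1] = 0) ∧
    IsPrimitive shuffleCoprod ψ ∧
    (∀ ζ : Mu N, ψ [some ζ] - ψ [some ζ⁻¹] = 0) ∧
    IsPrimitive harmonicCyc (starCyc ψ)}

/-- For `d ∣ N`, the algebra morphism `p^d_* : ℚ⟨⟨X⟩⟩ → ℚ⟨⟨X_d⟩⟩`, `x₀ ↦ d x₀`, `x_ζ ↦ x_{ζ^d}`.
Here `X_d = {x₀, x_ζ | ζ ∈ μ_{N/d}}` is viewed as a subset of `X`. -/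
def pDist (d : ℕ) : NCSeries ℚ (CycX N) → NCSeries ℚ (CycX N) :=
  letterMorphism fun a b => open Classical in
    match a with
    | none => if b = none then (d : ℚ) else 0
    | some ζ => if b = some (ζ ^ d) then 1 else 0

/-- For `d ∣ N`, the algebra morphism `i_d^* : ℚ⟨⟨X⟩⟩ → ℚ⟨⟨X_d⟩⟩`, `x₀ ↦ x₀`, `x_ζ ↦ x_ζ` if
`ζ ∈ μ_{N/d}` and `x_ζ ↦ 0` otherwise. -/
def iDist (d : ℕ) : NCSeries ℚ (CycX N) → NCSeries ℚ (CycX N) :=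
  letterMorphism fun a b => open Classical in
    match a with
    | none => if b = none then 1 else 0
    | some ζ => if ζ ^ (N / d) = 1 ∧ b = some ζ then 1 else 0

/-- The cyclotomic double shuffle and distribution Lie algebra `𝔡𝔪𝔯𝔡₀^{μ_N}`, as a set of
series. -/
def dmrdCyc (N : ℕ) [NeZero N] : Set (NCSeries ℚ (CycX N)) :=
  {ψ | ψ ∈ dmrCyc N ∧ ∀ d : ℕ, d ∣ N →
    pDist d ψ = iDist d ψ +
      (open Classical in ∑ ζ : Mu N with ζ ^ (N / d) = 1, ψ [some ζ]) • X (some 1)}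

end CyclotomicDoubleShuffle

/-! ## The congruent side -/

section Congruent

variable {R : Type*} [CommRing R] {N : ℕ}

/-- The total index in `ℤ/N` of a word in `X̃`; the letter `x̃` has index `0`. -/
def totalIndex (w : List (CongX N)) : ZMod N := (w.map fun a => a.getD 0).sum

/-- The operator `T̃_a`.  If `R` contains `ζ_N`, then `T̃_a = (1/N) ∑_{m=1}^N ζ_N^{-ma} t̃_m`, where
`t̃_m` is the algebra automorphism `x̃ ↦ x̃`, `x̃_α ↦ ζ_N^{mα} x̃_α`; this is `TCong_eq` below.  As
`t̃_m` multiplies a word of total index `b` by `ζ_N^{mb}`, this is the projection to the words of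
total index `a`, which is defined over any `R` and is the restriction of `T̃_a` to the rational
form. -/
def TCong (a : ZMod N) : NCSeries R (CongX N) →ₗ[R] NCSeries R (CongX N) where
  toFun f := (fun w => open Classical in if totalIndex w = a then f w else 0 :
    NCSeries R (CongX N))
  map_add' f g := funext fun w => by
    change (open Classical in if totalIndex w = a then f w + g w else 0) =
      (open Classical in if totalIndex w = a then f w else 0) +
      (open Classical in if totalIndex w = a then g w else 0)
    split_ifs <;> simp
  map_smul' r f := funext fun w => by
    change (open Classical in if totalIndex w = a then r * f w else 0) =
      r * (open Classical in if totalIndex w = a then f w else 0)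
    split_ifs <;> simp

theorem TCong_apply (a : ZMod N) (f : NCSeries R (CongX N)) (w : List (CongX N)) :
    TCong a f w = open Classical in if totalIndex w = a then f w else 0 := rfl

theorem TCong_TCong (a b : ZMod N) (f : NCSeries R (CongX N)) :
    TCong a (TCong b f) = open Classical in if a = b then TCong a f else 0 := by
  classical
  ext w
  by_cases h : a = b
  · subst h; by_cases h' : totalIndex w = a <;> simp [TCong_apply, h']
  · rw [if_neg h]
    by_cases h' : totalIndex w = a
    · simp [TCong_apply, h', h]
    · simp [TCong_apply, h']

theorem totalIndex_take_drop (w : List (CongX N)) (i : ℕ) :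
    totalIndex (w.take i) + totalIndex (w.drop i) = totalIndex w := by
  simp only [totalIndex, List.map_take, List.map_drop, List.sum_take_add_sum_drop]

theorem TCong_mul_TCong (a b : ZMod N) (f g : NCSeries R (CongX N)) :
    TCong (a + b) (f * TCong b g) = TCong a f * TCong b g := by
  classical
  ext w
  rw [TCong_apply]
  simp only [NCSeries.mul_apply, TCong_apply]
  by_cases h : totalIndex w = a + b
  · rw [if_pos h]
    refine Finset.sum_congr rfl fun i _ => ?_
    have h2 := totalIndex_take_drop w i
    by_cases h3 : totalIndex (w.drop i) = b
    · rw [h3, h, add_left_inj] at h2; simp [h2, h3]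
    · simp [h3]
  · rw [if_neg h]
    refine (Finset.sum_eq_zero fun i _ => ?_).symm
    have h2 := totalIndex_take_drop w i
    by_cases h3 : totalIndex (w.drop i) = b
    · have : totalIndex (w.take i) ≠ a := fun h4 => h (by rw [← h2, h3, h4])
      simp [this]
    · simp [h3]

theorem TCong_mul_TCong' (a b : ZMod N) (f g : NCSeries R (CongX N)) :
    TCong (a + b) (TCong a f * g) = TCong a f * TCong b g := by
  classical
  ext w
  rw [TCong_apply]
  simp only [NCSeries.mul_apply, TCong_apply]
  by_cases h : totalIndex w = a + b
  · rw [if_pos h]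
    refine Finset.sum_congr rfl fun i _ => ?_
    have h2 := totalIndex_take_drop w i
    by_cases h3 : totalIndex (w.take i) = a
    · rw [h3, h, add_right_inj] at h2; simp [h2, h3]
    · simp [h3]
  · rw [if_neg h]
    refine (Finset.sum_eq_zero fun i _ => ?_).symm
    have h2 := totalIndex_take_drop w i
    by_cases h3 : totalIndex (w.drop i) = b
    · have : totalIndex (w.take i) ≠ a := fun h4 => h (by rw [← h2, h3, h4])
      simp [this]
    · simp [h3]

theorem TCong_X (a : ZMod N) (b : CongX N) :
    TCong a (X b : NCSeries R (CongX N)) = open Classical in if b.getD 0 = a then X b else 0 := by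
  classical
  ext w
  rw [TCong_apply]
  by_cases hw : w = [b]
  · subst hw; simp only [totalIndex, List.map_cons, List.map_nil, List.sum_singleton]
    split_ifs <;> rfl
  · have : (X b : NCSeries R (CongX N)) w = 0 := by simp [X, hw]
    split_ifs <;> simp [this]

variable [NeZero N]

theorem sum_TCong (f : NCSeries R (CongX N)) : ∑ a, TCong a f = f := by
  classical
  ext w
  simp [TCong_apply]

/-- The values on the letters of the derivation `d̃_ψ`: `x̃ ↦ 0`, `x̃_α ↦ T̃_α([∑_β x̃_β, ψ])`. -/
def dCongLetter (ψ : NCSeries R (CongX N)) : CongX N → NCSeries R (CongX N)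
  | none => 0
  | some α => TCong α ((∑ β : ZMod N, X (some β)) * ψ - ψ * ∑ β : ZMod N, X (some β))

theorem dCongLetter_add (ψ φ : NCSeries R (CongX N)) :
    dCongLetter (ψ + φ) = dCongLetter ψ + dCongLetter φ := by
  funext a
  cases a with
  | none => simp [dCongLetter]
  | some ζ =>
    simp only [dCongLetter, Pi.add_apply, ← map_add]
    congr 1
    noncomm_ring

theorem dCongLetter_smul (r : R) (ψ : NCSeries R (CongX N)) :
    dCongLetter (r • ψ) = r • dCongLetter ψ := by
  funext a
  cases a with
  | none => simp [dCongLetter]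
  | some ζ => simp only [dCongLetter, Pi.smul_apply, mul_smul_series, smul_mul_series, ← smul_sub, map_smul]

/-- The derivation `d̃_ψ` of `R⟨⟨X̃⟩⟩`. -/
def dCong (ψ : NCSeries R (CongX N)) : NCSeries R (CongX N) →ₗ[R] NCSeries R (CongX N) :=
  der (dCongLetter ψ)

theorem dCong_TCong (ψ : NCSeries R (CongX N)) (a : ZMod N) (f : NCSeries R (CongX N)) :
    dCong ψ (TCong a f) = TCong a (dCong ψ f) := by
  classical
  have h := eq_der (∑ a, TCong a ∘ₗ dCong ψ ∘ₗ TCong a) (dCongLetter ψ)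
    (fun f g => by
      have key : ∀ b c, ∑ a, TCong a (dCong ψ (TCong a (TCong b f * TCong c g))) =
          TCong b (dCong ψ (TCong b f)) * TCong c g +
            TCong b f * TCong c (dCong ψ (TCong c g)) := by
        intro b c
        rw [Finset.sum_eq_single (b + c)]
        · rw [TCong_mul_TCong, TCong_TCong, if_pos rfl, dCong, der_mul, map_add,
            TCong_mul_TCong, TCong_mul_TCong']
        · intro a _ ha
          rw [← TCong_mul_TCong, TCong_TCong, if_neg ha, map_zero, map_zero]
        · simp
      simp only [LinearMap.sum_apply, LinearMap.comp_apply]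
      have h1 : ∑ a, TCong a (dCong ψ (TCong a (f * g))) =
          ∑ b, ∑ c, ∑ a, TCong a (dCong ψ (TCong a (TCong b f * TCong c g))) := by
        have h2 : f * g = ∑ b, ∑ c, TCong b f * TCong c g := by
          rw [← Finset.sum_mul_sum, sum_TCong, sum_TCong]
        simp only [h2, map_sum]
        rw [Finset.sum_comm]
        exact Finset.sum_congr rfl fun b _ => Finset.sum_comm
      rw [h1]
      simp only [key, Finset.sum_add_distrib, ← Finset.mul_sum, ← Finset.sum_mul, sum_TCong])
    (fun b => by
      simp only [LinearMap.sum_apply, LinearMap.comp_apply, TCong_X]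
      rw [Finset.sum_eq_single (b.getD 0)]
      · rw [if_pos rfl, dCong, der_X]
        cases b with
        | none => simp [dCongLetter]
        | some α => simp [dCongLetter, TCong_TCong]
      · intro a _ ha
        rw [if_neg (Ne.symm ha), map_zero, map_zero]
      · simp)
  have h2 : ∀ f, dCong ψ f = ∑ a, TCong a (dCong ψ (TCong a f)) := fun f => by
    have := LinearMap.congr_fun h f
    simp only [LinearMap.sum_apply, LinearMap.comp_apply] at this
    exact this.symm
  rw [h2 (TCong a f), h2 f, map_sum]
  refine Finset.sum_congr rfl fun b _ => ?_
  rw [TCong_TCong, TCong_TCong]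
  by_cases hb : b = a
  · subst hb; simp
  · simp [hb, Ne.symm hb]

/-- The bracket `⟨ψ₁, ψ₂⟩~ = d̃_{ψ₁}(ψ₂) - d̃_{ψ₂}(ψ₁) + [ψ₁, ψ₂]` on `R⟨⟨X̃⟩⟩`. -/
def bracketCong (ψ₁ ψ₂ : NCSeries R (CongX N)) : NCSeries R (CongX N) :=
  dCong ψ₁ ψ₂ - dCong ψ₂ ψ₁ + (ψ₁ * ψ₂ - ψ₂ * ψ₁)

theorem dCong_bracketCong (x y f : NCSeries R (CongX N)) :
    dCong (bracketCong x y) f = dCong x (dCong y f) - dCong y (dCong x f) := by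
  have hs : ∀ ψ : NCSeries R (CongX N), der (dCongLetter ψ) (∑ β : ZMod N, X (some β)) =
      (∑ β : ZMod N, X (some β)) * ψ - ψ * ∑ β : ZMod N, X (some β) := fun ψ => by
    simp only [map_sum, der_X, dCongLetter, sum_TCong]
  unfold dCong
  rw [der_comm]
  congr 2
  funext a
  cases a with
  | none => simp [dCongLetter]
  | some α =>
    have hx : ∀ g, der (dCongLetter x) (TCong α g) = TCong α (der (dCongLetter x) g) :=
      dCong_TCong x α
    have hy : ∀ g, der (dCongLetter y) (TCong α g) = TCong α (der (dCongLetter y) g) :=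
      dCong_TCong y α
    simp only [dCongLetter]
    rw [hx, hy, ← map_sub]
    congr 1
    rw [map_sub, map_sub, der_mul, der_mul, der_mul, der_mul, hs, hs, bracketCong, dCong, dCong]
    noncomm_ring

end Congruent

/-- `R⟨⟨X̃⟩⟩` as the Lie algebra with the bracket `⟨-,-⟩~` (and not the commutator). -/
def CongLie (R : Type*) (N : ℕ) : Type _ := NCSeries R (CongX N)

namespace CongLie

variable {R : Type*} [CommRing R] {N : ℕ}

instance : AddCommGroup (CongLie R N) := inferInstanceAs (AddCommGroup (NCSeries R (CongX N)))
instance : Module R (CongLie R N) := inferInstanceAs (Module R (NCSeries R (CongX N)))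

/-- The underlying series. -/
def toSeries : CongLie R N ≃ₗ[R] NCSeries R (CongX N) := LinearEquiv.refl R (NCSeries R (CongX N))

variable [NeZero N]

instance : Bracket (CongLie R N) (CongLie R N) where
  bracket x y := toSeries.symm (bracketCong (toSeries x) (toSeries y))

theorem toSeries_lie (x y : CongLie R N) :
    toSeries ⁅x, y⁆ = bracketCong (toSeries x) (toSeries y) := rfl

instance : LieRing (CongLie R N) where
  add_lie x y z := toSeries.injective <| by
    simp only [map_add, toSeries_lie, bracketCong, dCong, dCongLetter_add, der_add,
      LinearMap.add_apply]
    noncomm_ring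
  lie_add x y z := toSeries.injective <| by
    simp only [map_add, toSeries_lie, bracketCong, dCong, dCongLetter_add, der_add,
      LinearMap.add_apply]
    noncomm_ring
  lie_self x := toSeries.injective <| by simp [toSeries_lie, bracketCong]
  leibniz_lie x y z := toSeries.injective <| by
    simp only [map_add, toSeries_lie]
    exact jacobi_aux (fun ψ => (dCong ψ).toAddMonoidHom) (fun ψ f g => der_mul _ f g)
      (fun x y f => dCong_bracketCong x y f) (toSeries x) (toSeries y) (toSeries z)

instance : LieAlgebra R (CongLie R N) where
  lie_smul r x y := toSeries.injective <| by
    simp only [map_smul, toSeries_lie, bracketCong, dCong, dCongLetter_smul, der_smul,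
      LinearMap.smul_apply, mul_smul_series, smul_mul_series, smul_add, smul_sub]

end CongLie

section CongruentDoubleShuffle

variable {N : ℕ}

/-- The action of the linear automorphism `𝐪̃` on words:
`x̃^{k₁-1} x̃_{α₁} ⋯ x̃^{k_r-1} x̃_{α_r} x̃^{k-1} ↦
x̃^{k₁-1} x̃_{α₁-α₂} ⋯ x̃^{k_{r-1}-1} x̃_{α_{r-1}-α_r} x̃^{k_r-1} x̃_{α_r} x̃^{k-1}`.  In the last case
`(w.reduceOption.headD 0)` is the index following `α`, if there is one, and `0` otherwise. -/
def qWord : List (CongX N) → List (CongX N)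
  | [] => []
  | none :: w => none :: qWord w
  | some α :: w => some (α - w.reduceOption.headD 0) :: qWord w

/-- The inverse of `𝐪̃`: as `𝐪̃` permutes the words, the coefficient of `𝐪̃⁻¹(f)` at `w` is the
coefficient of `f` at `𝐪̃(w)`. -/
def qInv (f : NCSeries ℚ (CongX N)) : NCSeries ℚ (CongX N) := fun w => f (qWord w)

/-- The harmonic coproduct on letters:
`ỹ_{k,α} ↦ ỹ_{k,α} ⊗ 1 + 1 ⊗ ỹ_{k,α} + ∑_{k₁+k₂=k} ỹ_{k₁,α} ⊗ ỹ_{k₂,α}`. -/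
def harmonicCong (y : CongY N) :
    MonoidAlgebra ℚ (FreeMonoid (CongY N) × FreeMonoid (CongY N)) :=
  MonoidAlgebra.single (FreeMonoid.of y, 1) 1 + MonoidAlgebra.single (1, FreeMonoid.of y) 1 +
    ∑ k ∈ Finset.Icc 1 y.1 ×ˢ Finset.Icc 1 y.1 with k.1 + k.2 = y.1,
      MonoidAlgebra.single (FreeMonoid.of (k.1, y.2), FreeMonoid.of (k.2, y.2)) 1

variable [NeZero N]

/-- `ψ_* = π_Ỹ(𝐪̃⁻¹(ψ)) + ∑_{n ≥ 2} ∑_{α, β₁, …, β_n ∈ ℤ/N}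
((-1)^{n-1}/(n N^n)) (ψ | x̃^{n-1} x̃_α) ỹ_{1,β₁} ⋯ ỹ_{1,β_n}`. -/
def starCong (ψ : NCSeries ℚ (CongX N)) : NCSeries ℚ (CongY N) := fun w =>
  piY (qInv ψ) w + open Classical in
    if 2 ≤ w.length ∧ ∀ y ∈ w, y.1 = 1 then
      ∑ α : ZMod N, (-1) ^ (w.length - 1) / ((w.length : ℚ) * (N : ℚ) ^ w.length) *
        ψ (List.replicate (w.length - 1) none ++ [some α])
    else 0

/-- The congruent double shuffle Lie algebra `𝔡𝔪𝔯₀^{[N]}`, as a set of series. -/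
def dmrCong (N : ℕ) [NeZero N] : Set (NCSeries ℚ (CongX N)) :=
  {ψ | (ψ [none] = 0 ∧ ∑ α : ZMod N, ψ [some α] = 0) ∧
    IsPrimitive shuffleCoprod ψ ∧
    (∀ α : ZMod N, ψ [some α] - ψ [some (-α)] = 0) ∧
    IsPrimitive harmonicCong (starCong ψ)}

/-- For `d ∣ N`, the algebra morphism `p̃^d_* : ℚ⟨⟨X̃⟩⟩ → ℚ⟨⟨X̃_d⟩⟩`, `x̃ ↦ d x̃`, `x̃_α ↦ d x̃_α` if
`α ∈ dℤ/Nℤ` and `x̃_α ↦ 0` otherwise.  Here `X̃_d = {x̃, x̃_β | β ∈ ℤ/(N/d)ℤ}` is viewed as the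
subset `{x̃, x̃_α | α ∈ dℤ/Nℤ}` of `X̃` through the isomorphism `ℤ/(N/d)ℤ ≃ dℤ/Nℤ` given by
multiplication by `d`. -/
def pDistCong (d : ℕ) : NCSeries ℚ (CongX N) → NCSeries ℚ (CongX N) :=
  letterMorphism fun a b => open Classical in
    match a with
    | none => if b = none then (d : ℚ) else 0
    | some α => if (∃ β : ZMod N, α = d * β) ∧ b = some α then (d : ℚ) else 0

/-- For `d ∣ N`, the algebra morphism `ĩ_d^* : ℚ⟨⟨X̃⟩⟩ → ℚ⟨⟨X̃_d⟩⟩`, `x̃ ↦ x̃`, `x̃_α ↦ x̃_{dα}`, with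
`X̃_d` viewed as a subset of `X̃` as before. -/
def iDistCong (d : ℕ) : NCSeries ℚ (CongX N) → NCSeries ℚ (CongX N) :=
  letterMorphism fun a b => open Classical in
    match a with
    | none => if b = none then 1 else 0
    | some α => if b = some (d * α) then 1 else 0

/-- The Lie algebra `𝔡𝔪𝔯𝔡₀^{[N]}` of the congruent double shuffle and distribution relations, as a
set of series.  The last sum runs over the letters of `X̃_d` other than `x̃`. -/
def dmrdCong (N : ℕ) [NeZero N] : Set (NCSeries ℚ (CongX N)) :=
  {ψ | ψ ∈ dmrCong N ∧ ∀ d : ℕ, d ∣ N →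
    pDistCong d ψ = iDistCong d ψ +
      ψ [some 0] • open Classical in
        ∑ α : ZMod N with ∃ β : ZMod N, α = d * β, X (some α)}

end CongruentDoubleShuffle

/-! ## The comparison map -/

/-- The cyclotomic field `ℚ(μ_N)`. -/
abbrev CycField (N : ℕ) : IntermediateField ℚ ℂ := IntermediateField.adjoin ℚ {z : ℂ | z ^ N = 1}

section Comparison

variable (N : ℕ) [NeZero N]

/-- `ζ_N = exp(2πi/N)`, as an element of `μ_N`. -/
def zetaMu : Mu N := (Complex.isPrimitiveRoot_exp N (NeZero.ne N)).toRootsOfUnity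

/-- `ζ_N = exp(2πi/N)`, as an element of `ℚ(μ_N)`. -/
def zetaField : CycField N :=
  ⟨Complex.exp (2 * Real.pi * Complex.I / N), IntermediateField.subset_adjoin ℚ _
    (Complex.isPrimitiveRoot_exp N (NeZero.ne N)).pow_eq_one⟩

theorem zetaField_primitive : IsPrimitiveRoot (zetaField N) N := by
  have h := Complex.isPrimitiveRoot_exp N (NeZero.ne N)
  exact IsPrimitiveRoot.of_map_of_injective (f := (CycField N).val) h
    (CycField N).val.toRingHom.injective

/-- The formula `T̃_a = (1/N) ∑_{m=1}^N ζ_N^{-ma} t̃_m`, where `t̃_m` is the algebra automorphism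
`x̃ ↦ x̃`, `x̃_α ↦ ζ_N^{mα} x̃_α`. -/
theorem TCong_eq (a : ZMod N) (f : NCSeries (CycField N) (CongX N)) :
    TCong a f = (N : CycField N)⁻¹ • ∑ m ∈ Finset.Icc 1 N,
      zetaField N ^ (-(m * a.val : ℤ)) • letterMorphism (fun x y => open Classical in
        if y = x then x.elim 1 fun α => zetaField N ^ (m * α.val) else 0) f := by
  classical
  have hz := zetaField_primitive N
  have hz0 : zetaField N ≠ 0 := hz.ne_zero (NeZero.ne N)
  have hN : (N : CycField N) ≠ 0 := Nat.cast_ne_zero.mpr (NeZero.ne N)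
  have hpow : ∀ j k : ℤ, ((j : ZMod N) = k) → zetaField N ^ j = zetaField N ^ k := by
    intro j k h
    rw [ZMod.intCast_eq_intCast_iff_dvd_sub] at h
    have h2 := (hz.zpow_eq_one_iff_dvd _).mpr h
    rw [zpow_sub₀ hz0, div_eq_one_iff_eq (zpow_ne_zero _ hz0)] at h2
    exact h2.symm
  have hprod : ∀ (m : ℕ) (w : List (CongX N)),
      (w.map fun x => x.elim 1 fun α => zetaField N ^ (m * α.val)).prod =
        zetaField N ^ (m * (totalIndex w).val : ℤ) := by
    intro m w
    induction w with
    | nil => simp [totalIndex]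
    | cons x w ih =>
      rw [List.map_cons, List.prod_cons, ih]
      cases x with
      | none => simp [totalIndex]
      | some α =>
        have h1 : zetaField N ^ (m * α.val) = zetaField N ^ ((m * α.val : ℕ) : ℤ) :=
          (zpow_natCast _ _).symm
        simp only [Option.elim_some, h1]
        rw [← zpow_add₀ hz0]
        apply hpow
        simp only [totalIndex, List.map_cons, List.sum_cons, Option.getD_some]
        push_cast
        simp only [ZMod.natCast_val, ZMod.cast_id', id_eq]
        ring
  refine NCSeries.ext fun w => ?_
  rw [TCong_apply, NCSeries.smul_apply, NCSeries.sum_apply]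
  simp only [NCSeries.smul_apply]
  have hterm : ∀ m : ℕ, letterMorphism (fun x y => if y = x then
      x.elim 1 fun α => zetaField N ^ (m * α.val) else 0) f w =
      zetaField N ^ (m * (totalIndex w).val : ℤ) * f w := by
    intro m
    have := letterMorphism_diag
      (fun x : CongX N => x.elim (1 : CycField N) fun α => zetaField N ^ (m * α.val)) f w
    rw [hprod] at this
    convert this
  have hterm2 : ∀ m : ℕ, zetaField N ^ (-(m * a.val : ℤ)) *
      (zetaField N ^ (m * (totalIndex w).val : ℤ) * f w) =
      (zetaField N ^ ((totalIndex w).val - a.val : ℤ)) ^ m * f w := by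
    intro m
    rw [← mul_assoc, ← zpow_add₀ hz0, ← zpow_natCast, ← zpow_mul]
    congr 2
    ring
  have hsum : ∑ m ∈ Finset.Icc 1 N, zetaField N ^ (-(m * a.val : ℤ)) *
      letterMorphism (fun x y => if y = x then
        x.elim 1 fun α => zetaField N ^ (m * α.val) else 0) f w =
      (∑ m ∈ Finset.Icc 1 N, (zetaField N ^ ((totalIndex w).val - a.val : ℤ)) ^ m) * f w := by
    rw [Finset.sum_mul]
    exact Finset.sum_congr rfl fun m _ => by rw [hterm, hterm2]
  have hmod : (zetaField N ^ ((totalIndex w).val - a.val : ℤ)) ^ N = 1 := by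
    rw [← zpow_natCast, ← zpow_mul, mul_comm, zpow_mul, zpow_natCast, hz.pow_eq_one, one_zpow]
  by_cases h : totalIndex w = a
  · rw [if_pos h]
    refine Eq.trans ?_ (congrArg (fun t => (N : CycField N)⁻¹ * t) hsum).symm
    simp [h, hN]
  · rw [if_neg h]
    refine Eq.trans ?_ (congrArg (fun t => (N : CycField N)⁻¹ * t) hsum).symm
    have hne : zetaField N ^ ((totalIndex w).val - a.val : ℤ) ≠ 1 := by
      intro h1
      apply h
      rw [hz.zpow_eq_one_iff_dvd, ← ZMod.intCast_zmod_eq_zero_iff_dvd] at h1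
      push_cast at h1
      simpa [sub_eq_zero] using h1
    have hgeom : ∑ m ∈ Finset.Icc 1 N,
        (zetaField N ^ ((totalIndex w).val - a.val : ℤ)) ^ m = 0 := by
      have h3 : ∑ m ∈ Finset.Icc 1 N, (zetaField N ^ ((totalIndex w).val - a.val : ℤ)) ^ m =
          (zetaField N ^ ((totalIndex w).val - a.val : ℤ)) *
            ∑ m ∈ Finset.range N, (zetaField N ^ ((totalIndex w).val - a.val : ℤ)) ^ m := by
        rw [Finset.mul_sum, ← Finset.Ico_add_one_right_eq_Icc, Finset.sum_Ico_eq_sum_range]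
        exact Finset.sum_congr rfl fun m _ => by rw [pow_add, pow_one]
      rw [h3, geom_sum_eq hne, hmod]
      simp
    rw [hgeom, zero_mul, mul_zero]

/-- The algebra morphism `ℱ : ℚ(μ_N)⟨⟨X̃⟩⟩ → ℚ(μ_N)⟨⟨X⟩⟩`,
`x̃ ↦ x₀`, `x̃_α ↦ ∑_{m=1}^N ζ_N^{-mα} x_{ζ_N^m}`. -/
def comparison : NCSeries (CycField N) (CongX N) → NCSeries (CycField N) (CycX N) :=
  letterMorphism fun a b => open Classical in
    match a with
    | none => if b = none then 1 else 0
    | some α => ∑ m ∈ Finset.Icc 1 N,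
        if b = some (zetaMu N ^ m) then zetaField N ^ (-(m * α.val : ℤ)) else 0

variable {N}

/-- The embedding `ℚ(μ_N) ⊗ L → ℚ(μ_N)⟨⟨X̃⟩⟩`, `r ⊗ ψ ↦ r ψ`, for a Lie subalgebra `L` of
`(ℚ⟨⟨X̃⟩⟩, ⟨-,-⟩~)`. -/
def CongLie.extend (L : LieSubalgebra ℚ (CongLie ℚ N)) :
    CycField N ⊗[ℚ] L →ₗ[CycField N] NCSeries (CycField N) (CongX N) :=
  scalarExt (CycField N) (CongX N) ∘ₗ
    (CongLie.toSeries.toLinearMap ∘ₗ L.toSubmodule.subtype).baseChange (CycField N)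

/-- The embedding `ℚ(μ_N) ⊗ L → ℚ(μ_N)⟨⟨X⟩⟩`, `r ⊗ ψ ↦ r ψ`, for a Lie subalgebra `L` of
`(ℚ⟨⟨X⟩⟩, ⟨-,-⟩)`. -/
def CycLie.extend (L : LieSubalgebra ℚ (CycLie ℚ N)) :
    CycField N ⊗[ℚ] L →ₗ[CycField N] NCSeries (CycField N) (CycX N) :=
  scalarExt (CycField N) (CycX N) ∘ₗ
    (CycLie.toSeries.toLinearMap ∘ₗ L.toSubmodule.subtype).baseChange (CycField N)

end Comparison

end Main

end

/-!
All conditions are `ℚ`-linear in the coefficients of a series, and make sense over every field `K`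
of characteristic `0`.  A series is primitive for one of the coproducts if and only if it vanishes on
the corresponding quasi-shuffle products of nonempty words (`isPrimitive_iff_isPrim`); this is the
form in which primitivity is used.  The proof has two independent parts: the bracket preserves the
cyclotomic algebra over `K`, and `ℱ` identifies the congruent conditions over `ℚ(μ_N)` with the
cyclotomic ones.

**The cyclotomic bracket.**  Write `ψ = ∑ Φ_i x₀^i` with `Φ_i` in the letters `y_{k,ζ}` (after
`𝐩⁻¹`), and let `φ_0 = ψ_*` and `φ_i = Φ_i` for `i > 0`.  As `ψ` vanishes on shuffle products
with `x₀`, the series `φ_{i+1}` is obtained from `φ_i`, up to a scalar, by the coderivation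
`y_{k+1,ζ} ↦ k y_{k,ζ}` (`rightSeq_succ`); hence all `φ_i` are primitive for the harmonic coproduct
(`isPrim_starSeq`).  Put `φ(t) = ∑ φ_i t^{-i}`, let `χ(t)` be its image under the anti-automorphism
`t ↦ -t`, `y_{k,ζ} ↦ (-1)^k y_{k,ζ⁻¹}`, and let `y(t) = 1 + ∑ t^k y_{k,ζ}`, which is group-like.  The
series `Z(t) = φ(t) y(t) + y(t) χ(t)` satisfies `Δ(Z) = Z ⊗ y + y ⊗ Z` (`qsum_zSer`).

The operator `f ↦ ψ f + d_ψ(f)`, on the letters `y_{k,ζ}`, is the derivation `y(t) ↦ Z(t)` up to a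
multiplication by `ψ` on the right, with `Φ_0` in place of `ψ_*` (`flat_mul_add_dCyc`).  Here the
terms `t_ζ(ψ) x_ζ` of `d_ψ(x_ζ)` give `y(t) χ(t)` because the shuffle antipode maps `ψ` to `-ψ`.  The
derivation `y(t) ↦ Z(t)` is a coderivation, provided that `Z(t)` has no terms `t^k` with `k ≤ 0`
(`isCoderLetters_zFun`, `qsum_replaceDer`).  This is `zSer_eq_zero`: by the shuffle antipode, the
coefficient of `t` in `Z(t)`, in index `1`, is a series in `y_{1,1}`, which comes from the correction
term of `ψ_*` (`zSer_rightSeq_one`, `zSer_starCorr_one`), and then the comparison of the coefficients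
of `t` and of `t^0` in the formula for `Δ(Z)` suffices, together with the parity in weight `1` and an
element `g` of `μ_N` with `g ≠ 1` and `g² ≠ 1`.  The latter is where `N ≥ 3` is used.  The same
argument shows that `(ψ | x₀^{n-1} x_1) = 0` for even `n`, so that the correction term is odd and
changes the derivation by an inner one.  The result is
`⟨ψ₁, ψ₂⟩_* = D₁(ψ₂_*) - D₂(ψ₁_*) + [ψ₂_*, ψ₁_*]` with coderivations `D₁` and `D₂`
(`starSer_bracketCyc`), which is primitive.

The scalar correction terms of the distribution relations vanish on both sides (`mem_dmrdCyc_iff`,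
`mem_dmrdCong_iff`); the relations then say that two substitutions of letters agree at `ψ`, and both
of them intertwine the derivations `d_ψ` (`letterSub_der`).

**The comparison.**  `ℱ` is a finite Fourier transform in the indices of the letters, with the inverse
given by `fInv`.  It turns `T̃_α` into an average of the automorphisms `t_ζ` (`letterSub_fMat_TCong`),
and hence one bracket into the other (`letterSub_fMat_bracketCong`).  It turns `𝐪̃` into `𝐩` and the
pointwise product of indices on the congruent side into the convolution on `μ_N`, hence one harmonic
coproduct into the other (`letterSub_fMat_pyWord`, `isPrim_yFourier_iff`).  The distribution relations
correspond by Poisson summation (`distribution_iff`).  Altogether, `ℱ ψ̃` satisfies the cyclotomic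
conditions if and only if `ψ̃` satisfies the congruent ones (`isDmrdCyc_letterSub_fMat_iff`).  As
`ℚ(μ_N)` has finite degree, the tensor products are the spaces of series over `ℚ(μ_N)` which satisfy
the conditions (`mem_range_extendCong`, `mem_range_extendCyc`).  The closure of the congruent algebra
under its bracket follows from that of the cyclotomic one (`IsDmrdCong.bracketCong`).
-/

set_option linter.unusedSectionVars false

/-! ### Quasi-shuffle products of words -/

section QuasiShuffle

variable {A M M' M'' : Type*}

/-- The words (with multiplicity) occurring in the quasi-shuffle product of two words, for a
partially defined product `m` on the letters.  The shuffle product is the case where `m` is defined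
nowhere. -/
def quasiShuffle (m : A → A → Option A) : List A → List A → List (List A)
  | [], v => [v]
  | a :: u, [] => [a :: u]
  | a :: u, b :: v => (quasiShuffle m u (b :: v)).map (a :: ·) ++
      (quasiShuffle m (a :: u) v).map (b :: ·) ++
      (m a b).elim [] fun c => (quasiShuffle m u v).map (c :: ·)

/-- The partial product which is defined nowhere; its quasi-shuffle product is the shuffle
product. -/
def noMul : A → A → Option A := fun _ _ => none

/-- A function on words, extended linearly and evaluated at the quasi-shuffle product of `u` and
`v`: this is the coefficient at `u ⊗ v` of the quasi-shuffle coproduct of the series `f`. -/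
def qsum [AddCommMonoid M] (m : A → A → Option A) (f : List A → M) (u v : List A) : M :=
  ((quasiShuffle m u v).map f).sum

/-- `f` is primitive for the quasi-shuffle coproduct: it vanishes at the empty word and at all
quasi-shuffle products of nonempty words. -/
def IsPrim [AddCommMonoid M] (m : A → A → Option A) (f : List A → M) : Prop :=
  f [] = 0 ∧ ∀ u v, u ≠ [] → v ≠ [] → qsum m f u v = 0

section Qsum

variable [AddCommMonoid M] [AddCommMonoid M'] (m : A → A → Option A)

@[simp] theorem quasiShuffle_nil_left (v : List A) : quasiShuffle m [] v = [v] := by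
  cases v <;> simp [quasiShuffle]

@[simp] theorem quasiShuffle_nil_right (u : List A) : quasiShuffle m u [] = [u] := by
  cases u <;> simp [quasiShuffle]

@[simp] theorem qsum_nil_left (f : List A → M) (v : List A) : qsum m f [] v = f v := by
  simp [qsum]

@[simp] theorem qsum_nil_right (f : List A → M) (u : List A) : qsum m f u [] = f u := by
  simp [qsum]

theorem qsum_cons_cons (f : List A → M) (a b : A) (u v : List A) :
    qsum m f (a :: u) (b :: v) = qsum m (fun w => f (a :: w)) u (b :: v) +
      qsum m (fun w => f (b :: w)) (a :: u) v +
      (m a b).elim 0 fun c => qsum m (fun w => f (c :: w)) u v := by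
  rw [qsum, quasiShuffle]
  cases m a b <;> simp [qsum, Function.comp_def, add_assoc]

theorem qsum_add (f g : List A → M) (u v : List A) :
    qsum m (fun w => f w + g w) u v = qsum m f u v + qsum m g u v := by
  simp only [qsum, List.sum_map_add]

@[simp] theorem qsum_zero (u v : List A) : qsum m (fun _ => (0 : M)) u v = 0 := by
  simp [qsum]

theorem map_qsum (L : M →+ M') (f : List A → M) (u v : List A) :
    L (qsum m f u v) = qsum m (fun w => L (f w)) u v := by
  simp [qsum, map_list_sum, Function.comp_def]

theorem qsum_sum {ι : Type*} (s : Finset ι) (f : ι → List A → M) (u v : List A) :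
    qsum m (fun w => ∑ i ∈ s, f i w) u v = ∑ i ∈ s, qsum m (f i) u v := by
  induction s using Finset.cons_induction with
  | empty => simp
  | cons a s ha ih => simp only [Finset.sum_cons, qsum_add, ih]

theorem qsum_mul_left {R : Type*} [CommRing R] (r : R) (f : List A → R) (u v : List A) :
    qsum m (fun w => r * f w) u v = r * qsum m f u v :=
  (map_qsum m (AddMonoidHom.mulLeft r) f u v).symm

variable {m}

theorem qsum_congr {f g : List A → M} {u v : List A} (h : ∀ w ∈ quasiShuffle m u v, f w = g w) :
    qsum m f u v = qsum m g u v := by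
  unfold qsum; rw [List.map_congr_left h]

theorem IsPrim.add {f g : List A → M} (hf : IsPrim m f) (hg : IsPrim m g) :
    IsPrim m fun w => f w + g w :=
  ⟨by simp [hf.1, hg.1], fun u v hu hv => by rw [qsum_add, hf.2 u v hu hv, hg.2 u v hu hv, add_zero]⟩

theorem IsPrim.map (L : M →+ M') {f : List A → M} (hf : IsPrim m f) :
    IsPrim m fun w => L (f w) :=
  ⟨by simp [hf.1], fun u v hu hv => by rw [← map_qsum, hf.2 u v hu hv, map_zero]⟩

theorem IsPrim.mul_left {R : Type*} [CommRing R] (r : R) {f : List A → R} (hf : IsPrim m f) :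
    IsPrim m fun w => r * f w := hf.map (AddMonoidHom.mulLeft r)

theorem IsPrim.sub {R : Type*} [CommRing R] {f g : List A → R} (hf : IsPrim m f)
    (hg : IsPrim m g) : IsPrim m fun w => f w - g w := by
  simpa [sub_eq_add_neg] using hf.add (hg.mul_left (-1))

/-- A quantity which is additive on letters is constant on the words of a quasi-shuffle product. -/
theorem eq_mul_of_mem_quasiShuffle {P : Type*} [CommMonoid P] (h : A → P)
    (hm : ∀ a b c, m a b = some c → h c = h a * h b) {u v w : List A}
    (hw : w ∈ quasiShuffle m u v) : (w.map h).prod = (u.map h).prod * (v.map h).prod := by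
  induction u, v using quasiShuffle.induct generalizing w with
  | case1 v => simp_all
  | case2 a u => simp_all
  | case3 a u b v ih1 ih2 ih3 =>
    rw [quasiShuffle, List.mem_append, List.mem_append, List.mem_map, List.mem_map] at hw
    rcases hw with (⟨x, hx, rfl⟩ | ⟨x, hx, rfl⟩) | hw
    · simp [ih1 hx, mul_assoc]
    · simp [ih2 hx, mul_left_comm]
    · cases hc : m a b with
      | none => simp [hc] at hw
      | some c =>
        simp only [hc, Option.elim_some, List.mem_map] at hw
        obtain ⟨x, hx, rfl⟩ := hw
        simp [ih3 hx, hm a b c hc, mul_mul_mul_comm]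

theorem length_le_of_mem_quasiShuffle {u v w : List A} (hw : w ∈ quasiShuffle m u v) :
    u.length ≤ w.length ∧ v.length ≤ w.length := by
  induction u, v using quasiShuffle.induct generalizing w with
  | case1 v => simp_all
  | case2 a u => simp_all
  | case3 a u b v ih1 ih2 ih3 =>
    rw [quasiShuffle, List.mem_append, List.mem_append, List.mem_map, List.mem_map] at hw
    rcases hw with (⟨x, hx, rfl⟩ | ⟨x, hx, rfl⟩) | hw
    · have := ih1 hx; simp at this ⊢; omega
    · have := ih2 hx; simp at this ⊢; omega
    · cases hc : m a b with
      | none => simp [hc] at hw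
      | some c =>
        simp only [hc, Option.elim_some, List.mem_map] at hw
        obtain ⟨x, hx, rfl⟩ := hw
        have := ih3 hx; simp; omega

/-- Evaluation at a quasi-shuffle product, described through the last letters. -/
theorem qsum_append_append (f : List A → M) (u v : List A) (a b : A) :
    qsum m f (u ++ [a]) (v ++ [b]) = qsum m (fun w => f (w ++ [a])) u (v ++ [b]) +
      qsum m (fun w => f (w ++ [b])) (u ++ [a]) v +
      (m a b).elim 0 fun c => qsum m (fun w => f (w ++ [c])) u v := by
  have hel : ∀ (o : Option A) (g h k : A → M), (∀ c, o = some c → g c = h c + k c) →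
      o.elim 0 g = o.elim 0 h + o.elim 0 k := by
    intro o g h k H; cases o <;> simp [H]
  induction hn : u.length + v.length using Nat.strong_induction_on generalizing u v f with
  | _ n IH =>
  subst hn
  rcases u with _ | ⟨x, u⟩ <;> rcases v with _ | ⟨y, v⟩
  · simp [qsum_cons_cons, add_comm]
  · simp only [List.nil_append, List.cons_append, qsum_cons_cons, qsum_nil_left]
    rw [show [a] = [] ++ [a] from rfl, IH _ (by simp) _ [] v rfl]
    simp only [List.nil_append, qsum_nil_left, List.append_assoc, List.cons_append, add_assoc]
    abel
  · simp only [List.nil_append, List.cons_append, qsum_cons_cons, qsum_nil_right]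
    have h := IH _ (by simp) (fun w => f (x :: w)) u [] rfl
    simp only [List.nil_append] at h
    rw [h]
    simp only [qsum_nil_right, List.append_assoc, List.cons_append]
    abel
  · simp only [List.cons_append, qsum_cons_cons]
    have h1 := IH _ (by simp) (fun w => f (x :: w)) u (y :: v) rfl
    have h2 := IH _ (by simp) (fun w => f (y :: w)) (x :: u) v rfl
    simp only [List.cons_append] at h1 h2
    rw [h1, h2]
    have h3 := fun c => IH _ (by simp; omega) (fun w => f (c :: w)) u v rfl
    simp only [h3]
    cases m x y <;> cases m a b <;> simp <;> abel

theorem qsum_reverse (f : List A → M) (u v : List A) :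
    qsum m (fun w => f w.reverse) u v = qsum m f u.reverse v.reverse := by
  induction u, v using quasiShuffle.induct generalizing f with
  | case1 v => simp
  | case2 a u => simp
  | case3 a u b v ih1 ih2 ih3 =>
    simp only [List.reverse_cons, qsum_append_append, qsum_cons_cons]
    have h1 := ih1 fun w => f (w ++ [a])
    have h2 := ih2 fun w => f (w ++ [b])
    have h3 := fun c => ih3 fun w => f (w ++ [c])
    simp only [List.reverse_cons] at h1 h2 h3
    simp only [h1, h2, h3]

theorem qsum_map {B : Type*} {m' : B → B → Option B} (h : A → B)
    (hm : ∀ a b, m' (h a) (h b) = (m a b).map h) (f : List B → M) (u v : List A) :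
    qsum m (fun w => f (w.map h)) u v = qsum m' f (u.map h) (v.map h) := by
  induction u, v using quasiShuffle.induct generalizing f with
  | case1 v => simp
  | case2 a u => simp
  | case3 a u b v ih1 ih2 ih3 =>
    simp only [List.map_cons, qsum_cons_cons, hm]
    have h1 := ih1 fun w => f (h a :: w)
    have h2 := ih2 fun w => f (h b :: w)
    have h3 := fun c => ih3 fun w => f (h c :: w)
    simp only [List.map_cons] at h1 h2 h3
    rw [h1, h2]
    cases m a b <;> simp [h3]

theorem IsPrim.comp_map {f : List A → M} (hf : IsPrim m f) (h : A → A)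
    (hm : ∀ a b, m (h a) (h b) = (m a b).map h) : IsPrim m fun w => f (w.map h) :=
  ⟨hf.1, fun u v hu hv => by
    rw [qsum_map h hm]; exact hf.2 _ _ (by simpa using hu) (by simpa using hv)⟩

theorem IsPrim.comp_reverse {f : List A → M} (hf : IsPrim m f) :
    IsPrim m fun w => f w.reverse :=
  ⟨hf.1, fun u v hu hv => by
    rw [qsum_reverse]; exact hf.2 _ _ (by simpa using hu) (by simpa using hv)⟩

end Qsum

/-- The antipode identity `∑_{W = u v} (-1)^{|u|} S(u) ⧢ v = 0`, in the form in which it can be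
proved by induction on `V`: for `U = []` it is the identity itself, and in general the
alternating sum of the shuffles of `S(u) U` with `v` telescopes. -/
theorem sum_qsum_reverse {R : Type*} [CommRing R] (f : List A → R) (U V : List A) :
    ∑ j ∈ Finset.range (V.length + 1),
      (-1) ^ j * qsum noMul f ((V.take j).reverse ++ U) (V.drop j) =
      match U with
      | [] => if V = [] then f [] else 0
      | a :: U' => qsum noMul (fun w => f (a :: w)) U' V := by
  induction V generalizing U with
  | nil => cases U <;> simp
  | cons b V ih =>
    rw [List.length_cons, Finset.sum_range_succ']
    have h : ∀ j, (-1 : R) ^ (j + 1) * qsum noMul f (((b :: V).take (j + 1)).reverse ++ U)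
        ((b :: V).drop (j + 1)) = -((-1) ^ j * qsum noMul f ((V.take j).reverse ++ (b :: U))
          (V.drop j)) := by
      intro j; simp [pow_succ]
    simp only [h, Finset.sum_neg_distrib, ih]
    cases U with
    | nil => simp
    | cons a U => simp [qsum_cons_cons, noMul]

/-- A Lie series is mapped to its opposite by the antipode of the shuffle Hopf algebra. -/
theorem IsPrim.apply_reverse {R : Type*} [CommRing R] {f : List A → R} (hf : IsPrim noMul f)
    (w : List A) : f w.reverse = -(-1) ^ w.length * f w := by
  rcases eq_or_ne w [] with rfl | hw
  · simp [hf.1]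
  have h := sum_qsum_reverse f [] w
  simp only [List.append_nil, if_neg hw] at h
  rw [Finset.sum_range_succ] at h
  obtain ⟨n, hn⟩ : ∃ n, w.length = n + 1 :=
    ⟨w.length - 1, by have := List.length_pos_iff.mpr hw; omega⟩
  rw [hn, Finset.sum_range_succ', Finset.sum_eq_zero] at h
  · have h1 : w.take (n + 1) = w := by rw [← hn]; simp
    have h2 : w.drop (n + 1) = [] := by rw [← hn]; simp
    rw [h1, h2] at h
    simp only [List.take_zero, List.reverse_nil, qsum_nil_left, List.drop_zero, pow_zero, one_mul,
      zero_add, qsum_nil_right] at h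
    rw [hn]
    have h3 : ((-1 : R) ^ (n + 1)) * (-1) ^ (n + 1) = 1 := by rw [← mul_pow]; simp
    linear_combination (-1 : R) ^ (n + 1) * h - f w.reverse * h3
  · intro j hj
    rw [Finset.mem_range] at hj
    rw [hf.2, mul_zero]
    · simp [hw]
    · simp; omega

end QuasiShuffle

/-! ### Convolution products and their compatibility with quasi-shuffle coproducts -/

section Convolution

variable {A M M' M'' : Type*} [AddCommMonoid M] [AddCommMonoid M'] [AddCommMonoid M'']

/-- The sum of `B (f u) (g v)` over all factorizations `w = u v`. -/
def conv (B : M →+ M' →+ M'') : (List A → M) → (List A → M') → List A → M''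
  | f, g, [] => B (f []) (g [])
  | f, g, a :: w => B (f []) (g (a :: w)) + conv B (fun u => f (a :: u)) g w

/-- The sum of `B (F u₁ v₁) (G u₂ v₂)` over all factorizations `u = u₁ u₂` and `v = v₁ v₂`. -/
def conv₂ (B : M →+ M' →+ M'') :
    (List A → List A → M) → (List A → List A → M') → List A → List A → M''
  | F, G, [], v => conv B (F []) (G []) v
  | F, G, a :: u, v => conv B (F []) (G (a :: u)) v + conv₂ B (fun u => F (a :: u)) G u v

variable (B : M →+ M' →+ M'')

theorem conv_nil (f : List A → M) (g : List A → M') : conv B f g [] = B (f []) (g []) := rfl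

theorem conv_cons (f : List A → M) (g : List A → M') (a : A) (w : List A) :
    conv B f g (a :: w) = B (f []) (g (a :: w)) + conv B (fun u => f (a :: u)) g w := rfl

theorem conv_add_left (f f' : List A → M) (g : List A → M') (w : List A) :
    conv B (fun u => f u + f' u) g w = conv B f g w + conv B f' g w := by
  induction w generalizing f f' with
  | nil => simp [conv_nil]
  | cons a w ih => simp only [conv_cons, ih, map_add, AddMonoidHom.add_apply]; abel

theorem conv_add_right (f : List A → M) (g g' : List A → M') (w : List A) :
    conv B f (fun u => g u + g' u) w = conv B f g w + conv B f g' w := by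
  induction w generalizing f with
  | nil => simp [conv_nil]
  | cons a w ih => simp only [conv_cons, ih, map_add]; abel

@[simp] theorem conv_zero_left (g : List A → M') (w : List A) :
    conv B (fun _ => (0 : M)) g w = 0 := by
  induction w with
  | nil => simp [conv_nil]
  | cons a w ih => simp [conv_cons, ih]

@[simp] theorem conv_zero_right (f : List A → M) (w : List A) :
    conv B f (fun _ => (0 : M')) w = 0 := by
  induction w generalizing f with
  | nil => simp [conv_nil]
  | cons a w ih => simp [conv_cons, ih]

theorem conv_append_singleton (f : List A → M) (g : List A → M') (w : List A) (a : A) :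
    conv B f g (w ++ [a]) = conv B f (fun u => g (u ++ [a])) w + B (f (w ++ [a])) (g []) := by
  induction w generalizing f with
  | nil => simp [conv_nil, conv_cons]
  | cons b w ih => simp only [List.cons_append, conv_cons, ih, add_assoc]

theorem conv₂_nil (F : List A → List A → M) (G : List A → List A → M') (v : List A) :
    conv₂ B F G [] v = conv B (F []) (G []) v := rfl

theorem conv₂_cons (F : List A → List A → M) (G : List A → List A → M') (a : A) (u v : List A) :
    conv₂ B F G (a :: u) v =
      conv B (F []) (G (a :: u)) v + conv₂ B (fun u => F (a :: u)) G u v := rfl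

theorem conv₂_nil_right (F : List A → List A → M) (G : List A → List A → M') (u : List A) :
    conv₂ B F G u [] = conv B (fun u => F u []) (fun u => G u []) u := by
  induction u generalizing F with
  | nil => simp [conv₂_nil, conv_nil]
  | cons a u ih => simp [conv₂_cons, conv_nil, conv_cons, ih]

theorem conv₂_cons_right (F : List A → List A → M) (G : List A → List A → M') (u v : List A)
    (b : A) : conv₂ B F G u (b :: v) =
      conv B (fun u => F u []) (fun u => G u (b :: v)) u +
        conv₂ B (fun u v => F u (b :: v)) G u v := by
  induction u generalizing F with
  | nil => simp [conv₂_nil, conv_nil, conv_cons]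
  | cons a u ih => simp only [conv₂_cons, conv_cons, ih]; abel

theorem conv₂_add_left (F F' : List A → List A → M) (G : List A → List A → M') (u v : List A) :
    conv₂ B (fun u v => F u v + F' u v) G u v = conv₂ B F G u v + conv₂ B F' G u v := by
  induction u generalizing F F' with
  | nil => simp [conv₂_nil, conv_add_left]
  | cons a u ih => simp only [conv₂_cons, ih, conv_add_left]; abel

@[simp] theorem conv₂_zero_left (G : List A → List A → M') (u v : List A) :
    conv₂ B (fun _ _ => (0 : M)) G u v = 0 := by
  induction u with
  | nil => simp [conv₂_nil]
  | cons a u ih => simp [conv₂_cons, ih]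

/-- The quasi-shuffle coproduct is compatible with concatenation. -/
theorem qsum_conv (m : A → A → Option A) (f : List A → M) (g : List A → M') (u v : List A) :
    qsum m (conv B f g) u v = conv₂ B (qsum m f) (qsum m g) u v := by
  induction u, v using quasiShuffle.induct generalizing f with
  | case1 v =>
    rw [qsum_nil_left, conv₂_nil]
    congr 1 <;> funext w <;> simp
  | case2 a u =>
    rw [qsum_nil_right, conv₂_nil_right]
    congr 1 <;> funext w <;> simp
  | case3 a u b v ih1 ih2 ih3 =>
    have key : conv₂ B (qsum m f) (qsum m g) (a :: u) (b :: v) =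
        B (f []) (qsum m g (a :: u) (b :: v)) +
        conv₂ B (qsum m fun w => f (a :: w)) (qsum m g) u (b :: v) +
        conv₂ B (qsum m fun w => f (b :: w)) (qsum m g) (a :: u) v +
        (m a b).elim 0 fun c => conv₂ B (qsum m fun w => f (c :: w)) (qsum m g) u v := by
      have h1 : (fun v => qsum m f [] (b :: v)) = qsum m (fun w => f (b :: w)) [] := by
        funext w; simp
      have h2 : (fun u => qsum m f (a :: u) []) = fun u => qsum m (fun w => f (a :: w)) u [] := by
        funext w; simp
      rw [conv₂_cons, conv₂_cons_right, conv_cons, h1, h2, conv₂_cons_right, conv₂_cons]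
      simp only [qsum_cons_cons m f, conv₂_add_left, qsum_nil_left]
      cases m a b <;> simp <;> abel
    rw [key, qsum_cons_cons, qsum_cons_cons m g]
    have hB : ∀ x : A, (fun w => conv B f g (x :: w)) = fun w =>
        B (f []) (g (x :: w)) + conv B (fun u => f (x :: u)) g w := fun x => rfl
    simp only [hB, qsum_add, ih1, ih2, ih3, ← map_qsum]
    cases m a b <;> simp only [Option.elim_none, Option.elim_some, map_add, map_zero] <;> abel

theorem conv_ite_nil_left (x : M) (g : List A → M') (w : List A) :
    conv B (fun u => if u = [] then x else 0) g w = B x (g w) := by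
  cases w <;> simp [conv_nil, conv_cons]

theorem conv_ite_nil_right (f : List A → M) (x : M') (w : List A) :
    conv B f (fun u => if u = [] then x else 0) w = B (f w) x := by
  induction w generalizing f with
  | nil => simp [conv_nil]
  | cons a w ih => simp [conv_cons, ih]

theorem conv₂_eq_of_left (f : List A → M) (G : List A → List A → M')
    (u v : List A) :
    conv₂ B (fun u v => if v = [] then f u else 0) G u v = conv B f (fun u' => G u' v) u := by
  induction u generalizing f with
  | nil => rw [conv₂_nil, conv_ite_nil_left, conv_nil]
  | cons a u ih => rw [conv₂_cons, conv_ite_nil_left, conv_cons, ih]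

theorem conv₂_eq_of_right (f : List A → M) (G : List A → List A → M') (u v : List A) :
    conv₂ B (fun u v => if u = [] then f v else 0) G u v = conv B f (G u) v := by
  cases u with
  | nil => simp [conv₂_nil]
  | cons a u => simp [conv₂_cons]

theorem IsPrim.qsum_eq_add {m : A → A → Option A} {f : List A → M} (hf : IsPrim m f) :
    qsum m f = fun u v => (if v = [] then f u else 0) + if u = [] then f v else 0 := by
  funext u v
  rcases eq_or_ne u [] with rfl | hu <;> rcases eq_or_ne v [] with rfl | hv <;>
    simp [*, hf.1, hf.2]

/-- The coproduct of the product of a primitive element and another one. -/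
theorem IsPrim.qsum_conv_left {m : A → A → Option A} {f : List A → M} (hf : IsPrim m f)
    (g : List A → M') (u v : List A) : qsum m (conv B f g) u v =
      conv B f (fun u' => qsum m g u' v) u + conv B f (fun v' => qsum m g u v') v := by
  rw [qsum_conv, hf.qsum_eq_add, conv₂_add_left, conv₂_eq_of_left, conv₂_eq_of_right]

theorem conv₂_eq_of_left' (F : List A → List A → M) (g : List A → M') (u v : List A) :
    conv₂ B F (fun u v => if v = [] then g u else 0) u v = conv B (fun u' => F u' v) g u := by
  induction u generalizing F with
  | nil => rw [conv₂_nil, conv_ite_nil_right, conv_nil]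
  | cons a u ih => rw [conv₂_cons, conv_ite_nil_right, conv_cons, ih]

theorem conv₂_eq_of_right' (F : List A → List A → M) (g : List A → M') (u v : List A) :
    conv₂ B F (fun u v => if u = [] then g v else 0) u v = conv B (F u) g v := by
  induction u generalizing F with
  | nil => simp [conv₂_nil]
  | cons a u ih => simp [conv₂_cons, ih]

/-- The coproduct of the product of an element and a primitive one. -/
theorem IsPrim.qsum_conv_right {m : A → A → Option A} {g : List A → M'} (hg : IsPrim m g)
    (f : List A → M) (u v : List A) : qsum m (conv B f g) u v =
      conv B (fun u' => qsum m f u' v) g u + conv B (fun v' => qsum m f u v') g v := by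
  have h2 : ∀ (F : List A → List A → M) (G G' : List A → List A → M') (u v : List A),
      conv₂ B F (fun u v => G u v + G' u v) u v = conv₂ B F G u v + conv₂ B F G' u v := by
    intro F G G' u v
    induction u generalizing F with
    | nil => simp [conv₂_nil, conv_add_right]
    | cons a u ih => simp only [conv₂_cons, ih, conv_add_right]; abel
  rw [qsum_conv, hg.qsum_eq_add, h2, conv₂_eq_of_left', conv₂_eq_of_right']

/-- The commutator of two primitive elements is primitive. -/
theorem IsPrim.commutator {R : Type*} [CommRing R] {m : A → A → Option A} {f g : List A → R}
    (hf : IsPrim m f) (hg : IsPrim m g) :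
    IsPrim m fun w => conv AddMonoidHom.mul f g w - conv AddMonoidHom.mul g f w := by
  refine ⟨by simp [conv_nil, hf.1, hg.1], fun u v hu hv => ?_⟩
  have h1 : ∀ {g : List A → R} (_ : IsPrim m g) {v : List A} (_ : v ≠ []),
      (fun u => qsum m g u v) = fun u => if u = [] then g v else 0 := by
    intro g hg v hv; funext u; rw [hg.qsum_eq_add]; simp [hv]
  have h2 : ∀ {g : List A → R} (_ : IsPrim m g) {u : List A} (_ : u ≠ []),
      (fun v => qsum m g u v) = fun v => if v = [] then g u else 0 := by
    intro g hg v hv; funext u; rw [hg.qsum_eq_add]; simp [hv]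
  simp only [sub_eq_add_neg, ← neg_one_mul (conv _ g f _), qsum_add, qsum_mul_left]
  rw [hf.qsum_conv_left, hg.qsum_conv_left, h1 hg hv, h2 hg hu, h1 hf hv, h2 hf hu]
  simp only [conv_ite_nil_right, AddMonoidHom.mul_apply]
  ring

theorem conv_comp_left {P : Type*} [AddCommMonoid P] (L : P →+ M') (κ : List A → M' →+ M'')
    (g : List A → P) (w : List A) :
    conv (AddMonoidHom.id (P →+ M'')) (fun u => (κ u).comp L) g w =
      conv (AddMonoidHom.id _) κ (fun u => L (g u)) w := by
  induction w generalizing κ with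
  | nil => rfl
  | cons a w ih => rw [conv_cons, conv_cons, ih]; rfl

end Convolution

/-! ### Derivations which are coderivations -/

section Coderivation

variable {A M : Type*}

/-- The value at `f` of the sum of the operators which replace the first letter `y` of a word by
`c y`, where `κ w g = ∑ y, (c y | w) * g y`. -/
def replaceHead [AddCommMonoid M] (κ : List A → (A → M) →+ M) (f : List A → M) : List A → M :=
  conv (AddMonoidHom.id _) κ fun s y => f (y :: s)

/-- The derivation with `y ↦ c y` for every letter `y`, given through the functionals
`κ w g = ∑ y, (c y | w) * g y`.  These make sense also for an infinite alphabet.  It is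
assumed that no `c y` has a constant term. -/
def replaceDer [AddCommMonoid M] (κ : List A → (A → M) →+ M) : (List A → M) → List A → M
  | _, [] => 0
  | f, b :: w => replaceHead κ f (b :: w) + replaceDer κ (fun u => f (b :: u)) w

section

variable [AddCommMonoid M] (κ : List A → (A → M) →+ M)

theorem replaceDer_nil (f : List A → M) : replaceDer κ f [] = 0 := rfl

theorem replaceDer_cons (f : List A → M) (b : A) (w : List A) : replaceDer κ f (b :: w) =
    replaceHead κ f (b :: w) + replaceDer κ (fun u => f (b :: u)) w := rfl

theorem replaceHead_add (f g : List A → M) (w : List A) :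
    replaceHead κ (fun u => f u + g u) w = replaceHead κ f w + replaceHead κ g w := by
  unfold replaceHead
  rw [← conv_add_right]; rfl

theorem replaceDer_add (f g : List A → M) (w : List A) :
    replaceDer κ (fun u => f u + g u) w = replaceDer κ f w + replaceDer κ g w := by
  induction w generalizing f g with
  | nil => simp [replaceDer_nil]
  | cons b w ih => simp only [replaceDer_cons, ih, replaceHead_add]; abel

theorem replaceHead_add_left (κ' : List A → (A → M) →+ M) (f : List A → M) (w : List A) :
    replaceHead (fun u => κ u + κ' u) f w = replaceHead κ f w + replaceHead κ' f w :=
  conv_add_left _ _ _ _ _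

theorem replaceDer_add_left (κ' : List A → (A → M) →+ M) (f : List A → M) (w : List A) :
    replaceDer (fun u => κ u + κ' u) f w = replaceDer κ f w + replaceDer κ' f w := by
  induction w generalizing f with
  | nil => simp [replaceDer_nil]
  | cons b w ih => simp only [replaceDer_cons, ih, replaceHead_add_left]; abel

@[simp] theorem replaceHead_zero (w : List A) : replaceHead κ (fun _ => 0) w = 0 :=
  conv_zero_right _ _ _

@[simp] theorem replaceDer_zero (w : List A) : replaceDer κ (fun _ => 0) w = 0 := by
  induction w with
  | nil => rfl
  | cons b w ih => simp [replaceDer_cons, ih]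

end

section

variable [AddCommGroup M] {m : A → A → Option A} {κ : List A → (A → M) →+ M}

/-- `g ↦ (x ↦ g (x b))`, where `g` is extended by `0` if the product is not defined. -/
def mulRightHom (M : Type*) [AddCommMonoid M] (m : A → A → Option A) (b : A) :
    (A → M) →+ (A → M) where
  toFun g x := (m x b).elim 0 g
  map_zero' := by funext x; cases m x b <;> simp
  map_add' g g' := by funext x; simp only [Pi.add_apply]; cases m x b <;> simp

/-- `g ↦ (x ↦ g (a x))`, where `g` is extended by `0` if the product is not defined. -/
def mulLeftHom (M : Type*) [AddCommMonoid M] (m : A → A → Option A) (a : A) :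
    (A → M) →+ (A → M) where
  toFun g x := (m a x).elim 0 g
  map_zero' := by funext x; cases m a x <;> simp
  map_add' g g' := by funext x; simp only [Pi.add_apply]; cases m a x <;> simp

/-- The derivation given by `κ` is compatible with the coproduct on the letters.  On the coproduct
`∑ a ⊗ b` of a letter `y = a b` this is `Δ(c y) = ∑ c a ⊗ b + ∑ a ⊗ c b` up to the terms
`c y ⊗ 1` and `1 ⊗ c y`. -/
structure IsCoderLetters (m : A → A → Option A) (κ : List A → (A → M) →+ M) : Prop where
  nil : κ [] = 0
  cons : ∀ (a b : A) (u v : List A), qsum m κ (a :: u) (b :: v) =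
    (if v = [] then (κ (a :: u)).comp (mulRightHom M m b) else 0) +
    if u = [] then (κ (b :: v)).comp (mulLeftHom M m a) else 0

/-- The coproduct of the operator which replaces the first letter of a word.  On the right, the
first letter of one of the two words is replaced in the quasi-shuffle products of both; those
products which begin with the first letter of the other word do not occur in the coproduct, and are
the additional terms on the left. -/
theorem qsum_replaceHead (hκ : IsCoderLetters m κ) (f : List A → M) (a b : A) (u v : List A) :
    qsum m (replaceHead κ f) (a :: u) (b :: v) +
      replaceHead κ (fun u => qsum m (fun w => f (b :: w)) u v) (a :: u) +
      replaceHead κ (fun v => qsum m (fun w => f (a :: w)) u v) (b :: v) =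
      replaceHead κ (fun u => qsum m f u (b :: v)) (a :: u) +
      replaceHead κ (fun v => qsum m f (a :: u) v) (b :: v) := by
  set G : List A → List A → A → M := fun u v y => qsum m (fun w => f (y :: w)) u v with hG
  have hG' : qsum m (fun s y => f (y :: s)) = G := by
    funext u v y
    exact map_qsum m (Pi.evalAddMonoidHom (fun _ : A => M) y) _ u v
  have hκ' : qsum m κ = fun u v => (if v = [] then κ u else 0) + (if u = [] then κ v else 0) +
      (match v with
        | [] => 0
        | b :: v => if v = [] then (κ u).comp (mulRightHom M m b) else 0) +
      (match u with
        | [] => 0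
        | a :: u => if u = [] then (κ v).comp (mulLeftHom M m a) else 0) := by
    funext u v
    rcases u with _ | ⟨a, u⟩ <;> rcases v with _ | ⟨b, v⟩
    · simp [hκ.nil]
    · by_cases h : v = [] <;> simp [hκ.nil, h]
    · by_cases h : u = [] <;> simp [hκ.nil, h]
    · simp [hκ.cons]
  have h1 : replaceHead κ (fun u => qsum m f u (b :: v)) (a :: u) =
      conv (AddMonoidHom.id _) κ (fun u => G u (b :: v)) (a :: u) +
      replaceHead κ (fun u => qsum m (fun w => f (b :: w)) u v) (a :: u) +
      conv (AddMonoidHom.id _) (fun u => (κ u).comp (mulRightHom M m b)) (fun u => G u v)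
        (a :: u) := by
    rw [conv_comp_left, replaceHead, replaceHead, ← conv_add_right, ← conv_add_right]
    congr 1
    funext s y
    simp [qsum_cons_cons, hG, mulRightHom]
  have h2 : replaceHead κ (fun v => qsum m f (a :: u) v) (b :: v) =
      conv (AddMonoidHom.id _) κ (fun v => G (a :: u) v) (b :: v) +
      replaceHead κ (fun v => qsum m (fun w => f (a :: w)) u v) (b :: v) +
      conv (AddMonoidHom.id _) (fun v => (κ v).comp (mulLeftHom M m a)) (fun v => G u v)
        (b :: v) := by
    rw [conv_comp_left, replaceHead, replaceHead, ← conv_add_right, ← conv_add_right]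
    congr 1
    funext s y
    simp [qsum_cons_cons, hG, mulLeftHom, add_comm]
  have h3 : qsum m (replaceHead κ f) (a :: u) (b :: v) =
      conv (AddMonoidHom.id _) κ (fun u => G u (b :: v)) (a :: u) +
      conv (AddMonoidHom.id _) κ (fun v => G (a :: u) v) (b :: v) +
      conv (AddMonoidHom.id _) (fun u => (κ u).comp (mulRightHom M m b)) (fun u => G u v)
        (a :: u) +
      conv (AddMonoidHom.id _) (fun v => (κ v).comp (mulLeftHom M m a)) (fun v => G u v)
        (b :: v) := by
    unfold replaceHead
    rw [qsum_conv, hG', hκ', conv₂_add_left, conv₂_add_left, conv₂_add_left, conv₂_eq_of_left,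
      conv₂_eq_of_right]
    congr 1
    · rw [conv₂_cons_right]
      simp only [conv_zero_left, zero_add]
      rw [conv₂_eq_of_left]
    · rw [conv₂_cons]
      simp only [conv_zero_left, zero_add]
      rw [conv₂_eq_of_right (f := fun v => (κ v).comp (mulLeftHom M m a))]
  rw [h1, h2, h3]
  abel

/-- A derivation which is compatible with the coproduct on the letters is a coderivation. -/
theorem qsum_replaceDer (hκ : IsCoderLetters m κ) (f : List A → M) (u v : List A) :
    qsum m (replaceDer κ f) u v = replaceDer κ (fun u => qsum m f u v) u +
      replaceDer κ (fun v => qsum m f u v) v := by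
  induction hn : u.length + v.length using Nat.strong_induction_on generalizing u v f with
  | _ n IH =>
  subst hn
  rcases u with _ | ⟨a, u⟩
  · simp [replaceDer_nil]
  rcases v with _ | ⟨b, v⟩
  · simp [replaceDer_nil]
  have IH1 := IH _ (by simp) (fun w => f (a :: w)) u (b :: v) rfl
  have IH2 := IH _ (by simp) (fun w => f (b :: w)) (a :: u) v rfl
  have IH3 := fun c => IH _ (by simp; omega) (fun w => f (c :: w)) u v rfl
  have key := qsum_replaceHead hκ f a b u v
  rw [qsum_cons_cons] at key ⊢
  have hE : ∀ x : A, (fun w => replaceDer κ f (x :: w)) = fun w =>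
      replaceHead κ f (x :: w) + replaceDer κ (fun u => f (x :: u)) w := fun x => rfl
  simp only [hE, qsum_add, IH1, IH2, IH3]
  rw [replaceDer_cons κ (fun u => qsum m f u (b :: v)), replaceDer_cons κ (qsum m f (a :: u))]
  simp only [qsum_cons_cons m f, replaceDer_add]
  rw [replaceDer_cons κ (fun u => qsum m (fun w => f (b :: w)) u v),
    replaceDer_cons κ (fun v => qsum m (fun w => f (a :: w)) u v)]
  have key' := sub_eq_zero.mpr key
  refine sub_eq_zero.mp (Eq.trans ?_ key')
  cases m a b
  · simp only [Option.elim_none, replaceDer_zero]; abel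
  · simp only [Option.elim_some]; abel

/-- Such a derivation preserves primitive elements. -/
theorem IsPrim.replaceDer (hκ : IsCoderLetters m κ) {f : List A → M} (hf : IsPrim m f) :
    IsPrim m (replaceDer κ f) := by
  have h0 : ∀ (x : M) (w : List A), _root_.replaceDer κ (fun u => if u = [] then x else 0) w = 0 := by
    intro x w
    cases w with
    | nil => rfl
    | cons b w =>
      simp only [replaceDer_cons, replaceHead, reduceCtorEq, if_false, replaceDer_zero, add_zero]
      exact conv_zero_right _ _ _
  refine ⟨rfl, fun u v hu hv => ?_⟩
  rw [qsum_replaceDer hκ, hf.qsum_eq_add]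
  simp [hu, hv, h0]

end

end Coderivation

/-! ### The harmonic coproduct and Laurent series of primitive elements -/

section Harmonic

variable {G K : Type*} [CommGroup G] [Field K]

/-- The product on the letters `y_{k,γ}`, given by `y_{k,γ} y_{l,δ} = y_{k+l,γδ}`.  Its
quasi-shuffle product is the harmonic product. -/
def yMul (a b : ℕ+ × G) : Option (ℕ+ × G) := some (a.1 + b.1, a.2 * b.2)

/-- The weight of a word in the letters `y_{k,γ}`, where `y_{k,γ}` has weight `k`. -/
def yWeight (w : List (ℕ+ × G)) : ℕ := (w.map fun y => (y.1 : ℕ)).sum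

/-- The product of the indices `γ` of the letters `y_{k,γ}` of a word. -/
def yDeg (w : List (ℕ+ × G)) : G := (w.map Prod.snd).prod

@[simp] theorem yWeight_nil : yWeight ([] : List (ℕ+ × G)) = 0 := rfl
@[simp] theorem yWeight_cons (y : ℕ+ × G) (w : List (ℕ+ × G)) :
    yWeight (y :: w) = y.1 + yWeight w := by simp [yWeight]
@[simp] theorem yWeight_append (u w : List (ℕ+ × G)) :
    yWeight (u ++ w) = yWeight u + yWeight w := by simp [yWeight]
@[simp] theorem yDeg_nil : yDeg ([] : List (ℕ+ × G)) = 1 := rfl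
@[simp] theorem yDeg_cons (y : ℕ+ × G) (w : List (ℕ+ × G)) :
    yDeg (y :: w) = y.2 * yDeg w := by simp [yDeg]
@[simp] theorem yDeg_append (u w : List (ℕ+ × G)) :
    yDeg (u ++ w) = yDeg u * yDeg w := by simp [yDeg]

theorem yWeight_of_mem {u v w : List (ℕ+ × G)} (hw : w ∈ quasiShuffle yMul u v) :
    yWeight w = yWeight u + yWeight v := by
  have := eq_mul_of_mem_quasiShuffle (P := Multiplicative ℕ)
    (fun y : ℕ+ × G => Multiplicative.ofAdd (y.1 : ℕ)) (by
      intro a b c h; simp only [yMul, Option.some.injEq] at h; subst h; simp) hw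
  have h2 : ∀ w : List (ℕ+ × G), (w.map fun y => Multiplicative.ofAdd (y.1 : ℕ)).prod =
      Multiplicative.ofAdd (yWeight w) := by
    intro w; induction w with
    | nil => rfl
    | cons a w ih => simp [ih]
  rw [h2, h2, h2] at this
  exact Multiplicative.ofAdd.injective this

theorem yDeg_of_mem {u v w : List (ℕ+ × G)} (hw : w ∈ quasiShuffle yMul u v) :
    yDeg w = yDeg u * yDeg v :=
  eq_mul_of_mem_quasiShuffle Prod.snd (by
    intro a b c h; simp only [yMul, Option.some.injEq] at h; subst h; rfl) hw

/-- The word with the letters in the opposite order and the indices inverted. -/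
def yRev (w : List (ℕ+ × G)) : List (ℕ+ × G) := (w.map fun y => (y.1, y.2⁻¹)).reverse

@[simp] theorem yRev_nil : yRev ([] : List (ℕ+ × G)) = [] := rfl
@[simp] theorem yRev_cons (y : ℕ+ × G) (w : List (ℕ+ × G)) :
    yRev (y :: w) = yRev w ++ [(y.1, y.2⁻¹)] := by simp [yRev]

/-- The transpose of the anti-automorphism `y_{k,γ} ↦ (-1)^k y_{k,γ⁻¹}`. -/
def yAnti (f : List (ℕ+ × G) → K) (w : List (ℕ+ × G)) : K := (-1) ^ yWeight w * f (yRev w)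

theorem IsPrim.yAnti {f : List (ℕ+ × G) → K} (hf : IsPrim yMul f) : IsPrim yMul (yAnti f) := by
  have h := hf.comp_reverse.comp_map (fun y : ℕ+ × G => (y.1, y.2⁻¹)) (by
    intro a b; simp [yMul, mul_comm])
  refine ⟨by simp [_root_.yAnti, hf.1], fun u v hu hv => ?_⟩
  have h2 := h.2 u v hu hv
  have h3 : qsum yMul (_root_.yAnti f) u v = qsum yMul (fun w => (-1) ^ (yWeight u + yWeight v) *
      f (w.map fun y => (y.1, y.2⁻¹)).reverse) u v :=
    qsum_congr fun w hw => by rw [_root_.yAnti, yWeight_of_mem hw, yRev]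
  rw [h3, qsum_mul_left, h2, mul_zero]

/-- A sequence `φ_i` of series as the Laurent series `φ(t) = ∑ φ_i t^{-i}`, whose coefficients at
words are functions of the exponent of `t`. -/
def laurent (φ : ℕ → List (ℕ+ × G) → K) (w : List (ℕ+ × G)) : ℤ → K :=
  fun k => if k ≤ 0 then φ (-k).toNat w else 0

/-- Multiplication by `t^l` on Laurent series. -/
def shiftHom (K : Type*) [AddCommMonoid K] (l : ℤ) : (ℤ → K) →+ (ℤ → K) where
  toFun g k := g (k - l)
  map_zero' := rfl
  map_add' _ _ := rfl

/-- The coefficients of the group-like series `y(t) = 1 + ∑ t^k y_{k,γ}`, as operators on Laurent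
series. -/
def yOp (K : Type*) [AddCommMonoid K] : List (ℕ+ × G) → (ℤ → K) →+ (ℤ → K)
  | [] => AddMonoidHom.id _
  | [y] => shiftHom K (y.1 : ℕ)
  | _ :: _ :: _ => 0

theorem yOp_of_length {w : List (ℕ+ × G)} (hw : 2 ≤ w.length) : yOp K w = 0 := by
  rcases w with _ | ⟨a, _ | ⟨b, w⟩⟩
  · simp at hw
  · simp at hw
  · rfl

theorem yOp_comm (u v : List (ℕ+ × G)) : (yOp K u).comp (yOp K v) = (yOp K v).comp (yOp K u) := by
  rcases u with _ | ⟨a, _ | ⟨a', u⟩⟩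
  · rfl
  · rcases v with _ | ⟨b, _ | ⟨b', v⟩⟩
    · rfl
    · ext g k
      simp [yOp, shiftHom, sub_right_comm]
    · simp [yOp]
  · simp [yOp]

theorem qsum_yOp (u v : List (ℕ+ × G)) :
    qsum yMul (yOp K) u v = (yOp K u).comp (yOp K v) := by
  have h0 : ∀ (c : ℕ+ × G) (u v : List (ℕ+ × G)), u ≠ [] ∨ v ≠ [] →
      qsum yMul (fun w => yOp K (c :: w)) u v = 0 := by
    intro c u v h
    rw [qsum_congr (g := fun _ => 0), qsum_zero]
    intro w hw
    apply yOp_of_length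
    have := length_le_of_mem_quasiShuffle hw
    rw [← List.length_pos_iff, ← List.length_pos_iff] at h
    simp; omega
  rcases u with _ | ⟨a, u⟩
  · simp; rfl
  rcases v with _ | ⟨b, v⟩
  · simp; rfl
  rw [qsum_cons_cons, h0 _ _ _ (by simp), h0 _ _ _ (by simp)]
  simp only [yMul, Option.elim_some, zero_add]
  rcases u with _ | ⟨a', u⟩
  · rcases v with _ | ⟨b', v⟩
    · ext g k
      simp only [qsum_nil_left, yOp, shiftHom, PNat.add_coe, Nat.cast_add, AddMonoidHom.coe_mk,
        ZeroHom.coe_mk, AddMonoidHom.coe_comp, Function.comp_apply]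
      congr 1; ring
    · rw [h0 _ _ _ (by simp), yOp_of_length (w := b :: b' :: v) (by simp)]; simp
  · rw [h0 _ _ _ (by simp), yOp_of_length (w := a :: a' :: u) (by simp)]; simp

theorem qsum_apply {φ : List (ℕ+ × G) → ℤ → K} (u v : List (ℕ+ × G)) (k : ℤ) :
    qsum yMul φ u v k = qsum yMul (fun w => φ w k) u v :=
  map_qsum yMul (Pi.evalAddMonoidHom (fun _ : ℤ => K) k) φ u v

/-- The series `χ_i = (-1)^i σ(φ_i)`, where `σ` is the anti-automorphism `yAnti`. -/
def antiSeq (φ : ℕ → List (ℕ+ × G) → K) (i : ℕ) (w : List (ℕ+ × G)) : K :=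
  (-1) ^ i * yAnti (φ i) w

/-- The Laurent series `Z(t) = φ(t) y(t) + y(t) χ(t)`. -/
def zSer (φ : ℕ → List (ℕ+ × G) → K) (w : List (ℕ+ × G)) : ℤ → K :=
  conv AddMonoidHom.eval (laurent φ) (yOp K) w +
    conv (AddMonoidHom.id _) (yOp K) (laurent (antiSeq φ)) w

theorem IsPrim.laurent {φ : ℕ → List (ℕ+ × G) → K} (hφ : ∀ i, IsPrim yMul (φ i)) :
    IsPrim yMul (laurent φ) := by
  refine ⟨?_, fun u v hu hv => ?_⟩
  · funext k; simp [_root_.laurent, (hφ _).1]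
  · funext k
    have := map_qsum yMul (Pi.evalAddMonoidHom (fun _ : ℤ => K) k) (_root_.laurent φ) u v
    refine this.trans ?_
    by_cases hk : k ≤ 0
    · simpa [_root_.laurent, hk] using (hφ _).2 u v hu hv
    · simp [_root_.laurent, hk]

theorem IsPrim.antiSeq {φ : ℕ → List (ℕ+ × G) → K} (hφ : ∀ i, IsPrim yMul (φ i)) (i : ℕ) :
    IsPrim yMul (antiSeq φ i) := (hφ i).yAnti.mul_left _

theorem conv_laurent_append (f : List (ℕ+ × G) → ℤ → K) (w : List (ℕ+ × G)) (y : ℕ+ × G) :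
    conv AddMonoidHom.eval f (yOp K) (w ++ [y]) = shiftHom K (y.1 : ℕ) (f w) + f (w ++ [y]) := by
  rw [conv_append_singleton]
  congr 1
  induction w generalizing f with
  | nil => rfl
  | cons a w ih =>
    rw [conv_cons, yOp_of_length (by simp), ih]; simp

theorem conv_yOp_cons (f : List (ℕ+ × G) → ℤ → K) (w : List (ℕ+ × G)) (y : ℕ+ × G) :
    conv (AddMonoidHom.id _) (yOp K) f (y :: w) = f (y :: w) + shiftHom K (y.1 : ℕ) (f w) := by
  rw [conv_cons]
  congr 1
  cases w with
  | nil => rfl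
  | cons a w =>
    rw [conv_cons]
    simp [yOp]

/-- The Laurent series `Z(t)` satisfies `Δ(Z) = Z ⊗ y + y ⊗ Z`. -/
theorem qsum_zSer {φ : ℕ → List (ℕ+ × G) → K} (hφ : ∀ i, IsPrim yMul (φ i))
    (u v : List (ℕ+ × G)) :
    qsum yMul (zSer φ) u v = yOp K v (zSer φ u) + yOp K u (zSer φ v) := by
  have h1 : ∀ (T : (ℤ → K) →+ (ℤ → K)) (f : List (ℕ+ × G) → ℤ → K) w,
      conv AddMonoidHom.eval f (fun u' => T.comp (yOp K u')) w =
        T (conv AddMonoidHom.eval f (yOp K) w) := by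
    intro T f w
    induction w generalizing f with
    | nil => simp [conv_nil]
    | cons a w ih => simp [conv_cons, ih]
  have h2 : ∀ (T : (ℤ → K) →+ (ℤ → K)) (g : List (ℕ+ × G) → (ℤ → K) →+ (ℤ → K))
      (f : List (ℕ+ × G) → ℤ → K) w,
      conv (AddMonoidHom.id _) (fun u' => T.comp (g u')) f w =
        T (conv (AddMonoidHom.id _) g f w) := by
    intro T g f w
    induction w generalizing g with
    | nil => simp [conv_nil]
    | cons a w ih => simp [conv_cons, ih]
  unfold zSer
  rw [qsum_add, (IsPrim.laurent hφ).qsum_conv_left, (IsPrim.laurent (IsPrim.antiSeq hφ)).qsum_conv_right]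
  simp only [qsum_yOp]
  simp only [yOp_comm _ v, h1, h2]
  simp only [map_add]
  abel

theorem laurent_neg (φ : ℕ → List (ℕ+ × G) → K) (w : List (ℕ+ × G)) (j : ℕ) :
    laurent φ w (-j) = φ j w := by simp [laurent]

theorem laurent_pos (φ : ℕ → List (ℕ+ × G) → K) (w : List (ℕ+ × G)) {k : ℤ} (hk : 0 < k) :
    laurent φ w k = 0 := by simp [laurent, hk]

theorem zSer_nil {φ : ℕ → List (ℕ+ × G) → K} (hφ : ∀ i, φ i [] = 0) : zSer φ [] = 0 := by
  funext k
  simp [zSer, conv_nil, yOp, laurent, antiSeq, yAnti, hφ]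

theorem zSer_singleton {φ : ℕ → List (ℕ+ × G) → K} (hφ : ∀ i, φ i [] = 0) (y : ℕ+ × G) (j : ℕ) :
    zSer φ [y] (-j) = φ j [y] + antiSeq φ j [y] := by
  have h := conv_laurent_append (laurent φ) [] y
  rw [List.nil_append] at h
  rw [zSer, h, conv_yOp_cons]
  simp only [Pi.add_apply, laurent_neg]
  simp [shiftHom, laurent, antiSeq, yAnti, hφ]

end Harmonic

/-- The coproduct of a power series in a single letter which is not a product. -/
theorem qsum_powers {A K : Type*} [CommRing K] {m : A → A → Option A} {a : A}
    (ha : ∀ x y, m x y ≠ some a) (e : ℕ → K) (u v : List A) :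
    qsum m (fun w => open Classical in if ∀ y ∈ w, y = a then e w.length else 0) u v =
      open Classical in if (∀ y ∈ u, y = a) ∧ ∀ y ∈ v, y = a then
        ((u.length + v.length).choose u.length : K) * e (u.length + v.length) else 0 := by
  classical
  have hcons : ∀ (x : A) (e : ℕ → K), (fun w => if ∀ y ∈ x :: w, y = a then e (x :: w).length
      else 0) = fun w => if ∀ y ∈ w, y = a then (if x = a then e (w.length + 1) else 0) else 0 := by
    intro x e; funext w
    by_cases hx : x = a <;> simp [hx]
  induction u, v using quasiShuffle.induct generalizing e with
  | case1 v => simp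
  | case2 x u => simp
  | case3 x u y v ih1 ih2 ih3 =>
    rw [qsum_cons_cons]
    simp only [hcons]
    have h1 := ih1 fun n => if x = a then e (n + 1) else 0
    have h2 := ih2 fun n => if y = a then e (n + 1) else 0
    have h3 : ((m x y).elim 0 fun c => qsum m (fun w => if ∀ y ∈ w, y = a then
        (if c = a then e (w.length + 1) else 0) else 0) u v) = 0 := by
      cases hc : m x y with
      | none => rfl
      | some c =>
        have : c ≠ a := fun h => ha x y (hc.trans (congrArg some h))
        simp [this]
    rw [h1, h2, h3]
    by_cases hx : x = a <;> by_cases hy : y = a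
    · subst hx; subst hy
      simp only [List.length_cons, List.mem_cons, forall_eq_or_imp, true_and, if_true, add_zero]
      by_cases h : (∀ z ∈ u, z = y) ∧ ∀ z ∈ v, z = y
      · rw [if_pos h, if_pos h, if_pos h]
        rw [show u.length + 1 + (v.length + 1) = (u.length + (v.length + 1)) + 1 by omega,
          Nat.choose_succ_succ, show u.length + 1 + v.length = u.length + (v.length + 1) by omega]
        push_cast; ring
      · rw [if_neg h, if_neg h, if_neg h, add_zero]
    · simp [hx, hy]
    · simp [hx, hy]
    · simp [hx, hy]

/-! ### Vanishing of the polar part -/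

section Vanishing

variable {G K : Type*} [CommGroup G] [Field K] [CharZero K]

theorem yMul_ne_one (x y : ℕ+ × G) : yMul x y ≠ some ((1, 1) : ℕ+ × G) := by
  intro h
  simp only [yMul, Option.some.injEq, Prod.mk.injEq] at h
  have := congrArg PNat.val h.1
  have h1 := x.1.pos
  have h2 := y.1.pos
  simp at this; omega

/-- `Z(t)` has no terms `t^k` with `k ≤ 0`.  It is assumed that its coefficient at `t`, in index `1`,
is a series `∑ e_n y_{1,1}^n`.  Then the coefficient at `t` in `Δ(Z) = Z ⊗ y + y ⊗ Z` shows that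
`e_n = 0` for `n ≥ 4` and that in length at least `2` the only possible term is `3 e_3 y_{1,1}^2`, in
`Z_0`.  In length `1` the coefficients in `Z_{-j}` are determined by those in `Z_0`, and the
coefficient at `t^0` in `Δ(Z)` gives linear relations between these.  An element `g` with `g ≠ 1` and
`g² ≠ 1` shows that `e_3 = 0`; then the relations, and parity in weight `1`, imply that everything
vanishes.  In weight `n` and index `1` the vanishing of `Z_0` is a statement on `φ_0` if `n` is
even. -/
theorem zSer_eq_zero {φ : ℕ → List (ℕ+ × G) → K} (hφ : ∀ i, IsPrim yMul (φ i))
    (hletter : ∀ (i : ℕ) (k : ℕ+) (γ : G),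
      ((i : K) + 1) * φ (i + 1) [(k, γ)] = -(k : ℕ) * φ i [(k + 1, γ)])
    (hpar : ∀ γ : G, φ 0 [(1, γ)] = φ 0 [(1, γ⁻¹)])
    (hG : ∃ g : G, g ≠ 1 ∧ g * g ≠ 1) (e : ℕ → K)
    (he : ∀ n : ℕ+, e (n + 1) = -((1 + (-1) ^ (n : ℕ)) / (n : ℕ)) * φ 0 [(n, 1)])
    (hone : ∀ w : List (ℕ+ × G), yDeg w = 1 → zSer φ w 1 =
      open Classical in if ∀ y ∈ w, y = (1, 1) then e w.length else 0) :
    (∀ w k, k ≤ 0 → zSer φ w k = 0) ∧ ∀ n : ℕ+, Even (n : ℕ) → φ 0 [(n, 1)] = 0 := by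
  classical
  have hnil : ∀ i, φ i [] = 0 := fun i => (hφ i).1
  have hZnil : zSer φ [] = 0 := zSer_nil hnil
  -- the coefficient at `t^k` of the coproduct formula
  have hstar : ∀ u v k, qsum yMul (fun w => zSer φ w k) u v =
      yOp K v (zSer φ u) k + yOp K u (zSer φ v) k := fun u v k => by
    rw [← qsum_apply, qsum_zSer hφ]; rfl
  have hstar1 : ∀ u v, yDeg u * yDeg v = 1 → qsum yMul (fun w => zSer φ w 1) u v =
      if (∀ y ∈ u, y = ((1, 1) : ℕ+ × G)) ∧ ∀ y ∈ v, y = (1, 1) then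
        ((u.length + v.length).choose u.length : K) * e (u.length + v.length) else 0 := by
    intro u v h
    refine (qsum_congr fun w hw => ?_).trans ((qsum_powers yMul_ne_one e u v).trans ?_)
    · rw [hone w (by rw [yDeg_of_mem hw, h])]
      congr
    · congr
  have he4 : ∀ n, e (n + 4) = 0 := by
    intro n
    have h1 := hstar (List.replicate 2 (1, 1)) (List.replicate (n + 2) (1, 1)) 1
    rw [hstar1 _ _ (by simp [yDeg])] at h1
    rw [yOp_of_length (w := List.replicate 2 (1, 1)) (by simp),
      yOp_of_length (w := List.replicate (n + 2) (1, 1)) (by simp), if_pos (by simp)] at h1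
    simp only [AddMonoidHom.zero_apply, Pi.zero_apply, add_zero, List.length_replicate] at h1
    rcases mul_eq_zero.mp h1 with h | h
    · rw [Nat.cast_eq_zero, Nat.choose_eq_zero_iff] at h; omega
    · rw [← h]; congr 1; omega
  have hlong : ∀ (w : List (ℕ+ × G)) (k : ℕ+), 2 ≤ w.length →
      zSer φ w (1 - (k : ℕ)) = if k = 1 ∧ w = [(1, 1), (1, 1)] then 3 * e 3 else 0 := by
    intro w k hw
    have h1 := hstar w [(k, (yDeg w)⁻¹)] 1
    rw [hstar1 _ _ (by simp), yOp_of_length hw] at h1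
    have h2 : zSer φ w (1 - (k : ℕ)) = (yOp K [(k, (yDeg w)⁻¹)]) (zSer φ w) 1 := rfl
    rw [h2]
    simp only [AddMonoidHom.zero_apply, Pi.zero_apply, add_zero] at h1
    rw [← h1]
    by_cases h : (∀ y ∈ w, y = (1, 1)) ∧ k = 1
    · obtain ⟨ha, rfl⟩ := h
      have hrep := List.eq_replicate_of_mem ha
      obtain ⟨n, hn⟩ : ∃ n, w.length = n + 2 := ⟨w.length - 2, by omega⟩
      rw [hn] at hrep
      subst hrep
      rw [if_pos (by simp [yDeg])]
      rcases n with _ | n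
      · simp
      · rw [show (List.replicate (n + 1 + 2) ((1, 1) : ℕ+ × G)).length +
          [((1 : ℕ+), (yDeg (List.replicate (n + 1 + 2) ((1, 1) : ℕ+ × G)))⁻¹)].length = n + 4 by simp,
          he4]
        simp [List.replicate_succ]
    · rw [if_neg, if_neg]
      · rintro ⟨rfl, rfl⟩; simp at h
      · rintro ⟨h3, h4⟩
        simp only [List.mem_singleton, forall_eq, Prod.mk.injEq] at h4
        exact h ⟨h3, h4.1⟩
  -- `ρ j l γ` is the coefficient of `y_{l,γ}` in `Z_{-j}`
  set ρ : ℕ → ℕ+ → G → K := fun j l γ => zSer φ [(l, γ)] (-j) with hρ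
  have hρ' : ∀ j l γ, ρ j l γ = φ j [(l, γ)] + (-1) ^ (j + (l : ℕ)) * φ j [(l, γ⁻¹)] := by
    intro j l γ
    simp only [hρ]
    rw [zSer_singleton hnil]
    simp [antiSeq, yAnti, pow_add, mul_assoc]
  have hrec : ∀ (j : ℕ) (l : ℕ+) γ, ((j : K) + 1) * ρ (j + 1) l γ = -(l : ℕ) * ρ j (l + 1) γ := by
    intro j l γ
    rw [hρ', hρ', mul_add, mul_add, hletter, mul_left_comm, hletter]
    simp only [PNat.add_coe, PNat.one_coe, ← add_assoc, add_right_comm j 1]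
    ring
  have hdown : ∀ γ, (∀ l, ρ 0 l γ = 0) → ∀ j l, ρ j l γ = 0 := by
    intro γ h j
    induction j with
    | zero => exact h
    | succ j ih =>
      intro l
      have := hrec j l γ
      rw [ih, mul_zero] at this
      exact (mul_eq_zero.mp this).resolve_left (Nat.cast_add_one_ne_zero j)
  -- the coefficient at `t^0` of the coproduct of `Z`, at two letters
  have hrel : ∀ (l j : ℕ+) (α β : G), ρ 0 (l + j) (α * β) +
      (if l = 1 ∧ j = 1 ∧ α = 1 ∧ β = 1 then 6 * e 3 else 0) = ρ j l α + ρ l j β := by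
    intro l j α β
    have h1 := hstar [(l, α)] [(j, β)] 0
    have h2 : ∀ x y : ℕ+ × G, zSer φ [x, y] 0 = if x = (1, 1) ∧ y = (1, 1) then 3 * e 3 else 0 := by
      intro x y
      have := hlong [x, y] 1 (by simp)
      simpa using this
    simp only [qsum_cons_cons, qsum_nil_left, qsum_nil_right, yMul, Option.elim_some, h2] at h1
    have h3 : ρ j l α + ρ l j β = (yOp K [(j, β)]) (zSer φ [(l, α)]) 0 +
        (yOp K [(l, α)]) (zSer φ [(j, β)]) 0 := by
      simp [hρ, yOp, shiftHom]
    rw [h3, ← h1]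
    have h4 : ρ 0 (l + j) (α * β) = zSer φ [(l + j, α * β)] 0 := by simp [hρ]
    rw [h4]
    by_cases h : l = 1 ∧ j = 1 ∧ α = 1 ∧ β = 1
    · obtain ⟨rfl, rfl, rfl, rfl⟩ := h
      simp; ring
    · rw [if_neg h, if_neg, if_neg]
      · ring
      · rintro ⟨h5, h6⟩; simp_all
      · rintro ⟨h5, h6⟩; simp_all
  have hρone : ∀ n : ℕ+, ρ 0 n 1 = (1 + (-1) ^ (n : ℕ)) * φ 0 [(n, 1)] := by
    intro n; rw [hρ']; simp; ring
  have he' : ∀ n : ℕ+, ρ 0 n 1 = -(n : ℕ) * e (n + 1) := by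
    intro n
    rw [hρone, he]
    have : ((n : ℕ) : K) ≠ 0 := by exact_mod_cast n.ne_zero
    field_simp
  have hρ1 : ∀ (n : ℕ+) α, ρ 1 n α = -(n : ℕ) * ρ 0 (n + 1) α := by
    intro n α
    have := hrec 0 n α
    simpa using this
  -- The relations in weight `2` express `ρ 0 2` through itself, which leaves no room for `e 3`.
  have hr2 : ∀ α β : G, ρ 0 2 (α * β) + (if α = 1 ∧ β = 1 then 6 * e 3 else 0) =
      -ρ 0 2 α - ρ 0 2 β := by
    intro α β
    have h := hrel 1 1 α β
    have h1 : ∀ α, ρ ((1 : ℕ+) : ℕ) 1 α = - ρ 0 2 α := by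
      intro α; simpa [show (1 : ℕ+) + 1 = 2 from rfl] using hρ1 1 α
    rw [h1, h1] at h
    simpa [sub_eq_add_neg, show (1 : ℕ+) + 1 = 2 from rfl] using h
  have he3 : e 3 = 0 := by
    obtain ⟨g, hg, hgg⟩ := hG
    have h1 := hr2 g g
    have h2 := hr2 g 1
    have h3 := hr2 (g * g) 1
    have h4 : ρ 0 2 1 = -2 * e 3 := by have := he' 2; simpa using this
    simp only [hg, hgg, mul_one, false_and, if_false, add_zero, h4] at h1 h2 h3
    have : (6 : K) * e 3 = 0 := by linear_combination 2 * h1 - 2 * h2 - h3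
    exact (mul_eq_zero.mp this).resolve_left (by norm_num)
  have heall : ∀ n : ℕ+, e (n + 1) = 0 := by
    intro n
    rcases n with ⟨n, hn⟩
    rcases n with _ | _ | _ | n
    · simp at hn
    · have := he 1; simpa using this
    · exact he3
    · exact he4 n
  have hone0 : ∀ l, ρ 0 l 1 = 0 := fun l => by rw [he', heall, mul_zero]
  have hall : ∀ γ l, ρ 0 l γ = 0 := by
    intro γ l
    rcases eq_or_ne l 1 with rfl | hl
    · rw [hρ', ← hpar]; simp
    · obtain ⟨n, rfl⟩ := PNat.exists_eq_succ_of_ne_one hl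
      have h := hrel n 1 γ 1
      rw [he3, mul_zero, ite_self, add_zero, mul_one, PNat.one_coe, hρ1, hdown 1 hone0,
        add_zero] at h
      have h9 : ((n : ℕ) + 1 : K) * ρ 0 (n + 1) γ = 0 := by linear_combination h
      exact (mul_eq_zero.mp h9).resolve_left (Nat.cast_add_one_ne_zero _)
  refine ⟨fun w k hk => ?_, fun n hn => ?_⟩
  · rcases w with _ | ⟨y, w⟩
    · rw [hZnil]; rfl
    rcases w with _ | ⟨y', w⟩
    · have := hdown y.2 (hall y.2) (-k).toNat y.1
      simp only [hρ] at this
      rw [← this]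
      congr 1
      omega
    · have := hlong (y :: y' :: w) ⟨(1 - k).toNat, by omega⟩ (by simp)
      rw [he3] at this
      simp only [mul_zero, ite_self, PNat.mk_coe] at this
      rw [← this]
      congr 1
      omega
  · have h := hone0 n
    rw [hρone, hn.neg_one_pow] at h
    exact (mul_eq_zero.mp h).resolve_left (by norm_num)

end Vanishing

/-! ### The coderivation attached to a sequence of primitive series -/

section ZDerivation

variable {G K : Type*} [CommGroup G] [Field K]

/-- The functional `g ↦ ∑_{k ≥ 1} z_k g(y_{k,γ})` given by the positive part of a Laurent series
`z` which has no terms of degree `> n`. -/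
def zHom (n : ℕ) (z : ℤ → K) (γ : G) : (ℕ+ × G → K) →+ K where
  toFun g := ∑ k ∈ Finset.range n, z (k + 1) * g (k.succPNat, γ)
  map_zero' := by simp
  map_add' g h := by simp [mul_add, Finset.sum_add_distrib]

/-- The functional `g ↦ ∑_{k = 1}^n c_{n-k} g(y_{k,γ})`. -/
def letterHom (n : ℕ) (c : ℕ → K) (γ : G) : (ℕ+ × G → K) →+ K where
  toFun g := ∑ k ∈ Finset.range n, c (n - 1 - k) * g (k.succPNat, γ)
  map_zero' := by simp
  map_add' g h := by simp [mul_add, Finset.sum_add_distrib]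

/-- The functionals describing the derivation `y_{k,γ} ↦ Z_{k,γ}`, where `Z_{k,γ}` is the part of
index `γ` of the coefficient of `t^k` in `Z(t)`. -/
def zFun (φ : ℕ → List (ℕ+ × G) → K) (w : List (ℕ+ × G)) : (ℕ+ × G → K) →+ K :=
  zHom (yWeight w) (zSer φ w) (yDeg w)

theorem zHom_shift {z : ℤ → K} (hz : ∀ k, 0 < k → z k = 0) {l n : ℕ} (hl : l ≤ n) (γ : G) :
    zHom n (shiftHom K l z) γ = letterHom l (fun i => z (-i)) γ := by
  ext g
  simp only [zHom, letterHom, shiftHom, AddMonoidHom.coe_mk, ZeroHom.coe_mk]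
  rw [← Finset.sum_subset (Finset.range_subset_range.mpr hl)]
  · refine Finset.sum_congr rfl fun k hk => ?_
    rw [Finset.mem_range] at hk
    congr 2
    omega
  · intro k _ hk
    rw [Finset.mem_range] at hk
    rw [hz _ (by omega), zero_mul]

theorem zHom_eq_zero {z : ℤ → K} (hz : ∀ k, 0 < k → z k = 0) (n : ℕ) (γ : G) :
    zHom n z γ = 0 := by
  ext g
  change ∑ k ∈ Finset.range n, z (k + 1) * g (k.succPNat, γ) = 0
  exact Finset.sum_eq_zero fun k _ => by rw [hz _ (by omega), zero_mul]

theorem zHom_add (n : ℕ) (z z' : ℤ → K) (γ : G) :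
    zHom n (z + z') γ = zHom n z γ + zHom n z' γ := by
  ext g; simp [zHom, add_mul, Finset.sum_add_distrib]

/-- The contribution of `φ(t) y(t)` to `zFun`, in a form suitable for induction. -/
def lastFun : (ℕ → List (ℕ+ × G) → K) → G → List (ℕ+ × G) → (ℕ+ × G → K) →+ K
  | _, _, [] => 0
  | φ, δ, y :: s => (if s = [] then letterHom y.1 (fun i => φ i []) (δ * y.2) else 0) +
      lastFun (fun i u => φ i (y :: u)) (δ * y.2) s

/-- The contribution of `y(t) χ(t)` to `zFun`. -/
def firstFun (χ : ℕ → List (ℕ+ × G) → K) : List (ℕ+ × G) → (ℕ+ × G → K) →+ K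
  | [] => 0
  | y :: s => letterHom y.1 (fun i => χ i s) (y.2 * yDeg s)

theorem lastFun_append (φ : ℕ → List (ℕ+ × G) → K) (δ : G) (s : List (ℕ+ × G)) (y : ℕ+ × G) :
    lastFun φ δ (s ++ [y]) = letterHom y.1 (fun i => φ i s) (δ * yDeg s * y.2) := by
  induction s generalizing φ δ with
  | nil => simp [lastFun]
  | cons x s ih => simp [lastFun, ih, mul_assoc]

theorem zFun_eq (φ : ℕ → List (ℕ+ × G) → K) (w : List (ℕ+ × G)) :
    zFun φ w = lastFun φ 1 w + firstFun (antiSeq φ) w := by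
  have hL : ∀ (φ : ℕ → List (ℕ+ × G) → K) w k, 0 < k → laurent φ w k = 0 :=
    fun φ w k hk => laurent_pos φ w hk
  rw [zFun, zSer, zHom_add]
  congr 1
  · rcases List.eq_nil_or_concat w with rfl | ⟨s, y, rfl⟩
    · ext; simp [zHom, lastFun]
    · rw [List.concat_eq_append, conv_laurent_append, zHom_add, zHom_shift (hL _ _) (by simp),
        zHom_eq_zero (hL _ _), lastFun_append]
      simp [laurent_neg]
  · rcases w with _ | ⟨y, s⟩
    · ext; simp [zHom, firstFun]
    · rw [conv_yOp_cons, zHom_add, zHom_shift (hL _ _) (by simp), zHom_eq_zero (hL _ _)]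
      simp [laurent_neg, firstFun]

theorem zFun_apply {φ : ℕ → List (ℕ+ × G) → K} (w : List (ℕ+ × G)) (g : ℕ+ × G → K) :
    zFun φ w g = ∑ k ∈ Finset.range (yWeight w), zSer φ w (k + 1) * g (k.succPNat, yDeg w) := rfl

/-- If `Z(t)` has no polar part, it defines a coderivation. -/
theorem isCoderLetters_zFun {φ : ℕ → List (ℕ+ × G) → K} (hφ : ∀ i, IsPrim yMul (φ i))
    (hZ : ∀ w k, k ≤ 0 → zSer φ w k = 0) : IsCoderLetters yMul (zFun φ) where
  nil := by ext g; simp [zFun, zHom]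
  cons a b u v := by
    have h1 : ∀ (u : List (ℕ+ × G)) (b : ℕ+ × G) (γ : G) (g : ℕ+ × G → K) (n : ℕ),
        n = yWeight u + b.1 →
        ∑ k ∈ Finset.range n, zSer φ u (k + 1 - (b.1 : ℕ)) * g (k.succPNat, γ) =
        ∑ k ∈ Finset.range (yWeight u), zSer φ u (k + 1) * g (k.succPNat + b.1, γ) := by
      intro u b γ g n hn
      rw [hn, add_comm (yWeight u), Finset.sum_range_add, Finset.sum_eq_zero, zero_add]
      · refine Finset.sum_congr rfl fun k _ => ?_
        congr 2
        · push_cast; ring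
        · congr 1
          apply PNat.eq
          simp; omega
      · intro k hk
        rw [Finset.mem_range] at hk
        rw [hZ _ _ (by omega), zero_mul]
    have hstar : ∀ u v k, qsum yMul (fun w => zSer φ w k) u v =
        yOp K v (zSer φ u) k + yOp K u (zSer φ v) k := fun u v k => by
      rw [← qsum_apply, qsum_zSer hφ]; rfl
    ext g
    have h2 := map_qsum yMul (AddMonoidHom.eval g) (zFun φ) (a :: u) (b :: v)
    rw [AddMonoidHom.eval_apply_apply] at h2
    rw [h2]
    simp only [AddMonoidHom.eval_apply_apply]
    have h3 : qsum yMul (fun w => zFun φ w g) (a :: u) (b :: v) =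
        qsum yMul (fun w => ∑ k ∈ Finset.range (yWeight (a :: u) + yWeight (b :: v)),
          zSer φ w (k + 1) * g (k.succPNat, yDeg (a :: u) * yDeg (b :: v))) (a :: u) (b :: v) :=
      qsum_congr fun w hw => by rw [zFun_apply, yWeight_of_mem hw, yDeg_of_mem hw]
    rw [h3, qsum_sum]
    simp only [mul_comm (zSer φ _ _) _, qsum_mul_left, hstar]
    simp only [mul_comm (g _) _, add_mul, Finset.sum_add_distrib,
      AddMonoidHom.add_apply]
    congr 1
    · rcases v with _ | ⟨b', v⟩
      · simp only [yOp, shiftHom, AddMonoidHom.coe_mk, ZeroHom.coe_mk, if_true]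
        rw [h1 _ _ _ _ _ (by simp)]
        simp [zFun_apply, mulRightHom, yMul]
      · simp [yOp_of_length (K := K) (w := b :: b' :: v) (by simp)]
    · rcases u with _ | ⟨a', u⟩
      · simp only [yOp, shiftHom, AddMonoidHom.coe_mk, ZeroHom.coe_mk, if_true]
        rw [h1 _ _ _ _ _ (by simp [add_comm])]
        simp [zFun_apply, mulLeftHom, yMul, add_comm]
      · simp [yOp_of_length (K := K) (w := a :: a' :: u) (by simp)]

/-- The value of the operator `replaceHead` for the functionals `lastFun`. -/
def headSum : (ℕ → List (ℕ+ × G) → K) → G → (List (ℕ+ × G) → K) → List (ℕ+ × G) → K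
  | _, _, _, [] => 0
  | φ, δ, h, y :: s => letterHom y.1 (fun i => φ i []) (δ * y.2) (fun x => h (x :: s)) +
      headSum (fun i u => φ i (y :: u)) (δ * y.2) h s

theorem conv_lastFun (φ : ℕ → List (ℕ+ × G) → K) (δ : G) (h : List (ℕ+ × G) → K)
    (w : List (ℕ+ × G)) : replaceHead (lastFun φ δ) h w = headSum φ δ h w := by
  unfold replaceHead
  induction w generalizing φ δ with
  | nil => simp [conv_nil, lastFun, headSum]
  | cons y s ih =>
    rw [conv_cons, headSum, ← ih]
    simp only [lastFun, conv_add_left, conv_ite_nil_left]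
    simp

end ZDerivation

/-! ### The derivation `d_ψ` on words in the letters `y_{k,ζ}` -/

section CycWords

open NCSeries

variable {N : ℕ} {K : Type*} [Field K]

theorem yWord_cons {G : Type*} (y : ℕ+ × G) (w : List (ℕ+ × G)) :
    yWord (y :: w) = List.replicate ((y.1 : ℕ) - 1) none ++ some y.2 :: yWord w := by
  simp [yWord]

/-- The image under the permutation of words `𝐩`, started at `ζ`, of the word in `x₀, x_ζ`
corresponding to a word in `y_{k,ζ}`. -/
def pyWord (ζ : Mu N) (w : List (CycY N)) : List (CycX N) := pWord ζ (yWord w)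

@[simp] theorem pyWord_nil (ζ : Mu N) : pyWord ζ [] = [] := rfl

theorem pyWord_cons (ζ : Mu N) (y : CycY N) (w : List (CycY N)) :
    pyWord ζ (y :: w) =
      List.replicate ((y.1 : ℕ) - 1) none ++ some (ζ * y.2) :: pyWord (ζ * y.2) w := by
  have h : ∀ n w, pWord ζ (List.replicate n none ++ w) = List.replicate n none ++ pWord ζ w := by
    intro n w
    induction n with
    | zero => rfl
    | succ n ih => simp [List.replicate_succ, pWord, ih]
  rw [pyWord, yWord_cons, h]; rfl

theorem pyWord_append (ζ : Mu N) (u w : List (CycY N)) :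
    pyWord ζ (u ++ w) = pyWord ζ u ++ pyWord (ζ * yDeg u) w := by
  induction u generalizing ζ with
  | nil => simp
  | cons y u ih => simp [pyWord_cons, ih, mul_assoc]

theorem length_pyWord (ζ : Mu N) (w : List (CycY N)) : (pyWord ζ w).length = yWeight w := by
  induction w generalizing ζ with
  | nil => rfl
  | cons y w ih =>
    have := y.1.pos
    simp [pyWord_cons, ih]; omega

theorem map_pyWord (ξ ζ : Mu N) (w : List (CycY N)) :
    (pyWord ζ w).map (Option.map (ξ * ·)) = pyWord (ξ * ζ) w := by
  induction w generalizing ζ with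
  | nil => rfl
  | cons y w ih => simp [pyWord_cons, ih, mul_assoc]

/-- The reversal of words in `x₀, x_ζ` in terms of the letters `y_{k,ζ}`. -/
theorem reverse_pyWord (ζ : Mu N) (m : List (CycY N)) (hm : m ≠ []) :
    (some ζ :: (pyWord ζ m).dropLast).reverse = pyWord (ζ * yDeg m) (yRev m) := by
  induction m generalizing ζ with
  | nil => exact absurd rfl hm
  | cons y m ih =>
    rw [pyWord_cons, yRev_cons, pyWord_append, pyWord_cons]
    have hdeg : ∀ m : List (CycY N), yDeg (yRev m) = (yDeg m)⁻¹ := by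
      intro m
      induction m with
      | nil => simp
      | cons y m ih => simp [ih, mul_comm]
    rw [hdeg]
    rcases eq_or_ne m [] with rfl | hm'
    · simp
    · have h2 := ih (ζ * y.2) hm'
      have h3 : (List.replicate ((y.1 : ℕ) - 1) (none : CycX N) ++ some (ζ * y.2) ::
          pyWord (ζ * y.2) m).dropLast = List.replicate ((y.1 : ℕ) - 1) none ++
          (some (ζ * y.2) :: (pyWord (ζ * y.2) m).dropLast) := by
        rw [List.dropLast_append_of_ne_nil (by simp), List.dropLast_cons_of_ne_nil]
        rw [← List.length_pos_iff, length_pyWord]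
        rcases m with _ | ⟨y', m⟩
        · exact absurd rfl hm'
        · have := y'.1.pos; simp
      rw [h3, List.reverse_cons, List.reverse_append, h2]
      simp [mul_assoc]

/-- The restriction `π_Y (𝐩⁻¹ f)` of a series to words in the letters `y_{k,ζ}`. -/
def flat (f : NCSeries K (CycX N)) (w : List (CycY N)) : K := f (pyWord 1 w)

/-- The series `Φ_i` with `ψ = ∑ Φ_i x₀^i`, on words in the letters `y_{k,ζ}`. -/
def rightSeq (ψ : NCSeries K (CycX N)) (i : ℕ) (w : List (CycY N)) : K :=
  ψ (pyWord 1 w ++ List.replicate i none)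

theorem mul_replicate_append (g h : NCSeries K (CycX N)) (n : ℕ) (a : CycX N)
    (w : List (CycX N)) : (g * h) (List.replicate n none ++ a :: w) =
      ∑ i ∈ Finset.range (n + 1), g (List.replicate (n - i) none) *
        h (List.replicate i none ++ a :: w) +
      (tail (List.replicate n none ++ [a]) g * h) w := by
  rw [← Finset.sum_range_reflect]
  induction n generalizing g with
  | zero => simp [mul_cons]
  | succ n ih =>
    rw [List.replicate_succ, List.cons_append, mul_cons, ih, Finset.sum_range_succ' _ (n + 1)]
    have h1 : tail (List.replicate n none ++ [a]) (tail [none] g) =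
        tail (none :: List.replicate n none ++ [a]) g := rfl
    rw [h1, add_comm (∑ k ∈ Finset.range (n + 1), _) (g _ * _), add_assoc]
    congr 1
    · simp [List.replicate_succ]
    · congr 1
      refine Finset.sum_congr rfl fun i hi => ?_
      rw [Finset.mem_range] at hi
      rw [tail_apply, show n + 1 - (n + 1 + 1 - 1 - (i + 1)) = (n - (n + 1 - 1 - i)) + 1 by omega,
        List.replicate_succ, show n + 1 + 1 - 1 - (i + 1) = n + 1 - 1 - i by omega]
      rfl

/-- The product of two series, at the words in the letters `y_{k,ζ}`.  A factorization of such a word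
may cut a letter `y_{k,ζ} = x₀^i x₀^{k-1-i} x_ζ` in two, and then the first factor ends in `x₀^i`. -/
theorem mul_pyWord (g h : NCSeries K (CycX N)) (ζ : Mu N) (s : List (CycY N)) :
    (g * h) (pyWord ζ s) = g (pyWord ζ s) * h [] +
      headSum (fun i u => g (pyWord ζ u ++ List.replicate i none)) ζ (flat h) s := by
  induction s generalizing g ζ with
  | nil => simp [mul_nil, headSum]
  | cons y s ih =>
    have hy : (y.1 : ℕ) - 1 + 1 = y.1 := by have := y.1.pos; omega
    rw [pyWord_cons, mul_replicate_append, ih, headSum, hy]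
    simp only [tail_apply, pyWord_cons, List.append_assoc, List.cons_append, List.nil_append,
      letterHom, AddMonoidHom.coe_mk, ZeroHom.coe_mk, flat, one_mul, Nat.succPNat_coe,
      Nat.succ_eq_add_one, Nat.add_sub_cancel, pyWord_nil]
    ring

variable [NeZero N]

theorem der_replicate_append (c : CycX N → NCSeries K (CycX N)) (f : NCSeries K (CycX N)) (n : ℕ)
    (a : CycX N) (w : List (CycX N)) : der c f (List.replicate n none ++ a :: w) =
      ∑ i ∈ Finset.range (n + 1), ∑ b, (c b * tail (List.replicate i none ++ [b]) f)
        (List.replicate (n - i) none ++ a :: w) +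
      der c (tail (List.replicate n none ++ [a]) f) w := by
  induction n generalizing f with
  | zero => simp [der_cons]
  | succ n ih =>
    have hsum : ∑ i ∈ Finset.range (n + 1), ∑ b, (c b * tail (List.replicate i none ++ [b])
        (tail [none] f)) (List.replicate (n - i) none ++ a :: w) =
        ∑ i ∈ Finset.range (n + 1), ∑ b, (c b * tail (List.replicate (i + 1) none ++ [b]) f)
        (List.replicate (n + 1 - (i + 1)) none ++ a :: w) := by
      refine Finset.sum_congr rfl fun i hi => ?_
      rw [show n + 1 - (i + 1) = n - i by omega]
      rfl
    have hder : der c (tail (List.replicate n none ++ [a]) (tail [none] f)) w =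
        der c (tail (List.replicate (n + 1) none ++ [a]) f) w := rfl
    have hzero : ∑ b, (c b * tail [b] f) (none :: (List.replicate n none ++ a :: w)) =
        ∑ b, (c b * tail (List.replicate 0 none ++ [b]) f)
        (List.replicate (n + 1 - 0) none ++ a :: w) := rfl
    rw [List.replicate_succ, List.cons_append, der_cons, ih, Finset.sum_range_succ' _ (n + 1),
      hsum, hder, hzero, List.replicate_succ]
    ring

/-- The sum of the products `g_ζ x_ζ h_ζ`. -/
noncomputable def midSum (g h : Mu N → NCSeries K (CycX N)) (w : List (CycX N)) : K :=
  ∑ ζ, (g ζ * (X (some ζ) * h ζ) : NCSeries K (CycX N)) w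

theorem midSum_replicate_append (g h : Mu N → NCSeries K (CycX N)) (n : ℕ) (ζ : Mu N)
    (w : List (CycX N)) : midSum g h (List.replicate n none ++ some ζ :: w) =
      g ζ (List.replicate n none) * h ζ w +
        midSum (fun η => tail (List.replicate n none ++ [some ζ]) (g η)) h w := by
  classical
  have hcons : ∀ (g h : NCSeries K (CycX N)) (ζ : Mu N) (b : CycX N) (w : List (CycX N)),
      (g * (X (some ζ) * h) : NCSeries K (CycX N)) (b :: w) = g [] * (if b = some ζ then h w else 0) +
        (tail [b] g * (X (some ζ) * h) : NCSeries K (CycX N)) w := by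
    intro g h ζ b w; rw [mul_cons, X_mul_cons]; congr
  induction n generalizing g with
  | zero =>
    simp only [List.replicate_zero, List.nil_append, midSum, hcons, Finset.sum_add_distrib]
    congr 1
    rw [Finset.sum_eq_single ζ]
    · simp
    · intro η _ h; simp [Ne.symm h]
    · simp
  | succ n ih =>
    have h1 : midSum g h (none :: (List.replicate n none ++ some ζ :: w)) =
        midSum (fun η => tail [none] (g η)) h (List.replicate n none ++ some ζ :: w) := by
      simp [midSum, hcons]
    rw [List.replicate_succ, List.cons_append, h1, ih]
    rfl

/-- The functionals describing `midSum` on words in the letters `y_{k,ζ}`. -/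
def midFun (g : Mu N → NCSeries K (CycX N)) (k : ℕ) (U : List (CycX N)) (ζ : Mu N)
    (m : List (CycY N)) : (CycY N → K) →+ K :=
  if m = [] then 0 else
    (AddMonoidHom.mulLeft (g (ζ * yDeg m) (U ++ (pyWord ζ m).dropLast))).comp
      (Pi.evalAddMonoidHom (fun _ : CycY N => K) (k.succPNat, ζ * yDeg m))

/-- The terms `g_ζ x_ζ h_ζ` of `d_ψ`, at the words in the letters `y_{k,ζ}`: a subword ending in
`x_ζ` is replaced by a single letter `y_{k+1,ζ}`. -/
theorem midSum_pyWord (g : Mu N → NCSeries K (CycX N)) (f : NCSeries K (CycX N)) (k : ℕ)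
    (U : List (CycX N)) (ζ : Mu N) (s : List (CycY N)) :
    midSum (fun η => tail U (g η)) (fun η => tail (List.replicate k none ++ [some η]) f)
      (pyWord ζ s) = replaceHead (midFun g k U ζ) (flat f) s := by
  induction s generalizing U ζ with
  | nil =>
    have : ∀ ζ : Mu N, ∀ g h : NCSeries K (CycX N),
        (g * (X (some ζ) * h) : NCSeries K (CycX N)) [] = 0 := by
      intro ζ g h; simp [mul_nil, X_nil]
    simp [midSum, this, replaceHead, conv_nil, midFun]
  | cons y s ih =>
    rw [pyWord_cons, midSum_replicate_append, replaceHead, conv_cons]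
    have h1 : (fun m => midFun g k U ζ (y :: m)) = fun m =>
        (if m = [] then (AddMonoidHom.mulLeft (g (ζ * y.2)
            (U ++ List.replicate ((y.1 : ℕ) - 1) none))).comp
          (Pi.evalAddMonoidHom (fun _ : CycY N => K) (k.succPNat, ζ * y.2)) else 0) +
        midFun g k (U ++ (List.replicate ((y.1 : ℕ) - 1) none ++ [some (ζ * y.2)])) (ζ * y.2) m := by
      funext m
      rcases m with _ | ⟨y', m⟩
      · simp [midFun, pyWord_cons]
      · have h0 : (pyWord (ζ * y.2) (y' :: m)) ≠ [] := by
          rw [← List.length_pos_iff, length_pyWord]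
          have := y'.1.pos; simp
        have h2 : (pyWord ζ (y :: y' :: m)).dropLast = List.replicate ((y.1 : ℕ) - 1) none ++
            (some (ζ * y.2) :: (pyWord (ζ * y.2) (y' :: m)).dropLast) := by
          rw [pyWord_cons, List.dropLast_append_of_ne_nil (by simp),
            List.dropLast_cons_of_ne_nil h0]
        simp [midFun, h2, mul_assoc]
    rw [h1, conv_add_left, conv_ite_nil_left]
    have h3 := ih (U ++ (List.replicate ((y.1 : ℕ) - 1) none ++ [some (ζ * y.2)])) (ζ * y.2)
    have h4 : ∀ η, tail (List.replicate ((y.1 : ℕ) - 1) none ++ [some (ζ * y.2)]) (tail U (g η)) =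
        tail (U ++ (List.replicate ((y.1 : ℕ) - 1) none ++ [some (ζ * y.2)])) (g η) := by
      intro η; ext w; simp
    simp only [h4]
    rw [h3, replaceHead]
    simp [midFun, flat, pyWord_cons]

/-- The antipode turns the terms of `d_ψ` with `ψ` on the left of the letter into `y(t) χ(t)`. -/
theorem neg_midFun_tCyc [CharZero K] {ψ : NCSeries K (CycX N)} (hψ : IsPrim noMul ψ)
    (hx : ∀ i, ψ (List.replicate i none) = 0) (k j : ℕ) (ζ : Mu N) (m : List (CycY N))
    (g : CycY N → K) :
    midFun (fun η => tCyc η ψ) k (List.replicate j none ++ [some ζ]) ζ m g =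
      -(antiSeq (rightSeq ψ) j m * g (k.succPNat, ζ * yDeg m)) := by
  rcases eq_or_ne m [] with rfl | hm
  · simp [midFun, antiSeq, yAnti, rightSeq, hx]
  rw [midFun, if_neg hm]
  have hlen : (List.replicate j (none : CycX N) ++ [some ζ] ++ (pyWord ζ m).dropLast).length =
      j + yWeight m := by
    have : 0 < yWeight m := by
      rcases m with _ | ⟨y, m⟩
      · exact absurd rfl hm
      · have := y.1.pos; simp
    simp [length_pyWord]; omega
  have hrev : ((List.replicate j (none : CycX N) ++ [some ζ] ++ (pyWord ζ m).dropLast).map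
      (Option.map ((ζ * yDeg m)⁻¹ * ·))).reverse =
      pyWord 1 (yRev m) ++ List.replicate j none := by
    have h := reverse_pyWord ζ m hm
    rw [List.reverse_cons] at h
    rw [List.append_assoc, List.map_append, List.reverse_append, ← List.map_reverse (l := [some ζ] ++ _),
      List.reverse_append, List.reverse_singleton, h, map_pyWord]
    simp
  have h := hψ.apply_reverse ((List.replicate j (none : CycX N) ++ [some ζ] ++
    (pyWord ζ m).dropLast).map (Option.map ((ζ * yDeg m)⁻¹ * ·)))
  rw [hrev, List.length_map, hlen] at h
  simp only [AddMonoidHom.comp_apply, AddMonoidHom.coe_mulLeft, Pi.evalAddMonoidHom_apply,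
    tCyc_apply, antiSeq, yAnti, rightSeq, h]
  have h2 : ((-1 : K) ^ (j + yWeight m)) * (-1) ^ (j + yWeight m) = 1 := by
    rw [← mul_pow]; simp
  rw [pow_add] at *
  linear_combination (- ψ ((List.replicate j (none : CycX N) ++ [some ζ] ++
    (pyWord ζ m).dropLast).map (Option.map ((ζ * yDeg m)⁻¹ * ·))) * g (k.succPNat, ζ * yDeg m)) * h2

end CycWords

/-! ### Comparison of `d_ψ` with the derivation `y(t) ↦ Z(t)` -/

section

variable {A M M' M'' : Type*} [AddCommMonoid M] [AddCommMonoid M'] [AddCommMonoid M'']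

theorem conv_sum_left {ι : Type*} (B : M →+ M' →+ M'') (s : Finset ι) (f : ι → List A → M)
    (g : List A → M') (w : List A) :
    conv B (fun u => ∑ i ∈ s, f i u) g w = ∑ i ∈ s, conv B (f i) g w := by
  induction s using Finset.cons_induction with
  | empty => simp
  | cons a s ha ih => simp only [Finset.sum_cons, conv_add_left, ih]

end

theorem NCSeries.mul_eq_conv {K : Type*} [CommRing K] {A : Type*} (f g : NCSeries K A) (w : List A) :
    (f * g) w = conv AddMonoidHom.mul f g w := by
  induction w generalizing f with
  | nil => rw [mul_nil]; rfl
  | cons a w ih => exact (mul_cons f g a w).trans (congrArg (f [] * g (a :: w) + ·) (ih _))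

section CycWords

open NCSeries

variable {N : ℕ} [NeZero N] {K : Type*} [Field K] [CharZero K]

theorem sum_dCycLetter_mul (ψ : NCSeries K (CycX N)) (h : CycX N → NCSeries K (CycX N))
    (w : List (CycX N)) : ∑ b, (dCycLetter ψ b * h b : NCSeries K (CycX N)) w =
      ∑ ζ, (X (some ζ) * (tCyc ζ ψ * h (some ζ)) : NCSeries K (CycX N)) w -
      midSum (fun ζ => tCyc ζ ψ) (fun ζ => h (some ζ)) w := by
  rw [Fintype.sum_option, midSum, ← Finset.sum_sub_distrib]
  have h0 : (dCycLetter ψ none * h none : NCSeries K (CycX N)) w = 0 := by simp [dCycLetter]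
  rw [h0, zero_add]
  refine Finset.sum_congr rfl fun ζ _ => ?_
  rw [← NCSeries.sub_apply, ← mul_assoc, ← mul_assoc, ← sub_mul]; rfl

/-- The recursion for `d_ψ`, after the first letter `x_η` of a word.  The term `x_ζ t_ζ(ψ)` of
`[x_ζ, t_ζ(ψ)]` contributes only if it begins at this letter; the terms `t_ζ(ψ) x_ζ` may begin
with any of the letters `x₀` before it. -/
theorem dCyc_replicate_append (ψ f : NCSeries K (CycX N)) (n : ℕ) (η : Mu N)
    (w : List (CycX N)) : dCyc ψ f (List.replicate n none ++ some η :: w) =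
      (tCyc η ψ * tail (List.replicate n none ++ [some η]) f +
        dCyc ψ (tail (List.replicate n none ++ [some η]) f)) w -
      ∑ i ∈ Finset.range (n + 1), midSum (fun ζ => tCyc ζ ψ)
        (fun ζ => tail (List.replicate i none ++ [some ζ]) f)
        (List.replicate (n - i) none ++ some η :: w) := by
  classical
  rw [dCyc, der_replicate_append]
  simp only [sum_dCycLetter_mul, Finset.sum_sub_distrib, NCSeries.add_apply]
  rw [Finset.sum_range_succ, Finset.sum_eq_zero]
  · rw [Nat.sub_self, List.replicate_zero, List.nil_append, Finset.sum_eq_single η]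
    · rw [X_mul_cons, if_pos rfl]; ring
    · intro ζ _ hζ
      rw [X_mul_cons, if_neg (by simpa using Ne.symm hζ)]
    · simp
  · intro i hi
    rw [Finset.mem_range] at hi
    refine Finset.sum_eq_zero fun ζ _ => ?_
    obtain ⟨k, hk⟩ : ∃ k, n - i = k + 1 := ⟨n - i - 1, by omega⟩
    rw [hk, List.replicate_succ, List.cons_append, X_mul_cons, if_neg (by simp)]

/-- The terms `t_ζ(ψ) x_ζ` of `d_ψ` which begin in the first letter `y_{k,ζ}` of a word give the part
`y(t) χ(t)` of `Z(t)`. -/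
theorem sum_midSum {ψ : NCSeries K (CycX N)} (hψ : IsPrim noMul ψ)
    (hx : ∀ i, ψ (List.replicate i none) = 0) (f : NCSeries K (CycX N)) (y : CycY N)
    (w : List (CycY N)) :
    ∑ i ∈ Finset.range y.1, midSum (fun ζ => tCyc ζ ψ)
        (fun ζ => tail (List.replicate i none ++ [some ζ]) f)
        (List.replicate (y.1 - 1 - i) none ++ some y.2 :: pyWord y.2 w) =
      - replaceHead (firstFun (antiSeq (rightSeq ψ))) (flat f) (y :: w) := by
  have h1 : ∀ i, midSum (fun ζ => tCyc ζ ψ)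
        (fun ζ => tail (List.replicate i none ++ [some ζ]) f)
        (List.replicate (y.1 - 1 - i) none ++ some y.2 :: pyWord y.2 w) =
      replaceHead (midFun (fun ζ => tCyc ζ ψ) i
        (List.replicate (y.1 - 1 - i) none ++ [some y.2]) y.2) (flat f) w := by
    intro i
    rw [midSum_replicate_append, midSum_pyWord, tCyc_apply, List.map_replicate]
    simp [hx]
  simp only [h1]
  have h2 : replaceHead (firstFun (antiSeq (rightSeq ψ))) (flat f) (y :: w) =
      conv (AddMonoidHom.id _) (fun m => firstFun (antiSeq (rightSeq ψ)) (y :: m))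
        (fun s x => flat f (x :: s)) w := by
    rw [replaceHead, conv_cons]
    simp [firstFun]
  rw [h2, eq_neg_iff_add_eq_zero]
  unfold replaceHead
  rw [← conv_sum_left, ← conv_add_left]
  have h3 : (fun m => ∑ i ∈ Finset.range y.1, midFun (fun ζ => tCyc ζ ψ) i
        (List.replicate (y.1 - 1 - i) none ++ [some y.2]) y.2 m +
        firstFun (antiSeq (rightSeq ψ)) (y :: m)) = fun _ => 0 := by
    funext m
    ext g
    rw [AddMonoidHom.add_apply, AddMonoidHom.finsetSum_apply]
    simp only [neg_midFun_tCyc hψ hx, Finset.sum_neg_distrib]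
    simp [firstFun, letterHom]
  rw [h3, conv_zero_left]

/-- The operator `f ↦ ψ f + d_ψ(f)` in terms of the letters `y_{k,ζ}`. -/
theorem flat_mul_add_dCyc {ψ : NCSeries K (CycX N)} (hψ : IsPrim noMul ψ)
    (hx : ∀ i, ψ (List.replicate i none) = 0) (f : NCSeries K (CycX N)) (w : List (CycY N)) :
    flat (ψ * f + dCyc ψ f) w = replaceDer (zFun (rightSeq ψ)) (flat f) w +
      conv AddMonoidHom.mul (flat f) (flat ψ) w := by
  induction w generalizing f with
  | nil =>
    have h1 : dCyc ψ f [] = 0 := by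
      have h2 : ∀ a, dCycLetter ψ a [] = 0 := by
        intro a
        cases a with
        | none => rfl
        | some ζ => simp [dCycLetter, mul_nil, X_nil]
      rw [dCyc, der_nil]
      exact Finset.sum_eq_zero fun a _ => by rw [mul_nil, h2, zero_mul]
    have h2 : ψ [] = 0 := hψ.1
    simp [flat, mul_nil, h1, h2, replaceDer_nil, conv_nil]
  | cons y w ih =>
    have hy : (y.1 : ℕ) - 1 + 1 = y.1 := by have := y.1.pos; omega
    have ht : ∀ g : NCSeries K (CycX N), ∀ v, tCyc y.2⁻¹ g (pyWord 1 v) = g (pyWord y.2 v) := by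
      intro g v
      rw [tCyc_apply, map_pyWord]; simp
    set U : List (CycX N) := List.replicate ((y.1 : ℕ) - 1) none ++ [some y.2] with hU
    have hflat : (fun v => flat f (y :: v)) = flat (tCyc y.2⁻¹ (tail U f)) := by
      funext v
      rw [flat, flat, ht, pyWord_cons]
      simp [hU]
    have hD : (tCyc y.2 ψ * tail U f + dCyc ψ (tail U f)) (pyWord y.2 w) =
        flat (ψ * tCyc y.2⁻¹ (tail U f) + dCyc ψ (tCyc y.2⁻¹ (tail U f))) w := by
      have h3 : ψ * tCyc y.2⁻¹ (tail U f) + dCyc ψ (tCyc y.2⁻¹ (tail U f)) =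
          tCyc y.2⁻¹ (tCyc y.2 ψ * tail U f + dCyc ψ (tail U f)) := by
        rw [map_add, tCyc_mul, tCyc_tCyc, inv_mul_cancel, tCyc_one, dCyc_tCyc]
      rw [h3, flat, ht]
    have hz : replaceHead (zFun (rightSeq ψ)) (flat f) (y :: w) =
        headSum (rightSeq ψ) 1 (flat f) (y :: w) +
        replaceHead (firstFun (antiSeq (rightSeq ψ))) (flat f) (y :: w) := by
      rw [← conv_lastFun, ← replaceHead_add_left]
      congr 1
      funext m; exact zFun_eq _ m
    have hdC := dCyc_replicate_append ψ f ((y.1 : ℕ) - 1) y.2 (pyWord y.2 w)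
    rw [hy, sum_midSum hψ hx, ← hU, hD, ih] at hdC
    rw [replaceDer_cons, hz, conv_cons, hflat]
    rw [flat, NCSeries.add_apply, mul_pyWord]
    have h4 : pyWord 1 (y :: w) = List.replicate ((y.1 : ℕ) - 1) none ++ some y.2 :: pyWord y.2 w := by
      rw [pyWord_cons, one_mul]
    rw [h4, hdC, ← h4]
    simp only [AddMonoidHom.mul_apply, flat, pyWord_nil]
    change _ + headSum (rightSeq ψ) 1 (flat f) (y :: w) + _ = _
    ring

end CycWords

/-! ### The part of `Z(t)` given by an odd series -/

section InnerPart

variable {G K : Type*} [CommGroup G] [Field K]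

/-- The sequence `φ_0 = c`, `φ_i = 0` for `i > 0`. -/
def constSeq (c : List (ℕ+ × G) → K) (i : ℕ) (w : List (ℕ+ × G)) : K := if i = 0 then c w else 0

theorem letterHom_constSeq (n : ℕ+) (c : ℕ → K) (hc : ∀ i, i ≠ 0 → c i = 0) (γ : G)
    (g : ℕ+ × G → K) : letterHom n c γ g = c 0 * g (n, γ) := by
  have hn := n.pos
  change ∑ k ∈ Finset.range n, c (n - 1 - k) * g (k.succPNat, γ) = _
  rw [Finset.sum_eq_single ((n : ℕ) - 1)]
  · rw [Nat.sub_self]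
    congr 3
    apply PNat.eq
    simp only [Nat.succPNat_coe, Nat.succ_eq_add_one]
    omega
  · intro k hk h
    rw [Finset.mem_range] at hk
    rw [hc _ (by omega), zero_mul]
  · intro h; simp only [Finset.mem_range] at h; omega

theorem headSum_constSeq (c h : List (ℕ+ × G) → K) (δ : G) (hc : ∀ s, c s ≠ 0 → δ * yDeg s = 1)
    (w : List (ℕ+ × G)) :
    headSum (constSeq c) δ h w = conv AddMonoidHom.mul c h w - c w * h [] := by
  induction w generalizing c δ with
  | nil => simp [headSum, conv_nil]
  | cons y w ih =>
    rw [headSum, conv_cons, letterHom_constSeq _ _ (by intro i hi; simp [constSeq, hi])]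
    have h1 : (fun i u => constSeq c i (y :: u)) = constSeq fun u => c (y :: u) := rfl
    rw [h1, ih _ (δ * y.2) fun s hs => by rw [← hc _ hs]; simp [mul_assoc]]
    have h2 : constSeq c 0 [] * h ((y.1, δ * y.2) :: w) = c [] * h (y :: w) := by
      by_cases h0 : c [] = 0
      · simp [constSeq, h0]
      · have := hc _ h0
        simp only [yDeg_nil, mul_one] at this
        simp [constSeq, this]
    rw [h2]
    simp only [AddMonoidHom.mul_apply]
    ring

/-- The part of `Z(t)` coming from an odd series `c` is the commutator with `c`. -/
theorem replaceDer_constSeq (c : List (ℕ+ × G) → K) (hc : ∀ s, c s ≠ 0 → yDeg s = 1)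
    (hodd : ∀ s, yAnti c s = -c s) (f : List (ℕ+ × G) → K) (w : List (ℕ+ × G)) :
    replaceDer (zFun (constSeq c)) f w =
      conv AddMonoidHom.mul c f w - conv AddMonoidHom.mul f c w := by
  induction w generalizing f with
  | nil => simp [replaceDer_nil, conv_nil, mul_comm]
  | cons b w ih =>
    have h1 : replaceHead (zFun (constSeq c)) f (b :: w) =
        headSum (constSeq c) 1 f (b :: w) +
        replaceHead (firstFun (antiSeq (constSeq c))) f (b :: w) := by
      rw [← conv_lastFun, ← replaceHead_add_left]
      congr 1
      funext m; exact zFun_eq _ m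
    have h2 : replaceHead (firstFun (antiSeq (constSeq c))) f (b :: w) =
        -conv AddMonoidHom.mul c (fun s => f (b :: s)) w := by
      have h3 : ∀ m, firstFun (antiSeq (constSeq c)) (b :: m) =
          ((AddMonoidHom.mulLeft (-c m)).comp (Pi.evalAddMonoidHom (fun _ : ℕ+ × G => K) b)) := by
        intro m
        ext g
        rw [firstFun, letterHom_constSeq]
        · have h5 : antiSeq (constSeq c) 0 m = yAnti c m := by
            simp [antiSeq, yAnti, constSeq]
          rw [h5, hodd]
          by_cases h0 : c m = 0
          · simp [h0]
          · simp [hc _ h0]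
        · intro i hi
          simp [antiSeq, yAnti, constSeq, hi]
      have h4 : ∀ (c : List (ℕ+ × G) → K) (u : List (ℕ+ × G)), conv (AddMonoidHom.id _)
          (fun m => (AddMonoidHom.mulLeft (-c m)).comp (Pi.evalAddMonoidHom (fun _ : ℕ+ × G => K) b))
          (fun s y => f (y :: s)) u = -conv AddMonoidHom.mul c (fun s => f (b :: s)) u := by
        intro c u
        induction u generalizing c with
        | nil => simp [conv_nil]
        | cons a u ih => rw [conv_cons, conv_cons, ih]; simp; ring
      rw [replaceHead, conv_cons]
      simp only [h3, h4]
      simp [firstFun]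
    rw [replaceDer_cons, h1, h2, headSum_constSeq c f 1 (by simpa using hc), ih, conv_cons _ f c]
    simp only [AddMonoidHom.mul_apply]
    ring

theorem zSer_add (φ φ' : ℕ → List (ℕ+ × G) → K) (w : List (ℕ+ × G)) :
    zSer (fun i w => φ i w + φ' i w) w = zSer φ w + zSer φ' w := by
  have h1 : ∀ φ φ' : ℕ → List (ℕ+ × G) → K, laurent (fun i w => φ i w + φ' i w) =
      fun w => laurent φ w + laurent φ' w := by
    intro φ φ'; funext w k
    by_cases hk : k ≤ 0 <;> simp [laurent, hk]
  have h2 : antiSeq (fun i w => φ i w + φ' i w) = fun i w => antiSeq φ i w + antiSeq φ' i w := by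
    funext i w; simp [antiSeq, yAnti]; ring
  rw [zSer, h2, h1, h1, conv_add_left, conv_add_right]
  simp only [zSer]
  abel

theorem zFun_add (φ φ' : ℕ → List (ℕ+ × G) → K) (w : List (ℕ+ × G)) :
    zFun (fun i w => φ i w + φ' i w) w = zFun φ w + zFun φ' w := by
  rw [zFun, zSer_add, zHom_add]; rfl

/-! ### Shuffle products with `x₀` -/

/-- The functionals describing the derivation `y_{k+1,γ} ↦ k y_{k,γ}`, `y_{1,γ} ↦ 0`.  It is the
transpose of the derivation `y_{k,γ} ↦ k y_{k+1,γ}` of words, which is the shuffle product with `x₀`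
up to words ending in `x₀`. -/
def raiseFun : List (ℕ+ × G) → (ℕ+ × G → K) →+ K
  | [] => 0
  | y :: m => if m = [] then (AddMonoidHom.mulLeft ((y.1 : ℕ) : K)).comp
      (Pi.evalAddMonoidHom (fun _ : ℕ+ × G => K) (y.1 + 1, y.2)) else 0

theorem isCoderLetters_raiseFun :
    IsCoderLetters yMul (raiseFun : List (ℕ+ × G) → (ℕ+ × G → K) →+ K) where
  nil := rfl
  cons a b u v := by
    have hlong : ∀ w : List (ℕ+ × G), 2 ≤ w.length → (raiseFun w : (ℕ+ × G → K) →+ K) = 0 := by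
      intro w hw
      rcases w with _ | ⟨y, _ | ⟨y', w⟩⟩ <;> simp_all [raiseFun]
    by_cases h : u = [] ∧ v = []
    · obtain ⟨rfl, rfl⟩ := h
      rw [qsum_cons_cons]
      ext g
      have h1 := hlong [a, b] (by simp)
      have h2 := hlong [b, a] (by simp)
      simp only [qsum_nil_left, qsum_nil_right, yMul, Option.elim_some, h1, h2, if_true, zero_add]
      simp only [raiseFun, if_true, AddMonoidHom.add_apply, AddMonoidHom.comp_apply, Pi.evalAddMonoidHom_apply, AddMonoidHom.coe_mulLeft,
        mulRightHom, mulLeftHom, AddMonoidHom.coe_mk, ZeroHom.coe_mk, PNat.add_coe, Nat.cast_add]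
      simp only [yMul, Option.elim_some]
      rw [add_right_comm a.1 1 b.1, ← add_assoc a.1 b.1 1, add_mul]
    · have h0 : qsum yMul (raiseFun : List (ℕ+ × G) → (ℕ+ × G → K) →+ K) (a :: u) (b :: v) = 0 := by
        rw [← qsum_zero yMul (a :: u) (b :: v)]
        refine qsum_congr fun w hw => hlong w ?_
        have := length_le_of_mem_quasiShuffle hw
        rcases u with _ | ⟨_, u⟩ <;> rcases v with _ | ⟨_, v⟩ <;> simp at h this ⊢ <;> omega
      rw [h0]
      rcases u with _ | ⟨_, u⟩ <;> rcases v with _ | ⟨_, v⟩ <;> simp [raiseFun] at h ⊢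

theorem replaceDer_raiseFun_cons (f : List (ℕ+ × G) → K) (y : ℕ+ × G) (w : List (ℕ+ × G)) :
    replaceDer raiseFun f (y :: w) = ((y.1 : ℕ) : K) * f ((y.1 + 1, y.2) :: w) +
      replaceDer raiseFun (fun u => f (y :: u)) w := by
  rw [replaceDer_cons, replaceHead, conv_cons]
  simp only [raiseFun]
  rw [conv_ite_nil_left]
  simp

theorem replaceDer_raiseFun_eq_zero {f : List (ℕ+ × G) → K}
    (hf : ∀ w, ∀ y ∈ w, y.1 ≠ 1 → f w = 0) (w : List (ℕ+ × G)) :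
    replaceDer raiseFun f w = 0 := by
  induction w generalizing f with
  | nil => rfl
  | cons y w ih =>
    rw [replaceDer_raiseFun_cons, ih fun w y' hy' h => hf _ y' (by simp [hy']) h,
      hf _ (y.1 + 1, y.2) (by simp), mul_zero, zero_add]
    intro h
    have := congrArg PNat.val h
    have := y.1.pos
    simp at *

end InnerPart

section Recursion

open NCSeries

variable {N : ℕ} {K : Type*} [Field K]

theorem qsum_singleton_cons {A M : Type*} [AddCommMonoid M] (f : List A → M) (a b : A)
    (v : List A) : qsum noMul f [a] (b :: v) =
      f (a :: b :: v) + qsum noMul (fun w => f (b :: w)) [a] v := by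
  rw [qsum_cons_cons]; simp [noMul]

theorem qsum_singleton_replicate {A : Type*} (f : List A → K) (a : A) (n : ℕ) (v : List A) :
    qsum noMul f [a] (List.replicate n a ++ v) = n * f (List.replicate (n + 1) a ++ v) +
      qsum noMul (fun w => f (List.replicate n a ++ w)) [a] v := by
  induction n generalizing f with
  | zero => simp
  | succ n ih =>
    rw [List.replicate_succ, List.cons_append, qsum_singleton_cons, ih]
    simp only [List.replicate_succ, List.cons_append]
    push_cast
    ring

/-- The shuffle product with `x₀`, in terms of the letters `y_{k,ζ}`. -/
theorem qsum_none_pyWord (F : List (CycX N) → K) (ζ : Mu N) (w : List (CycY N)) (i : ℕ) :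
    qsum noMul F [none] (pyWord ζ w ++ List.replicate i none) =
      replaceDer raiseFun (fun w => F (pyWord ζ w ++ List.replicate i none)) w +
      (i + 1) * F (pyWord ζ w ++ List.replicate (i + 1) none) := by
  induction w generalizing F ζ with
  | nil =>
    have h := qsum_singleton_replicate F none i []
    simp only [List.append_nil, qsum_nil_right] at h
    rw [pyWord_nil, List.nil_append, h, replaceDer_nil, List.replicate_succ', List.nil_append]
    ring
  | cons y w ih =>
    have hy : (y.1 : ℕ) - 1 + 1 = y.1 := by have := y.1.pos; omega
    have hy2 : (((y.1 : ℕ) - 1 : ℕ) : K) = (y.1 : ℕ) - 1 := by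
      rw [eq_sub_iff_add_eq]; exact_mod_cast congrArg (Nat.cast (R := K)) hy
    rw [pyWord_cons, List.append_assoc, qsum_singleton_replicate, List.cons_append,
      qsum_singleton_cons, hy, hy2]
    have h1 := ih (fun w => F (List.replicate ((y.1 : ℕ) - 1) none ++ some (ζ * y.2) :: w))
      (ζ * y.2)
    rw [h1, replaceDer_raiseFun_cons]
    have h2 : List.replicate ((y.1 : ℕ) - 1) none ++ none :: some (ζ * y.2) ::
        (pyWord (ζ * y.2) w ++ List.replicate i none) = List.replicate (y.1 : ℕ) none ++
        some (ζ * y.2) :: (pyWord (ζ * y.2) w ++ List.replicate i none) := by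
      conv_rhs => rw [← hy, List.replicate_succ']
      simp
    simp only [pyWord_cons, h2, List.append_assoc, List.cons_append, PNat.add_coe, PNat.one_coe,
      Nat.add_sub_cancel]
    ring

/-- As `ψ` vanishes on the shuffle products with `x₀`, the series `Φ_{i+1}` is determined by `Φ_i`. -/
theorem rightSeq_succ {ψ : NCSeries K (CycX N)} (hψ : IsPrim noMul ψ) (h0 : ψ [none] = 0)
    (i : ℕ) (w : List (CycY N)) :
    ((i : K) + 1) * rightSeq ψ (i + 1) w = -replaceDer raiseFun (rightSeq ψ i) w := by
  have h := qsum_none_pyWord ψ 1 w i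
  have h2 : qsum noMul ψ [none] (pyWord 1 w ++ List.replicate i none) = 0 := by
    by_cases hw : pyWord 1 w ++ List.replicate i none = []
    · rw [hw]; exact (qsum_nil_right _ _ _).trans h0
    · exact hψ.2 _ _ (by simp) hw
  rw [h2] at h
  rw [eq_neg_iff_add_eq_zero, add_comm]
  exact h.symm

theorem apply_replicate_none [CharZero K] {ψ : NCSeries K (CycX N)} (hψ : IsPrim noMul ψ)
    (h0 : ψ [none] = 0) (i : ℕ) : ψ (List.replicate i none) = 0 := by
  cases i with
  | zero => exact hψ.1
  | succ i =>
    have h := rightSeq_succ hψ h0 i []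
    rw [replaceDer_nil, neg_zero, mul_eq_zero] at h
    rcases h with h | h
    · exact absurd h (Nat.cast_add_one_ne_zero i)
    · simpa [rightSeq] using h

end Recursion

/-! ### The vanishing of the polar part for double shuffle elements -/

section CycDoubleShuffle

open NCSeries

variable {N : ℕ} {K : Type*} [Field K]

/-- The correction term `∑_{n ≥ 2} ((-1)^{n-1}/n) (ψ | x₀^{n-1} x₁) y_{1,1}^n`. -/
noncomputable def starCorr (ψ : NCSeries K (CycX N)) (w : List (CycY N)) : K :=
  open Classical in if 2 ≤ w.length ∧ ∀ y ∈ w, y = ((1, 1) : CycY N) then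
    (-1) ^ (w.length - 1) / (w.length : K) * ψ (List.replicate (w.length - 1) none ++ [some 1])
  else 0

/-- The series `ψ_*`, with coefficients in any field. -/
noncomputable def starSer (ψ : NCSeries K (CycX N)) (w : List (CycY N)) : K :=
  flat ψ w + starCorr ψ w

/-- The sequence `φ_0 = ψ_*`, `φ_i = Φ_i` for `i > 0`, where `ψ = ∑ Φ_i x₀^i`. -/
noncomputable def starSeq (ψ : NCSeries K (CycX N)) (i : ℕ) (w : List (CycY N)) : K :=
  rightSeq ψ i w + constSeq (starCorr ψ) i w

theorem starSeq_zero (ψ : NCSeries K (CycX N)) : starSeq ψ 0 = starSer ψ := by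
  funext w; simp [starSeq, starSer, rightSeq, flat, constSeq]

theorem starSeq_succ (ψ : NCSeries K (CycX N)) (i : ℕ) :
    starSeq ψ (i + 1) = rightSeq ψ (i + 1) := by
  funext w; simp [starSeq, constSeq]

theorem starCorr_of_ne {ψ : NCSeries K (CycX N)} {w : List (CycY N)}
    (h : ¬(2 ≤ w.length ∧ ∀ y ∈ w, y = ((1, 1) : CycY N))) : starCorr ψ w = 0 := by
  rw [starCorr, if_neg h]

theorem eq_of_starCorr_ne {ψ : NCSeries K (CycX N)} {w : List (CycY N)} (h : starCorr ψ w ≠ 0) :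
    2 ≤ w.length ∧ ∀ y ∈ w, y = ((1, 1) : CycY N) :=
  not_imp_comm.mp starCorr_of_ne h

theorem yDeg_eq_one_of_forall {G : Type*} [CommGroup G] {w : List (ℕ+ × G)}
    (h : ∀ y ∈ w, y = (1, 1)) : yDeg w = 1 := by
  induction w with
  | nil => rfl
  | cons y w ih =>
    rw [yDeg_cons, ih fun y' hy' => h y' (by simp [hy']), h y (by simp)]; simp

theorem eq_replicate_of_forall {A : Type*} {a : A} {w : List A} (h : ∀ y ∈ w, y = a) :
    w = List.replicate w.length a := List.eq_replicate_of_mem h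

theorem forall_yRev {G : Type*} [CommGroup G] {w : List (ℕ+ × G)} :
    (∀ y ∈ yRev w, y = (1, 1)) ↔ ∀ y ∈ w, y = (1, 1) := by
  simp [yRev, Prod.ext_iff]

theorem length_yRev {G : Type*} [CommGroup G] (w : List (ℕ+ × G)) : (yRev w).length = w.length := by
  simp [yRev]

theorem starCorr_yRev (ψ : NCSeries K (CycX N)) (w : List (CycY N)) :
    starCorr ψ (yRev w) = starCorr ψ w := by
  simp only [starCorr, forall_yRev, length_yRev]

theorem yWeight_of_forall {G : Type*} [CommGroup G] {w : List (ℕ+ × G)}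
    (h : ∀ y ∈ w, y = (1, 1)) : yWeight w = w.length := by
  induction w with
  | nil => rfl
  | cons y w ih =>
    rw [yWeight_cons, ih fun y' hy' => h y' (by simp [hy']), h y (by simp)]
    simp [add_comm]

/-- The coefficient of `t` in `φ(t) y(t) + y(t) χ(t)`, at a nonempty word. -/
theorem zSer_one {G : Type*} [CommGroup G] (φ : ℕ → List (ℕ+ × G) → K) (s s' : List (ℕ+ × G))
    (y y' : ℕ+ × G) (h : y :: s = s' ++ [y']) : zSer φ (y :: s) 1 =
      φ ((y'.1 : ℕ) - 1) s' + antiSeq φ ((y.1 : ℕ) - 1) s := by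
  have hp : ∀ (n : ℕ+) (φ : ℕ → List (ℕ+ × G) → K) (s : List (ℕ+ × G)),
      shiftHom K (n : ℕ) (laurent φ s) 1 = φ ((n : ℕ) - 1) s := by
    intro n φ s
    have := n.pos
    rw [← laurent_neg φ s]
    change laurent φ s (1 - (n : ℕ)) = _
    congr 1
    push_cast [Nat.cast_sub this]
    ring
  rw [zSer, conv_yOp_cons]
  rw [h, conv_laurent_append]
  simp only [Pi.add_apply, hp]
  rw [laurent_pos _ _ one_pos, laurent_pos _ _ one_pos]
  ring

variable [CharZero K]

/-- The part of `Z(t)` coming from the `Φ_i` alone vanishes at `t` in index `1`; this is the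
antipode for the shuffle product. -/
theorem zSer_rightSeq_one {ψ : NCSeries K (CycX N)} (hψ : IsPrim noMul ψ) (h0 : ψ [none] = 0)
    {w : List (CycY N)} (hw : yDeg w = 1) : zSer (rightSeq ψ) w 1 = 0 := by
  rcases w with _ | ⟨y, s⟩
  · rw [zSer_nil]
    · rfl
    · intro i; exact apply_replicate_none hψ h0 i
  obtain ⟨s', y', h⟩ : ∃ s' y', y :: s = s' ++ [y'] :=
    ⟨_, _, (List.dropLast_append_getLast (List.cons_ne_nil y s)).symm⟩
  rw [zSer_one _ _ _ _ _ h]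
  have hr := reverse_pyWord (1 : Mu N) (y :: s) (by simp)
  have h1 : (pyWord 1 (y :: s)).dropLast = pyWord 1 s' ++ List.replicate ((y'.1 : ℕ) - 1) none := by
    rw [h, pyWord_append, pyWord_cons]
    rw [List.dropLast_append_of_ne_nil (by simp), List.dropLast_append_of_ne_nil (by simp)]
    simp
  have h2 : pyWord 1 (yRev (y :: s)) = pyWord 1 (yRev s) ++ List.replicate ((y.1 : ℕ) - 1) none ++
      [some (yDeg (yRev s) * y.2⁻¹)] := by
    rw [yRev_cons, pyWord_append, pyWord_cons]; simp
  rw [hw, one_mul, h1, h2, List.reverse_cons] at hr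
  have hr2 := List.append_inj_left' hr rfl
  have h3 := hψ.apply_reverse (pyWord 1 s' ++ List.replicate ((y'.1 : ℕ) - 1) none)
  rw [hr2] at h3
  have hlen : (pyWord 1 s' ++ List.replicate ((y'.1 : ℕ) - 1) none).length =
      ((y.1 : ℕ) - 1) + yWeight s := by
    have h4 := congrArg yWeight h
    have h5 := y.1.pos
    have h6 := y'.1.pos
    simp at h4
    simp [length_pyWord]; omega
  rw [hlen] at h3
  simp only [antiSeq, yAnti, rightSeq]
  rw [h3, pow_add]
  have h7 : ((-1 : K) ^ ((y.1 : ℕ) - 1)) * (-1) ^ ((y.1 : ℕ) - 1) = 1 := by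
    rw [← mul_pow]; simp
  have h8 : ((-1 : K) ^ (yWeight s)) * (-1) ^ (yWeight s) = 1 := by
    rw [← mul_pow]; simp
  linear_combination (-ψ (pyWord 1 s' ++ List.replicate ((y'.1 : ℕ) - 1) none)) * h7 * 
    (-1 : K) ^ (yWeight s) * (-1) ^ (yWeight s)
    - ψ (pyWord 1 s' ++ List.replicate ((y'.1 : ℕ) - 1) none) * h8

/-- The part of `Z(t)` coming from the correction term of `ψ_*` is, at `t` and in index `1`, a series
in `y_{1,1}`. -/
theorem zSer_starCorr_one (ψ : NCSeries K (CycX N)) (w : List (CycY N)) (hw : yDeg w = 1) :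
    zSer (constSeq (starCorr ψ)) w 1 = open Classical in if ∀ y ∈ w, y = ((1, 1) : CycY N) then
      -((1 + (-1) ^ (w.length - 1)) / ((w.length - 1 : ℕ) : K)) *
        ψ (List.replicate (w.length - 2) none ++ [some 1]) else 0 := by
  classical
  rcases w with _ | ⟨y, s⟩
  · rw [zSer_nil]
    · simp
    · intro i; simp [constSeq, starCorr]
  obtain ⟨s', y', h⟩ : ∃ s' y', y :: s = s' ++ [y'] :=
    ⟨_, _, (List.dropLast_append_getLast (List.cons_ne_nil y s)).symm⟩
  rw [zSer_one _ _ _ _ _ h]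
  have hone : ∀ n : ℕ+, ¬ (n : ℕ) - 1 = 0 ∨ n = 1 := by
    intro n
    by_cases hn : n = 1
    · exact Or.inr hn
    · refine Or.inl fun h => hn (PNat.eq ?_)
      have := n.pos
      simp only [PNat.one_coe]; omega
  have hlen : s'.length = s.length := by
    have := congrArg List.length h
    simpa using this.symm
  split_ifs with hall
  · have h1 : ∀ z ∈ s, z = (1, 1) := fun z hz => hall z (by simp [hz])
    have h2 : y = (1, 1) := hall y (by simp)
    have h3 : ∀ z ∈ s', z = (1, 1) := fun z hz => hall z (by rw [h]; simp [hz])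
    have h4 : y' = (1, 1) := hall y' (by rw [h]; simp)
    have h5 : s' = s := by
      rw [eq_replicate_of_forall h1, eq_replicate_of_forall h3, hlen]
    subst h2 h4 h5
    simp only [PNat.one_coe, Nat.sub_self, constSeq, if_true, antiSeq, yAnti, starCorr_yRev,
      yWeight_of_forall h1, pow_zero, one_mul, List.length_cons, Nat.add_sub_cancel]
    by_cases h6 : 2 ≤ s'.length
    · rw [starCorr, if_pos ⟨h6, h1⟩]
      obtain ⟨n, hn⟩ : ∃ n, s'.length = n + 1 := ⟨s'.length - 1, by omega⟩
      rw [hn]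
      simp only [Nat.add_sub_cancel, show n + 1 + 1 - 2 = n by omega]
      have h7 : ((-1 : K) ^ n) * (-1) ^ n = 1 := by
        rw [← mul_pow]; simp
      have h8 : ((n + 1 : ℕ) : K) ≠ 0 := Nat.cast_ne_zero.mpr (by omega)
      field_simp
      rw [pow_succ]
      linear_combination (-(ψ (List.replicate n none ++ [some 1]))) * h7
    · rw [starCorr, if_neg fun h => h6 h.1]
      obtain h7 | h7 : s'.length = 0 ∨ s'.length = 1 := by omega
      · simp [h7]
      · simp [h7]
  · -- a nonzero term makes all letters equal to `y_{1,1}`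
    have hL : constSeq (starCorr ψ) ((y'.1 : ℕ) - 1) s' = 0 := by
      rcases hone y'.1 with h1 | h1
      · simp [constSeq, h1]
      · rw [h1]
        simp only [constSeq, PNat.one_coe, Nat.sub_self, if_true]
        by_contra h2
        have h3 := (eq_of_starCorr_ne h2).2
        rw [h, yDeg_append, yDeg_eq_one_of_forall h3, one_mul] at hw
        refine hall fun z hz => ?_
        rw [h, List.mem_append] at hz
        rcases hz with hz | hz
        · exact h3 z hz
        · simp only [List.mem_singleton] at hz
          rw [hz]; exact Prod.ext h1 (by simpa using hw)
    have hR : antiSeq (constSeq (starCorr ψ)) ((y.1 : ℕ) - 1) s = 0 := by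
      rcases hone y.1 with h1 | h1
      · simp [antiSeq, yAnti, constSeq, h1]
      · rw [h1]
        simp only [antiSeq, yAnti, constSeq, PNat.one_coe, Nat.sub_self, if_true, starCorr_yRev]
        by_contra h2
        have h3 := (eq_of_starCorr_ne (right_ne_zero_of_mul (right_ne_zero_of_mul h2))).2
        rw [yDeg_cons, yDeg_eq_one_of_forall h3, mul_one] at hw
        refine hall fun z hz => ?_
        rcases List.mem_cons.mp hz with hz | hz
        · rw [hz]; exact Prod.ext h1 hw
        · exact h3 z hz
    rw [hL, hR, add_zero]

/-- The conditions defining `𝔡𝔪𝔯₀^{μ_N}`, over any field and in terms of words. -/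
structure IsDmrCyc (ψ : NCSeries K (CycX N)) : Prop where
  apply_none : ψ [none] = 0
  apply_one : ψ [some 1] = 0
  shuffle : IsPrim noMul ψ
  parity : ∀ ζ, ψ [some ζ] = ψ [some ζ⁻¹]
  harmonic : IsPrim yMul (starSer ψ)

namespace IsDmrCyc

variable {ψ : NCSeries K (CycX N)}

/-- All series `φ_i` are primitive for the harmonic coproduct: up to scalars they arise from `ψ_*` by
applying the coderivation `y_{k+1,γ} ↦ k y_{k,γ}`, which kills the correction term. -/
theorem isPrim_starSeq (hψ : IsDmrCyc ψ) (i : ℕ) : IsPrim yMul (starSeq ψ i) := by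
  induction i with
  | zero => rw [starSeq_zero]; exact hψ.harmonic
  | succ i ih =>
    have h1 : ∀ w, starSeq ψ (i + 1) w = (-((i : K) + 1)⁻¹) * replaceDer raiseFun (starSeq ψ i) w := by
      intro w
      have h2 := rightSeq_succ hψ.shuffle hψ.apply_none i w
      have h3 : replaceDer raiseFun (starSeq ψ i) w = replaceDer raiseFun (rightSeq ψ i) w := by
        have h4 : replaceDer raiseFun (constSeq (starCorr ψ) i) w = 0 := by
          refine replaceDer_raiseFun_eq_zero (fun w y hy hy1 => ?_) w
          have : starCorr ψ w = 0 := starCorr_of_ne fun h => hy1 (by rw [h.2 y hy])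
          simp [constSeq, this]
        have h5 := replaceDer_add (raiseFun : List (CycY N) → (CycY N → K) →+ K) (rightSeq ψ i)
          (constSeq (starCorr ψ) i) w
        rw [h4, add_zero] at h5
        exact h5
      have h4 : (i : K) + 1 ≠ 0 := Nat.cast_add_one_ne_zero i
      rw [h3, starSeq_succ]
      field_simp
      linear_combination h2
    rw [show starSeq ψ (i + 1) = _ from funext h1]
    exact (ih.replaceDer isCoderLetters_raiseFun).mul_left _

/-- For a double shuffle element, the series `Z(t)` has no polar part. -/
theorem zSer_starSeq (hψ : IsDmrCyc ψ) (hG : ∃ g : Mu N, g ≠ 1 ∧ g * g ≠ 1) :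
    (∀ w k, k ≤ 0 → zSer (starSeq ψ) w k = 0) ∧
      ∀ n : ℕ+, Even (n : ℕ) → starSeq ψ 0 [(n, 1)] = 0 := by
  have hs0 : ∀ y, starSeq ψ 0 [y] = ψ (pyWord 1 [y]) := by
    intro y
    have : starCorr ψ [y] = 0 := starCorr_of_ne (by simp)
    rw [starSeq_zero, starSer, this, add_zero, flat]
  have hs : ∀ i y, starSeq ψ i [y] = rightSeq ψ i [y] := by
    intro i y
    cases i with
    | zero => rw [hs0]; simp [rightSeq]
    | succ i => rw [starSeq_succ]
  refine zSer_eq_zero hψ.isPrim_starSeq (fun i k γ => ?_) (fun γ => ?_) hG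
    (fun n => -((1 + (-1) ^ (n - 1)) / ((n - 1 : ℕ) : K)) *
        ψ (List.replicate (n - 2) none ++ [some 1])) (fun n => ?_) (fun w hw => ?_)
  · rw [hs, hs, rightSeq_succ hψ.shuffle hψ.apply_none, replaceDer_raiseFun_cons, replaceDer_nil]
    simp
  · rw [hs0, hs0]
    simpa [pyWord_cons] using hψ.parity γ
  · rw [hs0]
    have : (n : ℕ) + 1 - 2 = n - 1 := by omega
    simp [pyWord_cons, this]
  · have h1 := zSer_add (rightSeq ψ) (constSeq (starCorr ψ)) w
    have h2 : zSer (starSeq ψ) w = zSer (rightSeq ψ) w + zSer (constSeq (starCorr ψ)) w := h1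
    rw [h2, Pi.add_apply, zSer_rightSeq_one hψ.shuffle hψ.apply_none hw, zero_add,
      zSer_starCorr_one ψ w hw]
    congr

end IsDmrCyc

end CycDoubleShuffle

/-! ### The bracket of double shuffle elements -/

section ShuffleDerivation

open NCSeries

variable {A K : Type*} [Field K]

theorem isPrim_X (a : A) : IsPrim noMul (X a : NCSeries K A) := by
  classical
  refine ⟨X_nil a, fun u v hu hv => ?_⟩
  have h0 : ∀ (x : A) (u v : List A), u ≠ [] ∨ v ≠ [] →
      qsum noMul (fun w => (X a : NCSeries K A) (x :: w)) u v = 0 := by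
    intro x u v h
    rw [← qsum_zero (M := K) noMul u v]
    refine qsum_congr fun w hw => ?_
    have h1 := length_le_of_mem_quasiShuffle hw
    rcases w with _ | ⟨y, w⟩
    · rcases u with _ | ⟨_, u⟩ <;> rcases v with _ | ⟨_, v⟩ <;> simp at h h1
    · simp [X]
  rcases u with _ | ⟨x, u⟩
  · exact absurd rfl hu
  rcases v with _ | ⟨y, v⟩
  · exact absurd rfl hv
  refine (qsum_cons_cons noMul _ x y u v).trans ?_
  rw [h0 _ _ _ (by simp), h0 _ _ _ (by simp)]
  simp [noMul]

theorem isPrim_commutator {f g : NCSeries K A} (hf : IsPrim noMul f) (hg : IsPrim noMul g) :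
    IsPrim noMul (f * g - g * f) := by
  have h : (fun w => conv AddMonoidHom.mul f g w - conv AddMonoidHom.mul g f w) =
      (f * g - g * f : NCSeries K A) := by
    funext w; rw [← mul_eq_conv, ← mul_eq_conv]; rfl
  rw [← h]
  exact hf.commutator hg

variable [Fintype A]

/-- The functionals describing the derivation `NCSeries.der c`. -/
noncomputable def derFunctional (c : A → NCSeries K A) (w : List A) : (A → K) →+ K :=
  ∑ a, (AddMonoidHom.mulLeft (c a w)).comp (Pi.evalAddMonoidHom (fun _ : A => K) a)

theorem derFunctional_apply (c : A → NCSeries K A) (w : List A) (g : A → K) :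
    derFunctional c w g = ∑ a, c a w * g a := by
  simp [derFunctional, AddMonoidHom.finsetSum_apply]

theorem replaceHead_derFunctional (c : A → NCSeries K A) (f : NCSeries K A) (w : List A) :
    replaceHead (derFunctional c) f w = ∑ a, (c a * tail [a] f : NCSeries K A) w := by
  unfold replaceHead
  induction w generalizing c with
  | nil =>
    simp only [conv_nil, mul_nil, AddMonoidHom.id_apply, derFunctional_apply]
    rfl
  | cons b w ih =>
    have h := ih fun a => tail [b] (c a)
    have h1 : (fun u => derFunctional c (b :: u)) = derFunctional fun a => tail [b] (c a) := rfl
    rw [conv_cons, h1, h]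
    simp only [mul_cons, Finset.sum_add_distrib, AddMonoidHom.id_apply, derFunctional_apply]
    rfl

theorem der_eq_replaceDer {c : A → NCSeries K A} (hc : ∀ a, c a [] = 0) (f : NCSeries K A)
    (w : List A) : der c f w = replaceDer (derFunctional c) f w := by
  induction w generalizing f with
  | nil =>
    exact (der_nil c f).trans (Finset.sum_eq_zero fun a _ => by rw [mul_nil, hc, zero_mul])
  | cons b w ih =>
    rw [der_cons, ih, ← replaceHead_derFunctional]; rfl

/-- A derivation which maps the letters to primitive series preserves primitive series. -/
theorem IsPrim.der {c : A → NCSeries K A} (hc : ∀ a, IsPrim noMul (c a)) {f : NCSeries K A}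
    (hf : IsPrim noMul f) : IsPrim noMul (der c f) := by
  have hκ : IsCoderLetters noMul (derFunctional c) := by
    refine ⟨?_, fun a b u v => ?_⟩
    · ext g; rw [derFunctional_apply]; simp [(hc _).1]
    · ext g
      have h1 := map_qsum noMul (AddMonoidHom.eval g) (derFunctional c) (a :: u) (b :: v)
      rw [AddMonoidHom.eval_apply_apply] at h1
      have h2 : mulRightHom K (noMul : A → A → Option A) b g = 0 := rfl
      have h3 : mulLeftHom K (noMul : A → A → Option A) a g = 0 := rfl
      rw [h1]
      simp only [AddMonoidHom.eval_apply_apply, derFunctional_apply, qsum_sum]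
      rw [Finset.sum_eq_zero]
      · split_ifs <;> simp [h2, h3]
      · intro x _
        simp only [mul_comm _ (g x)]
        refine (qsum_mul_left noMul (g x) (c x) _ _).trans ?_
        rw [(hc x).2 _ _ (by simp) (by simp), mul_zero]
  have h := hf.replaceDer hκ
  rwa [← show NCSeries.der c f = _root_.replaceDer (derFunctional c) f from
    funext (der_eq_replaceDer (fun a => (hc a).1) f)] at h

end ShuffleDerivation

section CycBracket

open NCSeries

variable {N : ℕ} {K : Type*} [Field K]

theorem isPrim_tCyc (ζ : Mu N) {ψ : NCSeries K (CycX N)} (hψ : IsPrim noMul ψ) :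
    IsPrim noMul (tCyc ζ ψ) :=
  hψ.comp_map (Option.map (ζ⁻¹ * ·)) fun _ _ => rfl

theorem isPrim_dCycLetter {ψ : NCSeries K (CycX N)} (hψ : IsPrim noMul ψ) (a : CycX N) :
    IsPrim noMul (dCycLetter ψ a) := by
  cases a with
  | none => exact ⟨rfl, fun u v _ _ => qsum_zero _ _ _⟩
  | some ζ => exact isPrim_commutator (isPrim_X _) (isPrim_tCyc ζ hψ)

variable [NeZero N]

theorem isPrim_bracketCyc {ψ₁ ψ₂ : NCSeries K (CycX N)} (h₁ : IsPrim noMul ψ₁)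
    (h₂ : IsPrim noMul ψ₂) : IsPrim noMul (bracketCyc ψ₁ ψ₂) :=
  ((h₂.der (isPrim_dCycLetter h₁)).sub (h₁.der (isPrim_dCycLetter h₂))).add
    (isPrim_commutator h₁ h₂)

theorem bracketCyc_none {ψ₁ ψ₂ : NCSeries K (CycX N)} (h₁ : IsPrim noMul ψ₁)
    (h₂ : IsPrim noMul ψ₂) : bracketCyc ψ₁ ψ₂ [none] = 0 := by
  have h : ∀ {ψ f : NCSeries K (CycX N)} (_ : IsPrim noMul ψ), dCyc ψ f [none] = 0 := by
    intro ψ f hψ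
    have h1 : ∀ a, dCycLetter ψ a [] = 0 := fun a => (isPrim_dCycLetter hψ a).1
    have h2 : ∀ a, dCycLetter ψ a [none] = 0 := by
      intro a
      have h3 : ψ [] = 0 := hψ.1
      cases a with
      | none => rfl
      | some ζ => simp [dCycLetter, mul_cons, mul_nil, X_nil, tail_X, tCyc_apply, h3]
    rw [dCyc, der_cons, der_nil]
    simp [mul_cons, mul_nil, h1, h2]
  have h3 : ψ₁ [] = 0 := h₁.1
  have h4 : ψ₂ [] = 0 := h₂.1
  simp [bracketCyc, h h₁, h h₂, mul_cons, mul_nil, h3, h4]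

variable [CharZero K]

/-- The bracket in terms of the letters `y_{k,ζ}`. -/
theorem flat_bracketCyc {ψ₁ ψ₂ : NCSeries K (CycX N)} (h₁ : IsPrim noMul ψ₁)
    (h₂ : IsPrim noMul ψ₂) (hx₁ : ψ₁ [none] = 0) (hx₂ : ψ₂ [none] = 0) (w : List (CycY N)) :
    flat (bracketCyc ψ₁ ψ₂) w =
      replaceDer (zFun (rightSeq ψ₁)) (flat ψ₂) w + conv AddMonoidHom.mul (flat ψ₂) (flat ψ₁) w -
      (replaceDer (zFun (rightSeq ψ₂)) (flat ψ₁) w +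
        conv AddMonoidHom.mul (flat ψ₁) (flat ψ₂) w) := by
  rw [← flat_mul_add_dCyc h₁ (apply_replicate_none h₁ hx₁),
    ← flat_mul_add_dCyc h₂ (apply_replicate_none h₂ hx₂)]
  simp only [flat, bracketCyc, NCSeries.add_apply, NCSeries.sub_apply]
  ring

/-- The part of depth one of a bracket vanishes. -/
theorem flat_bracketCyc_singleton {ψ₁ ψ₂ : NCSeries K (CycX N)} (h₁ : IsPrim noMul ψ₁)
    (h₂ : IsPrim noMul ψ₂) (hx₁ : ψ₁ [none] = 0) (hx₂ : ψ₂ [none] = 0) (y : CycY N) :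
    flat (bracketCyc ψ₁ ψ₂) [y] = 0 := by
  have h : ∀ {ψ : NCSeries K (CycX N)} (_ : IsPrim noMul ψ) (_ : ψ [none] = 0),
      zFun (rightSeq ψ) [y] = 0 := by
    intro ψ hψ hx
    ext g
    rw [zFun_apply]
    refine Finset.sum_eq_zero fun k _ => ?_
    have h0 : ∀ i, rightSeq ψ i [] = 0 := fun i => apply_replicate_none hψ hx i
    have h3 : laurent (rightSeq ψ) [] = 0 := by funext j; simp [laurent, h0]
    have h4 : laurent (antiSeq (rightSeq ψ)) [] = 0 := by
      funext j; simp [laurent, antiSeq, yAnti, h0]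
    have h2 := conv_laurent_append (laurent (rightSeq ψ)) [] y
    rw [List.nil_append] at h2
    rw [zSer, h2, conv_yOp_cons, h3, h4]
    simp [laurent_pos _ _ (show (0 : ℤ) < k + 1 by omega)]
  have h3 : flat ψ₁ [] = 0 := h₁.1
  have h4 : flat ψ₂ [] = 0 := h₂.1
  have h5 : ∀ φ : ℕ → List (CycY N) → K, zFun φ [] = 0 := by
    intro φ; ext g; simp [zFun_apply]
  rw [flat_bracketCyc h₁ h₂ hx₁ hx₂]
  simp [replaceDer_cons, replaceDer_nil, replaceHead, conv_cons, conv_nil, h h₁ hx₁, h h₂ hx₂, h3,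
    h4, h5]

theorem conv_id_eq_zero {A M M' : Type*} [AddCommMonoid M] [AddCommMonoid M']
    {κ : List A → M →+ M'} {g : List A → M} (h : ∀ u v, κ u (g v) = 0) (w : List A) :
    conv (AddMonoidHom.id _) κ g w = 0 := by
  induction w generalizing κ with
  | nil => simp [conv_nil, h]
  | cons a w ih => rw [conv_cons, ih fun u v => h (a :: u) v]; simp [h]

theorem replaceDer_eq_zero_of_powers {A : Type*} {a : A} {κ : List A → (A → K) →+ K}
    (hκ : ∀ m g, (∀ x, x ≠ a → g x = 0) → κ m g = 0) {f : List A → K}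
    (hf : ∀ w, ∀ y ∈ w, y ≠ a → f w = 0) (w : List A) : replaceDer κ f w = 0 := by
  induction w generalizing f with
  | nil => rfl
  | cons b w ih =>
    rw [replaceDer_cons, ih fun w y hy h => hf _ y (by simp [hy]) h, add_zero, replaceHead]
    exact conv_id_eq_zero (fun u v => hκ u _ fun x hx => hf _ x (by simp) hx) _

/-- Series in the powers of a letter commute. -/
theorem conv_comm_of_powers {A : Type*} {a : A} {f g : List A → K}
    (hf : ∀ w, ∀ y ∈ w, y ≠ a → f w = 0) (hg : ∀ w, ∀ y ∈ w, y ≠ a → g w = 0) (w : List A) :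
    conv AddMonoidHom.mul f g w = conv AddMonoidHom.mul g f w := by
  have h0 : ∀ {f g : List A → K} (_ : ∀ w, ∀ y ∈ w, y ≠ a → f w = 0)
      (_ : ∀ w, ∀ y ∈ w, y ≠ a → g w = 0) (w), (∃ y ∈ w, y ≠ a) →
      conv AddMonoidHom.mul f g w = 0 := by
    intro f g hf hg w hw
    induction w generalizing f with
    | nil => simp at hw
    | cons b w ih =>
      obtain ⟨y, hy, hya⟩ := hw
      rw [conv_cons, hg _ y hy hya]
      rcases List.mem_cons.mp hy with rfl | hy
      · have : (fun u => f (y :: u)) = fun _ => 0 := by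
          funext u; exact hf _ y (by simp) hya
        rw [this]; simp
      · rw [ih (fun w y hy h => hf _ y (by simp [hy]) h) ⟨y, hy, hya⟩]; simp
  by_cases hw : ∃ y ∈ w, y ≠ a
  · rw [h0 hf hg w hw, h0 hg hf w hw]
  · push Not at hw
    rw [List.eq_replicate_of_mem hw]
    generalize w.length = n
    have h1 : ∀ n (f g : List A → K), conv AddMonoidHom.mul f g (List.replicate n a) =
        ∑ i ∈ Finset.range (n + 1), f (List.replicate i a) * g (List.replicate (n - i) a) := by
      intro n
      induction n with
      | zero => intro f g; simp [conv_nil]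
      | succ n ih =>
        intro f g
        rw [List.replicate_succ, conv_cons, ih, Finset.sum_range_succ' _ (n + 1), add_comm]
        simp [List.replicate_succ]
    rw [h1, h1, ← Finset.sum_range_reflect]
    refine Finset.sum_congr rfl fun i hi => ?_
    rw [Finset.mem_range] at hi
    rw [mul_comm, show n + 1 - 1 - i = n - i by omega, show n - (n - i) = i by omega]

theorem starCorr_eq_zero_of_mem (ψ : NCSeries K (CycX N)) (w : List (CycY N)) (y : CycY N)
    (hy : y ∈ w) (h : y ≠ (1, 1)) : starCorr ψ w = 0 :=
  starCorr_of_ne fun h' => h (h'.2 y hy)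

namespace IsDmrCyc

variable {ψ ψ₁ ψ₂ : NCSeries K (CycX N)}

theorem starSeq_zero_singleton (ψ : NCSeries K (CycX N)) (n : ℕ+) :
    starSeq ψ 0 [(n, 1)] = ψ (List.replicate ((n : ℕ) - 1) none ++ [some 1]) := by
  rw [starSeq_zero, starSer, starCorr_of_ne (by simp), add_zero, flat]
  simp [pyWord_cons]

theorem yAnti_starCorr (hψ : IsDmrCyc ψ) (hG : ∃ g : Mu N, g ≠ 1 ∧ g * g ≠ 1)
    (w : List (CycY N)) : yAnti (starCorr ψ) w = -starCorr ψ w := by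
  rw [yAnti, starCorr_yRev]
  by_cases h : 2 ≤ w.length ∧ ∀ y ∈ w, y = ((1, 1) : CycY N)
  · rw [yWeight_of_forall h.2]
    rcases Nat.even_or_odd w.length with he | ho
    · have hpos : 0 < w.length := by omega
      have h1 := (starSeq_zero_singleton ψ _).symm.trans
        ((hψ.zSer_starSeq hG).2 ⟨w.length, hpos⟩ he)
      have h2 : starCorr ψ w = 0 := by
        rw [starCorr, if_pos h]
        exact mul_eq_zero_of_right _ h1
      simp [h2]
    · rw [ho.neg_one_pow]; ring
  · rw [starCorr_of_ne h]; simp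

/-- `Z_1` vanishes in index `1`. -/
theorem zSer_starSeq_one (hψ : IsDmrCyc ψ) (hG : ∃ g : Mu N, g ≠ 1 ∧ g * g ≠ 1)
    {w : List (CycY N)} (hw : yDeg w = 1) : zSer (starSeq ψ) w 1 = 0 := by
  have h2 : zSer (starSeq ψ) w = zSer (rightSeq ψ) w + zSer (constSeq (starCorr ψ)) w :=
    zSer_add (rightSeq ψ) (constSeq (starCorr ψ)) w
  rw [h2, Pi.add_apply, zSer_rightSeq_one hψ.shuffle hψ.apply_none hw, zero_add,
    zSer_starCorr_one ψ w hw]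
  split_ifs
  · rcases Nat.eq_zero_or_pos (w.length - 1) with h0 | h0
    · simp [h0]
    rcases Nat.even_or_odd (w.length - 1) with he | ho
    · have h1 := (starSeq_zero_singleton ψ _).symm.trans
        ((hψ.zSer_starSeq hG).2 ⟨w.length - 1, h0⟩ he)
      refine mul_eq_zero_of_right _ ?_
      rw [← h1]; rfl
    · simp [ho.neg_one_pow]
  · rfl

/-- The derivations `y(t) ↦ Z(t)` for `φ_0 = ψ_*` and for `φ_0 = Φ_0` differ by the commutator with the
correction term of `ψ_*`. -/
theorem replaceDer_starSeq (hψ : IsDmrCyc ψ) (hG : ∃ g : Mu N, g ≠ 1 ∧ g * g ≠ 1)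
    (f : List (CycY N) → K) (w : List (CycY N)) :
    replaceDer (zFun (starSeq ψ)) f w = replaceDer (zFun (rightSeq ψ)) f w +
      (conv AddMonoidHom.mul (starCorr ψ) f w - conv AddMonoidHom.mul f (starCorr ψ) w) := by
  have h : zFun (starSeq ψ) = fun w => zFun (rightSeq ψ) w + zFun (constSeq (starCorr ψ)) w :=
    funext (zFun_add _ _)
  rw [h, replaceDer_add_left, replaceDer_constSeq _
    (fun s hs => yDeg_eq_one_of_forall (eq_of_starCorr_ne hs).2) (hψ.yAnti_starCorr hG)]

/-- The derivation `y(t) ↦ Z(t)` kills `y_{1,1}`, and hence the correction term of `ψ₂_*`. -/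
theorem replaceDer_starSeq_starCorr (h₁ : IsDmrCyc ψ₁) (hG : ∃ g : Mu N, g ≠ 1 ∧ g * g ≠ 1)
    (ψ₂ : NCSeries K (CycX N)) (w : List (CycY N)) :
    replaceDer (zFun (starSeq ψ₁)) (starCorr ψ₂) w = 0 := by
  refine replaceDer_eq_zero_of_powers (a := (1, 1)) (fun m g hg => ?_)
    (fun w y hy h => starCorr_eq_zero_of_mem ψ₂ w y hy h) w
  rw [zFun_apply]
  refine Finset.sum_eq_zero fun k _ => ?_
  by_cases h : k = 0 ∧ yDeg m = 1
  · rw [h.1]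
    have := h₁.zSer_starSeq_one hG h.2
    simp [this]
  · rw [hg, mul_zero]
    intro h2
    have h3 := congrArg (fun y : CycY N => (y.1 : ℕ)) h2
    simp at h3
    exact h ⟨h3, congrArg Prod.snd h2⟩

/-- The series `ψ_*` of a bracket is a combination of derivations which are coderivations and of
a commutator. -/
theorem starSer_bracketCyc (h₁ : IsDmrCyc ψ₁) (h₂ : IsDmrCyc ψ₂)
    (hG : ∃ g : Mu N, g ≠ 1 ∧ g * g ≠ 1) (w : List (CycY N)) :
    starSer (bracketCyc ψ₁ ψ₂) w =
      (replaceDer (zFun (starSeq ψ₁)) (starSer ψ₂) w -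
        replaceDer (zFun (starSeq ψ₂)) (starSer ψ₁) w) +
      (conv AddMonoidHom.mul (starSer ψ₂) (starSer ψ₁) w -
        conv AddMonoidHom.mul (starSer ψ₁) (starSer ψ₂) w) := by
  have hcorr : starCorr (bracketCyc ψ₁ ψ₂) w = 0 := by
    by_cases h : 2 ≤ w.length ∧ ∀ y ∈ w, y = ((1, 1) : CycY N)
    · rw [starCorr, if_pos h]
      have h1 := flat_bracketCyc_singleton h₁.shuffle h₂.shuffle h₁.apply_none h₂.apply_none
        (⟨w.length, by omega⟩, 1)
      refine mul_eq_zero_of_right _ ?_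
      rw [← h1, flat]
      simp [pyWord_cons]
    · exact starCorr_of_ne h
  have hs : ∀ ψ : NCSeries K (CycX N), starSer ψ = fun w => flat ψ w + starCorr ψ w := fun _ => rfl
  rw [hs (bracketCyc ψ₁ ψ₂), hs ψ₁, hs ψ₂]
  simp only [replaceDer_add, conv_add_left, conv_add_right, h₁.replaceDer_starSeq_starCorr hG,
    h₂.replaceDer_starSeq_starCorr hG, h₁.replaceDer_starSeq hG (flat ψ₂),
    h₂.replaceDer_starSeq hG (flat ψ₁), hcorr]
  rw [flat_bracketCyc h₁.shuffle h₂.shuffle h₁.apply_none h₂.apply_none,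
    conv_comm_of_powers (starCorr_eq_zero_of_mem ψ₁) (starCorr_eq_zero_of_mem ψ₂)]
  ring

/-- `𝔡𝔪𝔯₀^{μ_N}` is closed under the bracket. -/
theorem bracketCyc (h₁ : IsDmrCyc ψ₁) (h₂ : IsDmrCyc ψ₂) (hG : ∃ g : Mu N, g ≠ 1 ∧ g * g ≠ 1) :
    IsDmrCyc (bracketCyc ψ₁ ψ₂) := by
  have hletter : ∀ ζ, _root_.bracketCyc ψ₁ ψ₂ [some ζ] = 0 := by
    intro ζ
    have h := flat_bracketCyc_singleton h₁.shuffle h₂.shuffle h₁.apply_none h₂.apply_none (1, ζ)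
    simpa [flat, pyWord_cons] using h
  refine ⟨bracketCyc_none h₁.shuffle h₂.shuffle, hletter 1,
    isPrim_bracketCyc h₁.shuffle h₂.shuffle, fun ζ => by rw [hletter, hletter], ?_⟩
  rw [show starSer (_root_.bracketCyc ψ₁ ψ₂) = _ from funext (starSer_bracketCyc h₁ h₂ hG)]
  have hE : ∀ {ψ : NCSeries K (CycX N)} {f : List (CycY N) → K} (_ : IsDmrCyc ψ) (_ : IsPrim yMul f),
      IsPrim yMul (replaceDer (zFun (starSeq ψ)) f) := fun hψ hf =>
    IsPrim.replaceDer (isCoderLetters_zFun hψ.isPrim_starSeq (hψ.zSer_starSeq hG).1) hf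
  exact ((hE h₁ h₂.harmonic).sub (hE h₂ h₁.harmonic)).add (h₂.harmonic.commutator h₁.harmonic)

end IsDmrCyc

end CycBracket

/-! ### Substitution of linear combinations of letters -/

section Substitution

variable {A B C I J L R M M' : Type*} [Fintype I] [Fintype J] [Fintype L] [CommRing R]

/-- The transpose of a substitution of letters: the coefficient of `f` at the word obtained from `v`
by replacing every letter `b` by `∑ i, c b i • ι b i`.  If the letters `a` of a finite alphabet are
mapped to `∑ b, φ a b b`, the image of a series is its `letterSub φ`. -/
def wordSub [AddCommMonoid M] [Module R M] (ι : B → I → A) (c : B → I → R) :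
    (List A → M) → List B → M
  | f, [] => f []
  | f, b :: v => ∑ i, c b i • wordSub ι c (fun w => f (ι b i :: w)) v

variable [AddCommGroup M] [Module R M] [AddCommGroup M'] [Module R M']

@[simp] theorem wordSub_nil (ι : B → I → A) (c : B → I → R) (f : List A → M) :
    wordSub ι c f [] = f [] := rfl

theorem wordSub_cons (ι : B → I → A) (c : B → I → R) (f : List A → M) (b : B) (v : List B) :
    wordSub ι c f (b :: v) = ∑ i, c b i • wordSub ι c (fun w => f (ι b i :: w)) v := rfl

theorem map_wordSub (T : M →ₗ[R] M') (ι : B → I → A) (c : B → I → R) (f : List A → M)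
    (v : List B) : T (wordSub ι c f v) = wordSub ι c (fun w => T (f w)) v := by
  induction v generalizing f with
  | nil => rfl
  | cons b v ih => simp only [wordSub_cons, map_sum, map_smul, ih]

theorem wordSub_add (ι : B → I → A) (c : B → I → R) (f g : List A → M) (v : List B) :
    wordSub ι c (fun w => f w + g w) v = wordSub ι c f v + wordSub ι c g v := by
  induction v generalizing f g with
  | nil => rfl
  | cons b v ih => simp only [wordSub_cons, ih, smul_add, Finset.sum_add_distrib]

@[simp] theorem wordSub_zero (ι : B → I → A) (c : B → I → R) (v : List B) :
    wordSub ι c (fun _ => (0 : M)) v = 0 := by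
  induction v with
  | nil => rfl
  | cons b v ih => simp [wordSub_cons, ih]

theorem wordSub_sum {S : Type*} (s : Finset S) (ι : B → I → A) (c : B → I → R)
    (f : S → List A → M) (v : List B) :
    wordSub ι c (fun w => ∑ x ∈ s, f x w) v = ∑ x ∈ s, wordSub ι c (f x) v := by
  induction s using Finset.cons_induction with
  | empty => simp
  | cons a s ha ih => simp only [Finset.sum_cons, wordSub_add, ih]

theorem wordSub_smul (r : R) (ι : B → I → A) (c : B → I → R) (f : List A → M) (v : List B) :
    wordSub ι c (fun w => r • f w) v = r • wordSub ι c f v :=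
  (map_wordSub (LinearMap.lsmul R M r) ι c f v).symm

theorem wordSub_eq_zero {ι : B → I → A} {c : B → I → R} {f : List A → M} {v : List B}
    (h : ∀ w, w.length = v.length → f w = 0) : wordSub ι c f v = 0 := by
  induction v generalizing f with
  | nil => exact h [] rfl
  | cons b v ih =>
    rw [wordSub_cons]
    exact Finset.sum_eq_zero fun i _ => by rw [ih fun w hw => h _ (by simp [hw]), smul_zero]

/-- A substitution which is compatible with the products of letters commutes with the
coproducts. -/
theorem qsum_wordSub {m : A → A → Option A} {m' : B → B → Option B} {ι : B → I → A}
    {c : B → I → R} (h : ∀ b b' (g : A → M), (m' b b').elim 0 (fun e => ∑ i, c e i • g (ι e i)) =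
      ∑ i, c b i • ∑ j, c b' j • (m (ι b i) (ι b' j)).elim 0 g) (f : List A → M) (u v : List B) :
    qsum m' (wordSub ι c f) u v =
      wordSub ι c (fun u' => wordSub ι c (fun v' => qsum m f u' v') v) u := by
  induction u, v using quasiShuffle.induct generalizing f with
  | case1 v => simp
  | case2 a u => simp
  | case3 a u b v ih1 ih2 ih3 =>
    have hsum : ∀ (r : I → R) (F : I → List B → M) (u v : List B),
        qsum m' (fun w => ∑ i, r i • F i w) u v = ∑ i, r i • qsum m' (F i) u v := by
      intro r F u v
      rw [qsum_sum]
      refine Finset.sum_congr rfl fun i _ => ?_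
      exact (map_qsum m' (LinearMap.lsmul R M (r i)).toAddMonoidHom (F i) u v).symm
    have h3 : ((m' a b).elim 0 fun e => qsum m' (fun w => wordSub ι c f (e :: w)) u v) =
        (m' a b).elim 0 fun e => ∑ i, c e i • wordSub ι c
          (fun u' => wordSub ι c (fun v' => qsum m (fun w => f (ι e i :: w)) u' v') v) u := by
      cases hm : m' a b with
      | none => rfl
      | some e =>
        simp only [Option.elim_some, wordSub_cons, hsum]
        exact Finset.sum_congr rfl fun i _ => by rw [ih3]
    rw [qsum_cons_cons, h3, h a b fun x => wordSub ι c
          (fun u' => wordSub ι c (fun v' => qsum m (fun w => f (x :: w)) u' v') v) u]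
    simp only [wordSub_cons, hsum, ih1, ih2]
    have h4 : ∀ i j u' v', qsum m f (ι a i :: u') (ι b j :: v') =
        qsum m (fun w => f (ι a i :: w)) u' (ι b j :: v') +
        qsum m (fun w => f (ι b j :: w)) (ι a i :: u') v' +
        (m (ι a i) (ι b j)).elim 0 fun x => qsum m (fun w => f (x :: w)) u' v' :=
      fun i j u' v' => qsum_cons_cons _ _ _ _ _ _
    have h5 : ∀ (o : Option A) u v, wordSub ι c (fun u' => wordSub ι c (fun v' =>
        o.elim 0 fun x => qsum m (fun w => f (x :: w)) u' v') v) u =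
        o.elim 0 fun x => wordSub ι c (fun u' => wordSub ι c (fun v' =>
          qsum m (fun w => f (x :: w)) u' v') v) u := by
      intro o u v; cases o <;> simp
    simp only [h4, wordSub_add, wordSub_sum, wordSub_smul, Finset.sum_add_distrib, smul_add, h5]
    congr 2
    simp only [Finset.smul_sum]
    rw [Finset.sum_comm]
    refine Finset.sum_congr rfl fun i _ => Finset.sum_congr rfl fun j _ => ?_
    rw [smul_comm]

theorem IsPrim.wordSub {m : A → A → Option A} {m' : B → B → Option B} {ι : B → I → A}
    {c : B → I → R} (h : ∀ b b' (g : A → M), (m' b b').elim 0 (fun e => ∑ i, c e i • g (ι e i)) =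
      ∑ i, c b i • ∑ j, c b' j • (m (ι b i) (ι b' j)).elim 0 g) {f : List A → M}
    (hf : IsPrim m f) : IsPrim m' (wordSub ι c f) := by
  refine ⟨hf.1, fun u v hu hv => ?_⟩
  rw [qsum_wordSub h]
  refine wordSub_eq_zero fun u' hu' => wordSub_eq_zero fun v' hv' => hf.2 _ _ ?_ ?_
  · rintro rfl; exact hu (List.length_eq_zero_iff.mp hu'.symm)
  · rintro rfl; exact hv (List.length_eq_zero_iff.mp hv'.symm)

theorem wordSub_wordSub {ι : B → I → A} {c : B → I → R} {ι' : C → J → B} {c' : C → J → R}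
    {ι'' : C → L → A} {c'' : C → L → R} (h : ∀ z (g : A → M),
      ∑ j, c' z j • ∑ i, c (ι' z j) i • g (ι (ι' z j) i) = ∑ k, c'' z k • g (ι'' z k))
    (f : List A → M) (v : List C) :
    wordSub ι' c' (wordSub ι c f) v = wordSub ι'' c'' f v := by
  induction v generalizing f with
  | nil => rfl
  | cons z v ih =>
    simp only [wordSub_cons, wordSub_sum, wordSub_smul, ih]
    exact h z fun a => wordSub ι'' c'' (fun w => f (a :: w)) v

theorem wordSub_id {ι : B → I → B} {c : B → I → R} (h : ∀ z (g : B → M),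
      ∑ i, c z i • g (ι z i) = g z) (f : List B → M) (v : List B) :
    wordSub ι c f v = f v := by
  induction v generalizing f with
  | nil => rfl
  | cons z v ih => simp only [wordSub_cons, ih]; exact h z fun a => f (a :: v)

end Substitution

section LetterSub

open NCSeries

variable {A B C R K : Type*} [Fintype A] [Fintype B] [Fintype C] [CommRing R] [CommRing K] [Algebra R K]

/-- The algebra morphism of series with `a ↦ ∑ b, φ a b b`. -/
def letterSub (φ : A → B → R) (f : NCSeries K A) : NCSeries K B :=
  wordSub (fun _ a => a) (fun b a => φ a b) f

theorem letterSub_nil (φ : A → B → R) (f : NCSeries K A) : letterSub φ f [] = f [] := rfl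

theorem letterSub_cons (φ : A → B → R) (f : NCSeries K A) (b : B) (v : List B) :
    letterSub φ f (b :: v) = ∑ a, φ a b • letterSub φ (tail [a] f) v := rfl

theorem letterSub_singleton (φ : A → B → R) (f : NCSeries K A) (b : B) :
    letterSub φ f [b] = ∑ a, φ a b • f [a] := rfl

theorem letterSub_add (φ : A → B → R) (f g : NCSeries K A) :
    letterSub φ (f + g) = letterSub φ f + letterSub φ g :=
  funext fun v => wordSub_add _ _ f g v

theorem letterSub_smul (φ : A → B → R) (r : R) (f : NCSeries K A) :
    letterSub φ (r • f) = r • letterSub φ f :=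
  funext fun v => wordSub_smul r _ _ f v

theorem letterSub_zero (φ : A → B → R) : letterSub φ (0 : NCSeries K A) = 0 :=
  funext fun v => wordSub_zero _ _ v

theorem letterSub_neg (φ : A → B → R) (f : NCSeries K A) :
    letterSub φ (-f) = -letterSub φ f := by
  rw [← neg_one_smul R f, letterSub_smul, neg_one_smul]

theorem letterSub_sub (φ : A → B → R) (f g : NCSeries K A) :
    letterSub φ (f - g) = letterSub φ f - letterSub φ g := by
  rw [sub_eq_add_neg, letterSub_add, letterSub_neg, sub_eq_add_neg]

theorem letterSub_sum {S : Type*} (s : Finset S) (φ : A → B → R) (f : S → NCSeries K A) :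
    letterSub φ (∑ x ∈ s, f x) = ∑ x ∈ s, letterSub φ (f x) := by
  induction s using Finset.cons_induction with
  | empty => simp [letterSub_zero]
  | cons a s ha ih => rw [Finset.sum_cons, letterSub_add, ih, Finset.sum_cons]

theorem letterSub_smul' (φ : A → B → R) (r : K) (f : NCSeries K A) :
    letterSub φ (r • f) = r • letterSub φ f :=
  funext fun v => (map_wordSub (LinearMap.mulLeft R r) (fun _ a => a) (fun b a => φ a b) f v).symm

theorem letterSub_mul (φ : A → B → R) (f g : NCSeries K A) :
    letterSub φ (f * g) = letterSub φ f * letterSub φ g := by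
  refine NCSeries.ext fun v => ?_
  induction v generalizing f with
  | nil => rw [letterSub_nil, mul_nil, mul_nil, letterSub_nil, letterSub_nil]
  | cons b v ih =>
    rw [letterSub_cons, mul_cons, letterSub_nil, letterSub_cons]
    have h : (tail [b] (letterSub φ f) * letterSub φ g : NCSeries K B) v =
        ∑ a, φ a b • (letterSub φ (tail [a] f) * letterSub φ g : NCSeries K B) v := by
      have h1 : tail [b] (letterSub φ f) = ∑ a, φ a b • letterSub φ (tail [a] f) :=
        NCSeries.ext fun w => by rw [NCSeries.sum_apply]; rfl
      rw [h1, Finset.sum_mul, NCSeries.sum_apply]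
      refine Finset.sum_congr rfl fun a _ => ?_
      rw [NCSeries.mul_apply, NCSeries.mul_apply, Finset.smul_sum]
      refine Finset.sum_congr rfl fun i _ => ?_
      exact smul_mul_assoc (φ a b) (letterSub φ (tail [a] f) (List.take i v)) _
    rw [h, Finset.mul_sum, ← Finset.sum_add_distrib]
    refine Finset.sum_congr rfl fun a _ => ?_
    rw [tail_mul, letterSub_add, letterSub_smul', NCSeries.add_apply, ih, smul_add,
      NCSeries.smul_apply, mul_smul_comm]

theorem letterSub_X [DecidableEq A] (φ : A → B → R) (a : A) :
    letterSub φ (X a : NCSeries K A) = ∑ b, φ a b • X b := by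
  classical
  refine NCSeries.ext fun v => ?_
  rw [NCSeries.sum_apply]
  have h1 : ∀ r : R, ∀ b : B, ∀ v, (r • (X b : NCSeries K B)) v = r • (X b : NCSeries K B) v :=
    fun _ _ _ => rfl
  simp only [h1]
  rcases v with _ | ⟨b, v⟩
  · rw [letterSub_nil, X_nil]
    simp [X_nil]
  · rw [letterSub_cons]
    have h2 : ∀ a', letterSub φ (tail [a'] (X a : NCSeries K A)) v =
        if a' = a then (1 : NCSeries K B) v else 0 := by
      intro a'
      rw [tail_X]
      split_ifs
      · cases v with
        | nil => rfl
        | cons b v =>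
          rw [letterSub_cons, one_cons]
          refine Finset.sum_eq_zero fun x _ => ?_
          have : tail [x] (1 : NCSeries K A) = 0 := by ext v; rfl
          rw [this, letterSub_zero, NCSeries.zero_apply, smul_zero]
      · rw [letterSub_zero]; rfl
    simp only [h2]
    rw [Finset.sum_eq_single a (fun x _ hx => by rw [if_neg hx, smul_zero]) (by simp),
      if_pos rfl, Finset.sum_eq_single b]
    · have h3 : (X b : NCSeries K B) (b :: v) = (1 : NCSeries K B) v := by
        have := congrFun (tail_X (R := K) b b) v
        rw [if_pos rfl] at this
        exact this
      rw [h3]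
    · intro x _ hx
      have h3 : (X x : NCSeries K B) (b :: v) = 0 := by
        have := congrFun (tail_X (R := K) x b) v
        rw [if_neg (Ne.symm hx)] at this
        exact this
      rw [h3, smul_zero]
    · simp

theorem letterSub_letterSub (φ : A → B → R) (φ' : B → C → R) (f : NCSeries K A) :
    letterSub φ' (letterSub φ f) = letterSub (fun a z => ∑ b, φ a b * φ' b z) f := by
  refine funext fun v => wordSub_wordSub (fun z g => ?_) f v
  simp only [Finset.smul_sum, Finset.sum_smul]
  rw [Finset.sum_comm]
  refine Finset.sum_congr rfl fun a _ => Finset.sum_congr rfl fun b _ => ?_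
  rw [smul_smul, mul_comm]

theorem letterSub_one [DecidableEq A] (f : NCSeries K A) :
    letterSub (fun a b => if a = b then (1 : R) else 0) f = f :=
  funext fun v => wordSub_id (fun z g => by simp) f v

theorem letterSub_algebraMap (φ : A → B → R) (f : NCSeries K A) :
    letterSub (fun a b => algebraMap R K (φ a b)) f = letterSub φ f := by
  refine funext fun v => ?_
  induction v generalizing f with
  | nil => rfl
  | cons b v ih =>
    rw [letterSub_cons, letterSub_cons]
    exact Finset.sum_congr rfl fun a _ => by rw [ih, algebraMap_smul]

theorem IsPrim.letterSub {φ : A → B → R} {f : NCSeries K A} (hf : IsPrim noMul f) :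
    IsPrim noMul (letterSub φ f) :=
  IsPrim.wordSub (m := noMul) (m' := noMul) (fun _ _ _ => by simp [noMul]) hf

/-- A substitution which intertwines two derivations on letters intertwines them. -/
theorem letterSub_der {φ : A → B → R} {c : A → NCSeries K A} {c' : B → NCSeries K B}
    (h : ∀ a, letterSub φ (c a) = ∑ b, φ a b • c' b) (f : NCSeries K A) :
    letterSub φ (der c f) = der c' (letterSub φ f) := by
  classical
  have hX : ∀ (a : A) (g : NCSeries K A) (b : B) (w : List B),
      letterSub φ (X a * g) (b :: w) = φ a b • letterSub φ g w := by
    intro a g b w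
    rw [letterSub_cons, Finset.sum_eq_single a]
    · congr 2
      refine NCSeries.ext fun v => ?_
      rw [tail_apply, List.singleton_append, X_mul_cons, if_pos rfl]
    · intro a' _ ha'
      have : tail [a'] (X a * g) = 0 := NCSeries.ext fun v => by
        rw [tail_apply, List.singleton_append, X_mul_cons, if_neg ha']; rfl
      rw [this, letterSub_zero, NCSeries.zero_apply, smul_zero]
    · simp
  have htail : ∀ b, tail [b] (letterSub φ f) = ∑ a, φ a b • letterSub φ (tail [a] f) :=
    fun b => NCSeries.ext fun w => by rw [NCSeries.sum_apply]; rfl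
  have hmul : ∀ (r : R) (x y : NCSeries K B), x * r • y = (r • x) * y := by
    intro r x y
    refine NCSeries.ext fun w => ?_
    rw [NCSeries.mul_apply, NCSeries.mul_apply]
    refine Finset.sum_congr rfl fun i _ => ?_
    change x _ * (r • y _) = (r • x _) * y _
    rw [mul_smul_comm, smul_mul_assoc]
  have hhead : ∀ f : NCSeries K A, letterSub φ (∑ a, c a * tail [a] f) =
      ∑ b, c' b * tail [b] (letterSub φ f) := by
    intro f
    have htail : ∀ b, tail [b] (letterSub φ f) = ∑ a, φ a b • letterSub φ (tail [a] f) :=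
      fun b => NCSeries.ext fun w => by rw [NCSeries.sum_apply]; rfl
    simp only [letterSub_sum, letterSub_mul, h, htail, Finset.mul_sum, Finset.sum_mul, hmul]
    exact Finset.sum_comm
  refine NCSeries.ext fun w => ?_
  induction w generalizing f with
  | nil =>
    have h1 : der c f [] = (∑ a, c a * tail [a] f : NCSeries K A) [] := by
      rw [der_nil, NCSeries.sum_apply]
    rw [letterSub_nil, h1]
    refine (letterSub_nil φ _).symm.trans ?_
    rw [hhead, der_nil, NCSeries.sum_apply]
  | cons b w ih =>
    rw [der_eq, letterSub_add, hhead, NCSeries.add_apply, letterSub_sum, NCSeries.sum_apply,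
      NCSeries.sum_apply, der_cons]
    congr 1
    simp only [hX]
    have h1 : ∀ a, letterSub φ (der c (tail [a] f)) w = der c' (letterSub φ (tail [a] f)) w :=
      fun a => ih (tail [a] f) (fun b => NCSeries.ext fun w => by rw [NCSeries.sum_apply]; rfl)
    simp only [h1, htail, map_sum, NCSeries.sum_apply]
    refine Finset.sum_congr rfl fun a _ => ?_
    rw [← algebraMap_smul K (φ a b) (letterSub φ (tail [a] f)), map_smul, NCSeries.smul_apply,
      Algebra.smul_def]

end LetterSub

/-! ### Morphisms given on letters, in terms of words -/

section Morphisms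

open NCSeries

variable {A B R : Type*} [CommRing R]

/-- A morphism given on letters, as defined through the images of all words, is given by the
recursion on words of `letterSub`. -/
theorem letterMorphism_eq [Fintype A] [Fintype B] (φ : A → B → R) (f : NCSeries R A) :
    letterMorphism φ f = letterSub φ f := by
  classical
  -- the combination of the words `w` with the coefficients of `v` in their images
  let D : List B → List A →₀ R := fun v => v.foldr
    (fun b F => ∑ a, φ a b • F.mapDomain (a :: ·)) (Finsupp.single [] 1)
  have hDcons : ∀ b v, D (b :: v) = ∑ a, φ a b • (D v).mapDomain (a :: ·) := fun _ _ => rfl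
  have hD : ∀ (w : List A) (v : List B), (FreeMonoid.lift (fun a => ∑ b : B,
      MonoidAlgebra.single (FreeMonoid.of b) (φ a b)) (FreeMonoid.ofList w)).coeff
        (FreeMonoid.ofList v) = D v w := by
    intro w
    induction w with
    | nil =>
      intro v
      rw [FreeMonoid.ofList_nil, map_one, MonoidAlgebra.one_def, MonoidAlgebra.coeff_single]
      cases v with
      | nil => simp [D]
      | cons b v =>
        rw [hDcons, Finsupp.finsetSum_apply, Finset.sum_eq_zero]
        · rw [Finsupp.single_eq_of_ne]; simp
        · intro a _
          rw [Finsupp.smul_apply, Finsupp.mapDomain_of_notMem_range _ _ (by simp), smul_zero]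
    | cons a w ih =>
      intro v
      rw [FreeMonoid.ofList_cons, map_mul, FreeMonoid.lift_eval_of, Finset.sum_mul]
      rw [MonoidAlgebra.coeff_sum, Finsupp.finsetSum_apply]
      cases v with
      | nil =>
        rw [Finset.sum_eq_zero]
        · simp [D]
        · intro b _
          rw [MonoidAlgebra.coeff_single_mul_of_forall_mul_ne]
          intro d hd
          have := congrArg FreeMonoid.toList hd
          simp at this
      | cons b v =>
        rw [hDcons, Finsupp.finsetSum_apply, Finset.sum_eq_single b, Finset.sum_eq_single a]
        · rw [FreeMonoid.ofList_cons, Finsupp.smul_apply,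
            Finsupp.mapDomain_apply (List.cons_injective), ← ih]
          exact MonoidAlgebra.coeff_single_mul_mul _ _ _ _
        · intro a' _ ha'
          rw [Finsupp.smul_apply, Finsupp.mapDomain_of_notMem_range _ _ (by simp [ha']), smul_zero]
        · simp
        · intro b' _ hb'
          rw [MonoidAlgebra.coeff_single_mul_of_forall_mul_ne]
          intro d hd
          have := congrArg FreeMonoid.toList hd
          simp at this
          exact hb' this.1
        · simp
  have hmorph : ∀ (f : List A → R) v, ∑ᶠ w : FreeMonoid A, f w.toList *
      (FreeMonoid.lift (fun a => ∑ b : B, MonoidAlgebra.single (FreeMonoid.of b) (φ a b)) w).coeff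
        (FreeMonoid.ofList v) = Finsupp.linearCombination R f (D v) := by
    intro f v
    rw [Finsupp.linearCombination_apply, Finsupp.sum,
      finsum_eq_finsetSum_of_support_subset (s := (D v).support.map FreeMonoid.ofList.toEmbedding)]
    · rw [Finset.sum_map]
      refine Finset.sum_congr rfl fun w _ => ?_
      rw [smul_eq_mul, mul_comm]
      exact congrArg (· * f w) (hD w v)
    · intro w hw
      simp only [Function.mem_support] at hw
      have := right_ne_zero_of_mul hw
      rw [show w = FreeMonoid.ofList w.toList from rfl, hD] at this
      simp only [Finset.coe_map, Set.mem_image, Finset.mem_coe, Finsupp.mem_support_iff]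
      exact ⟨w.toList, this, rfl⟩
  have hsub : ∀ (f : List A → R) v, Finsupp.linearCombination R f (D v) =
      wordSub (fun _ a => a) (fun b a => φ a b) f v := by
    intro f v
    induction v generalizing f with
    | nil => exact (Finsupp.linearCombination_single R 1 []).trans (one_smul R _)
    | cons b v ih =>
      rw [hDcons, map_sum, wordSub_cons]
      refine Finset.sum_congr rfl fun a _ => ?_
      rw [map_smul, Finsupp.linearCombination_mapDomain, ← ih]
      rfl
  exact funext fun v => (hmorph f v).trans (hsub f v)

theorem finsum_mul_count [DecidableEq A] (f : List A → R) (l : List (List A)) :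
    ∑ᶠ w : FreeMonoid A, f w.toList * (l.count w.toList : R) = (l.map f).sum := by
  rw [finsum_eq_finsetSum_of_support_subset (s := l.toFinset.map FreeMonoid.ofList.toEmbedding)]
  · rw [Finset.sum_map, Finset.sum_list_map_count]
    refine Finset.sum_congr rfl fun w _ => ?_
    rw [nsmul_eq_mul, mul_comm]
    congr!
  · intro w hw
    simp only [Function.mem_support] at hw
    have h1 := right_ne_zero_of_mul hw
    have h2 : l.count w.toList ≠ 0 := by
      intro h; rw [h, Nat.cast_zero] at h1; exact h1 rfl
    simp only [Finset.coe_map, Set.mem_image, Finset.mem_coe, List.mem_toFinset]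
    exact ⟨w.toList, by rwa [Ne, List.count_eq_zero, not_not] at h2, rfl⟩

theorem count_map_cons [DecidableEq A] (a b : A) (w : List A) (l : List (List A)) :
    (l.map (b :: ·)).count (a :: w) = if b = a then l.count w else 0 := by
  split_ifs with h
  · subst h
    exact List.count_map_of_injective _ _ List.cons_injective _
  · rw [List.count_eq_zero]; simp [h]

/-- If `Δ` is the quasi-shuffle coproduct for the product `m` of letters, the series which are
primitive for `Δ` are those which vanish on the quasi-shuffle products. -/
theorem isPrimitive_iff_isPrim [DecidableEq A] (m : A → A → Option A)
    (Δ : A → MonoidAlgebra R (FreeMonoid A × FreeMonoid A))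
    (hΔ : ∀ (a : A) (g : MonoidAlgebra R (FreeMonoid A × FreeMonoid A)) (u v : List A),
      (Δ a * g).coeff (FreeMonoid.ofList u, FreeMonoid.ofList v) =
        (match u with
          | [] => 0
          | b :: u' => if b = a then g.coeff (FreeMonoid.ofList u', FreeMonoid.ofList v) else 0) +
        (match v with
          | [] => 0
          | c :: v' => if c = a then g.coeff (FreeMonoid.ofList u, FreeMonoid.ofList v') else 0) +
        (match u, v with
          | b :: u', c :: v' => if m b c = some a then
              g.coeff (FreeMonoid.ofList u', FreeMonoid.ofList v') else 0
          | _, _ => 0))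
    (f : NCSeries R A) : IsPrimitive Δ f ↔ IsPrim m f := by
  have hcount : ∀ (w u v : List A), (FreeMonoid.lift Δ (FreeMonoid.ofList w)).coeff
      (FreeMonoid.ofList u, FreeMonoid.ofList v) = ((quasiShuffle m u v).count w : R) := by
    intro w
    induction w with
    | nil =>
      intro u v
      rw [FreeMonoid.ofList_nil, map_one, MonoidAlgebra.one_def, MonoidAlgebra.coeff_single]
      rcases u with _ | ⟨b, u⟩ <;> rcases v with _ | ⟨c, v⟩
      · simp [Prod.one_eq_mk]
      · rw [Finsupp.single_eq_of_ne (by simp [Prod.one_eq_mk, Prod.ext_iff])]; simp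
      · rw [Finsupp.single_eq_of_ne (by simp [Prod.one_eq_mk, Prod.ext_iff])]; simp
      · rw [Finsupp.single_eq_of_ne (by simp [Prod.one_eq_mk, Prod.ext_iff])]
        rw [List.count_eq_zero.mpr, Nat.cast_zero]
        intro h
        have := length_le_of_mem_quasiShuffle h
        simp at this
    | cons a w ih =>
      intro u v
      rw [FreeMonoid.ofList_cons, map_mul, FreeMonoid.lift_eval_of, hΔ]
      simp only [ih]
      rcases u with _ | ⟨b, u⟩ <;> rcases v with _ | ⟨c, v⟩
      · simp
      · simp only [quasiShuffle_nil_left, List.count_singleton, zero_add, add_zero]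
        by_cases h : c = a <;> simp [h]
      · simp only [quasiShuffle_nil_right, List.count_singleton, add_zero]
        by_cases h : b = a <;> simp [h]
      · have h1 : ∀ o : Option A, ((o.elim [] fun c => (quasiShuffle m u v).map (c :: ·)).count
            (a :: w) : R) = if o = some a then ((quasiShuffle m u v).count w : R) else 0 := by
          intro o
          cases o with
          | none => simp
          | some e => simp [count_map_cons]
        rw [quasiShuffle, List.count_append, List.count_append, count_map_cons, count_map_cons]
        push_cast
        rw [h1]
  have hmorph : ∀ u v, morphism Δ f (FreeMonoid.ofList u, FreeMonoid.ofList v) = qsum m f u v := by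
    intro u v
    refine Eq.trans ?_ (finsum_mul_count f (quasiShuffle m u v))
    exact finsum_congr fun w => congrArg (f w.toList * ·) (hcount w.toList u v)
  have hprim : ∀ u v, (tmul f 1 + tmul 1 f : FreeMonoid A × FreeMonoid A → R)
      (FreeMonoid.ofList u, FreeMonoid.ofList v) =
      (if v = [] then f u else 0) + if u = [] then f v else 0 := by
    intro u v
    change f u * (1 : NCSeries R A) v + (1 : NCSeries R A) u * f v = _
    rcases u with _ | ⟨b, u⟩ <;> rcases v with _ | ⟨c, v⟩ <;> simp
  constructor
  · intro h
    have h2 : ∀ u v, qsum m f u v = (if v = [] then f u else 0) + if u = [] then f v else 0 := by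
      intro u v
      rw [← hmorph, ← hprim, h]
    refine ⟨?_, fun u v hu hv => by rw [h2, if_neg hu, if_neg hv, add_zero]⟩
    have h3 := h2 [] []
    rw [if_pos rfl] at h3
    have h4 : qsum m f [] [] = f [] := qsum_nil_left _ _ _
    rw [h4] at h3
    exact left_eq_add.mp h3
  · intro h
    refine funext fun p => ?_
    have h2 := congrFun (congrFun h.qsum_eq_add p.1.toList) p.2.toList
    exact (hmorph p.1.toList p.2.toList).trans (h2.trans (hprim p.1.toList p.2.toList).symm)

theorem coeff_single_left_mul [DecidableEq A] (a : A)
    (g : MonoidAlgebra R (FreeMonoid A × FreeMonoid A)) (u v : List A) :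
    (MonoidAlgebra.single (FreeMonoid.of a, 1) 1 * g).coeff
      (FreeMonoid.ofList u, FreeMonoid.ofList v) =
      match u with
      | [] => 0
      | b :: u' => if b = a then g.coeff (FreeMonoid.ofList u', FreeMonoid.ofList v) else 0 := by
  cases u with
  | nil =>
    refine MonoidAlgebra.coeff_single_mul_of_forall_mul_ne _ _ fun d hd => ?_
    have := congrArg (fun p => p.1.toList) hd
    simp at this
  | cons b u =>
    by_cases h : b = a
    · subst h
      simp only [if_true]
      exact (MonoidAlgebra.coeff_single_mul_mul g 1 (FreeMonoid.of b, 1)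
        (FreeMonoid.ofList u, FreeMonoid.ofList v)).trans (one_mul _)
    · simp only [h, if_false]
      refine MonoidAlgebra.coeff_single_mul_of_forall_mul_ne _ _ fun d hd => ?_
      have := congrArg (fun p => p.1.toList) hd
      simp at this
      exact h this.1.symm

theorem coeff_single_right_mul [DecidableEq A] (a : A)
    (g : MonoidAlgebra R (FreeMonoid A × FreeMonoid A)) (u v : List A) :
    (MonoidAlgebra.single (1, FreeMonoid.of a) 1 * g).coeff
      (FreeMonoid.ofList u, FreeMonoid.ofList v) =
      match v with
      | [] => 0
      | b :: v' => if b = a then g.coeff (FreeMonoid.ofList u, FreeMonoid.ofList v') else 0 := by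
  cases v with
  | nil =>
    refine MonoidAlgebra.coeff_single_mul_of_forall_mul_ne _ _ fun d hd => ?_
    have := congrArg (fun p => p.2.toList) hd
    simp at this
  | cons b v =>
    by_cases h : b = a
    · subst h
      simp only [if_true]
      exact (MonoidAlgebra.coeff_single_mul_mul g 1 (1, FreeMonoid.of b)
        (FreeMonoid.ofList u, FreeMonoid.ofList v)).trans (one_mul _)
    · simp only [h, if_false]
      refine MonoidAlgebra.coeff_single_mul_of_forall_mul_ne _ _ fun d hd => ?_
      have := congrArg (fun p => p.2.toList) hd
      simp at this
      exact h this.1.symm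

theorem coeff_single_pair_mul [DecidableEq A] (b c : A)
    (g : MonoidAlgebra R (FreeMonoid A × FreeMonoid A)) (u v : List A) :
    (MonoidAlgebra.single (FreeMonoid.of b, FreeMonoid.of c) 1 * g).coeff
      (FreeMonoid.ofList u, FreeMonoid.ofList v) =
      match u, v with
      | x :: u', y :: v' => if x = b ∧ y = c then
          g.coeff (FreeMonoid.ofList u', FreeMonoid.ofList v') else 0
      | _, _ => 0 := by
  rcases u with _ | ⟨x, u⟩
  · refine MonoidAlgebra.coeff_single_mul_of_forall_mul_ne _ _ fun d hd => ?_
    have := congrArg (fun p => p.1.toList) hd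
    simp at this
  rcases v with _ | ⟨y, v⟩
  · refine MonoidAlgebra.coeff_single_mul_of_forall_mul_ne _ _ fun d hd => ?_
    have := congrArg (fun p => p.2.toList) hd
    simp at this
  by_cases h : x = b ∧ y = c
  · obtain ⟨rfl, rfl⟩ := h
    simp only [and_self, if_true]
    exact (MonoidAlgebra.coeff_single_mul_mul g 1 (FreeMonoid.of x, FreeMonoid.of y)
      (FreeMonoid.ofList u, FreeMonoid.ofList v)).trans (one_mul _)
  · simp only [h, if_false]
    refine MonoidAlgebra.coeff_single_mul_of_forall_mul_ne _ _ fun d hd => h ?_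
    have h1 := congrArg (fun p => p.1.toList) hd
    have h2 := congrArg (fun p => p.2.toList) hd
    simp at h1 h2
    exact ⟨h1.1.symm, h2.1.symm⟩

theorem isPrimitive_shuffleCoprod_iff (f : NCSeries R A) :
    IsPrimitive shuffleCoprod f ↔ IsPrim noMul f := by
  classical
  refine isPrimitive_iff_isPrim noMul _ (fun a g u v => ?_) f
  rw [shuffleCoprod, add_mul, MonoidAlgebra.coeff_add, Finsupp.add_apply, coeff_single_left_mul,
    coeff_single_right_mul]
  rcases u with _ | ⟨b, u⟩ <;> rcases v with _ | ⟨c, v⟩ <;> simp [noMul]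

/-- The quasi-shuffle coproduct of a letter, when the letters which multiply to `a` form a finite
set. -/
theorem isPrimitive_iff_isPrim_of_finset [DecidableEq A] (m : A → A → Option A)
    (S : A → Finset (A × A)) (hS : ∀ a p, p ∈ S a ↔ m p.1 p.2 = some a)
    (Δ : A → MonoidAlgebra R (FreeMonoid A × FreeMonoid A))
    (hΔ : ∀ a, Δ a = MonoidAlgebra.single (FreeMonoid.of a, 1) 1 +
      MonoidAlgebra.single (1, FreeMonoid.of a) 1 +
        ∑ p ∈ S a, MonoidAlgebra.single (FreeMonoid.of p.1, FreeMonoid.of p.2) 1)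
    (f : NCSeries R A) : IsPrimitive Δ f ↔ IsPrim m f := by
  refine isPrimitive_iff_isPrim m Δ (fun a g u v => ?_) f
  rw [hΔ, add_mul, add_mul, MonoidAlgebra.coeff_add, MonoidAlgebra.coeff_add, Finsupp.add_apply,
    Finsupp.add_apply, coeff_single_left_mul, coeff_single_right_mul, Finset.sum_mul,
    MonoidAlgebra.coeff_sum, Finsupp.finsetSum_apply]
  congr 1
  simp only [coeff_single_pair_mul]
  rcases u with _ | ⟨b, u⟩ <;> rcases v with _ | ⟨c, v⟩ <;> try simp
  by_cases h : m b c = some a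
  · rw [if_pos h, Finset.sum_eq_single (b, c)]
    · simp
    · intro p _ hp
      rw [if_neg]
      rintro ⟨rfl, rfl⟩
      exact hp rfl
    · intro h1
      exact absurd ((hS a (b, c)).mpr h) h1
  · rw [if_neg h]
    refine Finset.sum_eq_zero fun p hp => if_neg ?_
    rintro ⟨rfl, rfl⟩
    exact h ((hS _ _).mp hp)

/-- The product on the letters `ỹ_{k,α}`, given by `ỹ_{k,α} ỹ_{l,α} = ỹ_{k+l,α}`; the product of
letters with different indices is not defined. -/
def congMul {G : Type*} [DecidableEq G] (a b : ℕ+ × G) : Option (ℕ+ × G) :=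
  if a.2 = b.2 then some (a.1 + b.1, a.2) else none

theorem isPrimitive_harmonicCyc_iff {N : ℕ} [NeZero N] (f : NCSeries ℚ (CycY N)) :
    IsPrimitive harmonicCyc f ↔ IsPrim yMul f := by
  classical
  refine isPrimitive_iff_isPrim_of_finset yMul (fun y =>
    (((Finset.Icc 1 y.1 ×ˢ Finset.Icc 1 y.1).filter fun k => k.1 + k.2 = y.1) ×ˢ
      (Finset.univ.filter fun ζ : Mu N × Mu N => ζ.1 * ζ.2 = y.2)).map
      (Equiv.prodProdProdComm ℕ+ ℕ+ (Mu N) (Mu N)).toEmbedding) (fun a p => ?_) _ (fun y => ?_) f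
  · rw [Finset.mem_map_equiv]
    simp only [Equiv.prodProdProdComm_symm, Equiv.prodProdProdComm_apply, Finset.mem_product,
      Finset.mem_filter, Finset.mem_Icc, Finset.mem_univ, true_and, yMul, Option.some.injEq,
      Prod.ext_iff, one_le]
    constructor
    · exact fun h => ⟨h.1.2, h.2⟩
    · intro h
      refine ⟨⟨⟨?_, ?_⟩, h.1⟩, h.2⟩
      · rw [← h.1]; exact (PNat.lt_add_right _ _).le
      · rw [← h.1]; exact (PNat.lt_add_left _ _).le
  · rw [Finset.sum_map, Finset.sum_product, harmonicCyc]
    congr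

theorem isPrimitive_harmonicCong_iff {N : ℕ} (f : NCSeries ℚ (CongY N)) :
    IsPrimitive harmonicCong f ↔ IsPrim congMul f := by
  refine isPrimitive_iff_isPrim_of_finset congMul (fun y =>
    ((Finset.Icc 1 y.1 ×ˢ Finset.Icc 1 y.1).filter fun k => k.1 + k.2 = y.1).map
      ⟨fun k => ((k.1, y.2), (k.2, y.2)), fun k k' h => by simpa [Prod.ext_iff] using h⟩)
    (fun a p => ?_) _ (fun y => ?_) f
  · simp only [Finset.mem_map, Finset.mem_filter, Finset.mem_product, Finset.mem_Icc, congMul,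
      one_le, true_and]
    constructor
    · rintro ⟨k, hk, rfl⟩
      exact (if_pos rfl).trans (congrArg some (Prod.ext hk.2 rfl))
    · intro h
      split_ifs at h with h1
      simp only [Option.some.injEq] at h
      subst h
      refine ⟨(p.1.1, p.2.1), ⟨⟨(PNat.lt_add_right _ _).le, (PNat.lt_add_left _ _).le⟩, rfl⟩, ?_⟩
      simp [Prod.ext_iff, h1]
  · rw [Finset.sum_map, harmonicCong]
    rfl

end Morphisms

/-! ### Double shuffle and distribution on the cyclotomic side -/

section CycDistribution

open NCSeries

variable {N : ℕ} {K K' : Type*} [Field K] [CharZero K] [Algebra ℚ K] [Field K'] [CharZero K']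
  [Algebra ℚ K']

/-- The series with the coefficients `T (f w)`. -/
def mapCoeff {A : Type*} (T : K →ₗ[ℚ] K') (f : NCSeries K A) : NCSeries K' A := fun w => T (f w)

theorem mapCoeff_apply {A : Type*} (T : K →ₗ[ℚ] K') (f : NCSeries K A) (w : List A) :
    mapCoeff T f w = T (f w) := rfl

namespace IsDmrCyc

variable {ψ ψ₁ ψ₂ : NCSeries K (CycX N)}

theorem map (hψ : IsDmrCyc ψ) (T : K →ₗ[ℚ] K') :
    IsDmrCyc (mapCoeff T ψ) where
  apply_none := by rw [mapCoeff_apply, hψ.apply_none, map_zero]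
  apply_one := by rw [mapCoeff_apply, hψ.apply_one, map_zero]
  shuffle := hψ.shuffle.map T.toAddMonoidHom
  parity ζ := by rw [mapCoeff_apply, hψ.parity, mapCoeff_apply]
  harmonic := by
    have h : starSer (mapCoeff T ψ) = fun w => T (starSer ψ w) := by
      funext w
      have h1 : starCorr (mapCoeff T ψ) w = T (starCorr ψ w) := by
        by_cases h : 2 ≤ w.length ∧ ∀ y ∈ w, y = ((1, 1) : CycY N)
        · rw [starCorr, starCorr, if_pos h, if_pos h]
          have h2 : ∀ x : K, (-1) ^ (w.length - 1) / (w.length : K) * x =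
              ((-1) ^ (w.length - 1) / (w.length : ℚ)) • x := fun x => by
            rw [Algebra.smul_def]; simp
          have h3 : ∀ x : K', (-1) ^ (w.length - 1) / (w.length : K') * x =
              ((-1) ^ (w.length - 1) / (w.length : ℚ)) • x := fun x => by
            rw [Algebra.smul_def]; simp
          rw [mapCoeff_apply, h2, map_smul, h3]
        · rw [starCorr_of_ne h, starCorr_of_ne h, map_zero]
      rw [starSer, starSer, h1, map_add]; rfl
    rw [h]
    exact hψ.harmonic.map T.toAddMonoidHom

theorem zero : IsDmrCyc (0 : NCSeries K (CycX N)) where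
  apply_none := rfl
  apply_one := rfl
  shuffle := ⟨rfl, fun u v _ _ => qsum_zero _ _ _⟩
  parity _ := rfl
  harmonic := by
    have h : starSer (0 : NCSeries K (CycX N)) = fun _ => 0 := by
      funext w; simp [starSer, starCorr, flat]
    rw [h]
    exact ⟨rfl, fun u v _ _ => qsum_zero _ _ _⟩

theorem add (h₁ : IsDmrCyc ψ₁) (h₂ : IsDmrCyc ψ₂) : IsDmrCyc (ψ₁ + ψ₂) where
  apply_none := by rw [NCSeries.add_apply, h₁.apply_none, h₂.apply_none, add_zero]
  apply_one := by rw [NCSeries.add_apply, h₁.apply_one, h₂.apply_one, add_zero]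
  shuffle := h₁.shuffle.add h₂.shuffle
  parity ζ := by rw [NCSeries.add_apply, NCSeries.add_apply, h₁.parity, h₂.parity]
  harmonic := by
    have h : starSer (ψ₁ + ψ₂) = fun w => starSer ψ₁ w + starSer ψ₂ w := by
      funext w
      have h1 : starCorr (ψ₁ + ψ₂) w = starCorr ψ₁ w + starCorr ψ₂ w := by
        by_cases h : 2 ≤ w.length ∧ ∀ y ∈ w, y = ((1, 1) : CycY N)
        · rw [starCorr, starCorr, starCorr, if_pos h, if_pos h, if_pos h, NCSeries.add_apply, mul_add]
        · simp only [starCorr_of_ne h, add_zero]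
      rw [starSer, starSer, starSer, h1, flat, NCSeries.add_apply, flat, flat]; ring
    rw [h]
    exact h₁.harmonic.add h₂.harmonic

end IsDmrCyc

/-- The matrix of the substitution `p^d_*`. -/
noncomputable def pMat (d : ℕ) (a b : CycX N) : ℚ := open Classical in
  match a with
  | none => if b = none then (d : ℚ) else 0
  | some ζ => if b = some (ζ ^ d) then 1 else 0

/-- The matrix of the substitution `i_d^*`. -/
noncomputable def iMat (d : ℕ) (a b : CycX N) : ℚ := open Classical in
  match a with
  | none => if b = none then 1 else 0
  | some ζ => if ζ ^ (N / d) = 1 ∧ b = some ζ then 1 else 0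

variable [NeZero N]

theorem sum_pMat_smul {V : Type*} [AddCommGroup V] [Module ℚ V] (d : ℕ) (ζ : Mu N)
    (g : CycX N → V) : ∑ b, pMat d (some ζ) b • g b = g (some (ζ ^ d)) := by
  classical
  simp [pMat]

theorem sum_iMat_smul {V : Type*} [AddCommGroup V] [Module ℚ V] (d : ℕ) (ζ : Mu N)
    (g : CycX N → V) : ∑ b, iMat d (some ζ) b • g b =
      open Classical in if ζ ^ (N / d) = 1 then g (some ζ) else 0 := by
  classical
  by_cases h : ζ ^ (N / d) = 1 <;> simp [iMat, h]

/-- The conditions defining `𝔡𝔪𝔯𝔡₀^{μ_N}`, over any field and in terms of words.  The correction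
terms of the distribution relations vanish and are omitted. -/
structure IsDmrdCyc (ψ : NCSeries K (CycX N)) : Prop extends IsDmrCyc ψ where
  distribution : ∀ d, d ∣ N → letterSub (pMat d) ψ = letterSub (iMat d) ψ

theorem mem_dmrCyc_iff (ψ : NCSeries ℚ (CycX N)) : ψ ∈ dmrCyc N ↔ IsDmrCyc ψ := by
  have h : starCyc ψ = starSer ψ := rfl
  constructor
  · rintro ⟨⟨h1, h2⟩, h3, h4, h5⟩
    refine ⟨h1, h2, (isPrimitive_shuffleCoprod_iff ψ).mp h3, fun ζ => sub_eq_zero.mp (h4 ζ), ?_⟩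
    rw [← h]
    exact (isPrimitive_harmonicCyc_iff _).mp h5
  · rintro ⟨h1, h2, h3, h4, h5⟩
    refine ⟨⟨h1, h2⟩, (isPrimitive_shuffleCoprod_iff ψ).mpr h3, fun ζ => sub_eq_zero.mpr (h4 ζ), ?_⟩
    rw [← h] at h5
    exact (isPrimitive_harmonicCyc_iff _).mpr h5

/-- Comparison of the coefficients of all letters `x_ζ` in a distribution relation. -/
theorem sum_eq_of_distribution {ψ : NCSeries ℚ (CycX N)} {d : ℕ} {s : ℚ}
    (h : letterSub (pMat d) ψ = letterSub (iMat d) ψ + s • X (some 1)) :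
    ∑ ζ, ψ [some ζ] = (open Classical in ∑ ζ : Mu N with ζ ^ (N / d) = 1, ψ [some ζ]) + s := by
  classical
  have h1 : ∀ η : Mu N, letterSub (pMat d) ψ [some η] =
      letterSub (iMat d) ψ [some η] + s * (X (some 1) : NCSeries ℚ (CycX N)) [some η] := by
    intro η; rw [h]; rfl
  have h2 := Finset.sum_congr rfl fun η (_ : η ∈ Finset.univ) => h1 η
  simp only [letterSub_singleton, Finset.sum_add_distrib, ← Finset.mul_sum] at h2
  rw [Finset.sum_comm, Finset.sum_comm (f := fun η a => iMat d a (some η) • ψ [a]),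
    Fintype.sum_option, Fintype.sum_option] at h2
  have h3 : ∑ η : Mu N, (X (some 1) : NCSeries ℚ (CycX N)) [some η] = 1 := by
    simp [X]
  rw [h3] at h2
  have h4 : ∀ ζ η : Mu N, iMat d (some ζ) (some η) • ψ [some ζ] =
      if η = ζ then (if ζ ^ (N / d) = 1 then ψ [some ζ] else 0) else 0 := by
    intro ζ η
    by_cases h5 : η = ζ <;> by_cases h6 : ζ ^ (N / d) = 1 <;> simp [iMat, h5, h6]
  have h5 : ∀ ζ η : Mu N, pMat d (some ζ) (some η) • ψ [some ζ] =
      if η = ζ ^ d then ψ [some ζ] else 0 := by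
    intro ζ η
    by_cases h5 : η = ζ ^ d <;> simp [pMat, h5]
  simp only [h4, h5, Finset.sum_ite_eq', Finset.mem_univ, if_true] at h2
  simpa [pMat, iMat, Finset.sum_filter] using h2

theorem mem_dmrdCyc_iff (ψ : NCSeries ℚ (CycX N)) : ψ ∈ dmrdCyc N ↔ IsDmrdCyc ψ := by
  classical
  have hN : 0 < N := Nat.pos_of_ne_zero (NeZero.ne N)
  have hp : ∀ d, pDist d ψ = letterSub (pMat d) ψ := fun d => by
    rw [pDist, letterMorphism_eq]; rfl
  have hi : ∀ d, iDist d ψ = letterSub (iMat d) ψ := fun d => by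
    rw [iDist, letterMorphism_eq]; rfl
  have hone : ψ [some 1] = 0 → ∑ ζ : Mu N with ζ ^ (N / N) = 1, ψ [some ζ] = 0 := by
    intro h
    rw [Nat.div_self hN]
    refine Finset.sum_eq_zero fun ζ hζ => ?_
    simp only [pow_one, Finset.mem_filter, Finset.mem_univ, true_and] at hζ
    rw [hζ, h]
  constructor
  · rintro ⟨h1, h2⟩
    refine ⟨(mem_dmrCyc_iff ψ).mp h1, fun d hd => ?_⟩
    have h3 : ∀ d, d ∣ N → letterSub (pMat d) ψ = letterSub (iMat d) ψ +
        (∑ ζ : Mu N with ζ ^ (N / d) = 1, ψ [some ζ]) • X (some 1) := fun d hd => by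
      rw [← hp, ← hi, h2 d hd]
    have h4 := sum_eq_of_distribution (h3 N dvd_rfl)
    have h5 := sum_eq_of_distribution (h3 d hd)
    rw [hone h1.1.2, add_zero] at h4
    have h6 : ∑ ζ : Mu N with ζ ^ (N / d) = 1, ψ [some ζ] = 0 := by linarith
    rw [h3 d hd, h6, zero_smul, add_zero]
  · rintro ⟨h1, h2⟩
    refine ⟨(mem_dmrCyc_iff ψ).mpr h1, fun d hd => ?_⟩
    have h3 : ∀ d, d ∣ N → letterSub (pMat d) ψ = letterSub (iMat d) ψ +
        (0 : ℚ) • X (some 1) := fun d hd => by rw [h2 d hd, zero_smul, add_zero]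
    have h4 := sum_eq_of_distribution (h3 N dvd_rfl)
    have h5 := sum_eq_of_distribution (h3 d hd)
    rw [hone h1.apply_one, add_zero] at h4
    rw [add_zero, h4] at h5
    rw [hp, hi, h2 d hd, ← h5, zero_smul, add_zero]

theorem letterSub_tCyc {φ : CycX N → CycX N → ℚ} {ζ η : Mu N}
    (h : ∀ a b : CycX N, φ (a.map (ζ * ·)) (b.map (η * ·)) = φ a b) (f : NCSeries K (CycX N)) :
    letterSub φ (tCyc ζ f) = tCyc η (letterSub φ f) := by
  refine NCSeries.ext fun w => ?_
  rw [tCyc_apply]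
  induction w generalizing f with
  | nil => rfl
  | cons b w ih =>
    rw [List.map_cons, letterSub_cons, letterSub_cons]
    refine Fintype.sum_equiv (Equiv.optionCongr (Equiv.mulLeft ζ⁻¹)) _ _ fun a => ?_
    have h1 : tail [a] (tCyc ζ f) = tCyc ζ (tail [Option.map (ζ⁻¹ * ·) a] f) := rfl
    have h2 : (Equiv.optionCongr (Equiv.mulLeft ζ⁻¹)) a = Option.map (ζ⁻¹ * ·) a := rfl
    have h3 := h (Option.map (ζ⁻¹ * ·) a) (Option.map (η⁻¹ * ·) b)
    rw [Option.map_map, Option.map_map] at h3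
    have h4 : ∀ (ζ : Mu N) (a : CycX N), Option.map ((ζ * ·) ∘ (ζ⁻¹ * ·)) a = a := by
      intro ζ a; cases a <;> simp
    rw [h4, h4] at h3
    rw [h1, ih, h2, h3]

theorem letterSub_pMat_X (d : ℕ) (ζ : Mu N) :
    letterSub (pMat d) (X (some ζ) : NCSeries K (CycX N)) = X (some (ζ ^ d)) := by
  classical
  rw [letterSub_X, sum_pMat_smul]

theorem letterSub_pMat_dCyc (d : ℕ) (ψ f : NCSeries K (CycX N)) :
    letterSub (pMat d) (dCyc ψ f) = dCyc (letterSub (pMat d) ψ) (letterSub (pMat d) f) := by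
  refine letterSub_der (fun a => ?_) f
  cases a with
  | none =>
    rw [Finset.sum_eq_zero]
    · exact letterSub_zero _
    · intro b _
      cases b with
      | none => simp [dCycLetter]
      | some η => simp [pMat]
  | some ζ =>
    rw [sum_pMat_smul]
    have ht : letterSub (pMat d) (tCyc ζ ψ) = tCyc (ζ ^ d) (letterSub (pMat d) ψ) := by
      refine letterSub_tCyc (fun a b => ?_) ψ
      cases a <;> cases b <;> simp [pMat, mul_pow]
    rw [dCycLetter, letterSub_sub, letterSub_mul, letterSub_mul, letterSub_pMat_X, ht]; rfl

theorem letterSub_iMat_dCyc (d : ℕ) (ψ f : NCSeries K (CycX N)) :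
    letterSub (iMat d) (dCyc ψ f) = dCyc (letterSub (iMat d) ψ) (letterSub (iMat d) f) := by
  classical
  refine letterSub_der (fun a => ?_) f
  cases a with
  | none =>
    rw [Finset.sum_eq_zero]
    · exact letterSub_zero _
    · intro b _
      cases b with
      | none => simp [dCycLetter]
      | some η => simp [iMat]
  | some ζ =>
    rw [sum_iMat_smul, dCycLetter, letterSub_sub, letterSub_mul, letterSub_mul, letterSub_X,
      sum_iMat_smul]
    by_cases h : ζ ^ (N / d) = 1
    · have ht : letterSub (iMat d) (tCyc ζ ψ) = tCyc ζ (letterSub (iMat d) ψ) := by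
        refine letterSub_tCyc (fun a b => ?_) ψ
        cases a <;> cases b <;> simp [iMat, mul_pow, h]
      rw [if_pos h, ht, if_pos h]; rfl
    · rw [if_neg h, if_neg h, zero_mul, mul_zero, sub_zero]

namespace IsDmrdCyc

variable {ψ ψ₁ ψ₂ : NCSeries K (CycX N)}

/-- `𝔡𝔪𝔯𝔡₀^{μ_N}` is closed under the bracket. -/
theorem bracketCyc (h₁ : IsDmrdCyc ψ₁) (h₂ : IsDmrdCyc ψ₂) (hG : ∃ g : Mu N, g ≠ 1 ∧ g * g ≠ 1) :
    IsDmrdCyc (bracketCyc ψ₁ ψ₂) where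
  toIsDmrCyc := h₁.toIsDmrCyc.bracketCyc h₂.toIsDmrCyc hG
  distribution d hd := by
    simp only [_root_.bracketCyc, letterSub_add, letterSub_sub, letterSub_mul, letterSub_pMat_dCyc,
      letterSub_iMat_dCyc, h₁.distribution d hd, h₂.distribution d hd]

theorem map (hψ : IsDmrdCyc ψ) (T : K →ₗ[ℚ] K') :
    IsDmrdCyc (mapCoeff T ψ) where
  toIsDmrCyc := hψ.toIsDmrCyc.map T
  distribution d hd := by
    have h := hψ.distribution d hd
    refine NCSeries.ext fun w => ?_
    have h1 := congrArg T (congrFun h w)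
    exact (map_wordSub T _ _ ψ w).symm.trans (h1.trans (map_wordSub T _ _ ψ w))

theorem zero : IsDmrdCyc (0 : NCSeries K (CycX N)) where
  toIsDmrCyc := IsDmrCyc.zero
  distribution d _ := by rw [letterSub_zero, letterSub_zero]

theorem add (h₁ : IsDmrdCyc ψ₁) (h₂ : IsDmrdCyc ψ₂) : IsDmrdCyc (ψ₁ + ψ₂) where
  toIsDmrCyc := h₁.toIsDmrCyc.add h₂.toIsDmrCyc
  distribution d hd := by
    rw [letterSub_add, letterSub_add, h₁.distribution d hd, h₂.distribution d hd]

end IsDmrdCyc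

end CycDistribution

/-! ### Double shuffle and distribution on the congruent side -/

section CongDistribution

open NCSeries

variable {N : ℕ} {K K' : Type*} [Field K] [CharZero K] [Algebra ℚ K] [Field K'] [CharZero K']
  [Algebra ℚ K']

/-- The series `π_Ỹ(𝐪̃⁻¹(ψ))`. -/
def flatCong (ψ : NCSeries K (CongX N)) (w : List (CongY N)) : K := ψ (qWord (yWord w))

/-- The matrix of the substitution `p̃^d_*`. -/
noncomputable def pMatCong (d : ℕ) (a b : CongX N) : ℚ := open Classical in
  match a with
  | none => if b = none then (d : ℚ) else 0
  | some α => if (∃ β : ZMod N, α = d * β) ∧ b = some α then (d : ℚ) else 0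

/-- The matrix of the substitution `ĩ_d^*`. -/
noncomputable def iMatCong (d : ℕ) (a b : CongX N) : ℚ := open Classical in
  match a with
  | none => if b = none then 1 else 0
  | some α => if b = some (d * α) then 1 else 0

variable [NeZero N]

/-- The correction term
`∑_{n ≥ 2} ∑_{α, β₁, …, β_n} ((-1)^{n-1}/(n N^n)) (ψ | x̃^{n-1} x̃_α) ỹ_{1,β₁} ⋯ ỹ_{1,β_n}`. -/
noncomputable def starCorrCong (ψ : NCSeries K (CongX N)) (w : List (CongY N)) : K :=
  open Classical in if 2 ≤ w.length ∧ ∀ y ∈ w, y.1 = 1 then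
    ∑ α : ZMod N, (-1) ^ (w.length - 1) / ((w.length : K) * (N : K) ^ w.length) *
      ψ (List.replicate (w.length - 1) none ++ [some α])
  else 0

/-- The series `ψ̃_*`, with coefficients in any field. -/
noncomputable def starSerCong (ψ : NCSeries K (CongX N)) (w : List (CongY N)) : K :=
  flatCong ψ w + starCorrCong ψ w

theorem starCorrCong_of_ne {ψ : NCSeries K (CongX N)} {w : List (CongY N)}
    (h : ¬(2 ≤ w.length ∧ ∀ y ∈ w, y.1 = 1)) : starCorrCong ψ w = 0 := by
  rw [starCorrCong, if_neg h]

/-- The conditions defining `𝔡𝔪𝔯𝔡₀^{[N]}`, over any field and in terms of words.  The correction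
terms of the distribution relations vanish and are omitted. -/
structure IsDmrdCong (ψ : NCSeries K (CongX N)) : Prop where
  apply_none : ψ [none] = 0
  sum_apply : ∑ α : ZMod N, ψ [some α] = 0
  shuffle : IsPrim noMul ψ
  parity : ∀ α, ψ [some α] = ψ [some (-α)]
  harmonic : IsPrim congMul (starSerCong ψ)
  distribution : ∀ d, d ∣ N → letterSub (pMatCong d) ψ = letterSub (iMatCong d) ψ

theorem mem_dmrdCong_iff (hN : 2 ≤ N) (ψ : NCSeries ℚ (CongX N)) :
    ψ ∈ dmrdCong N ↔ IsDmrdCong ψ := by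
  classical
  have hN0 : (N : ℚ) ≠ 0 := Nat.cast_ne_zero.mpr (NeZero.ne N)
  have hN1 : (N : ℚ) - 1 ≠ 0 := by
    have : (2 : ℚ) ≤ N := by exact_mod_cast hN
    intro h; linarith
  have hp : ∀ d, pDistCong d ψ = letterSub (pMatCong d) ψ := fun d => by
    rw [pDistCong, letterMorphism_eq]
    congr 1
    funext a b
    cases a <;> simp only [pMatCong]
    congr
  have hi : ∀ d, iDistCong d ψ = letterSub (iMatCong d) ψ := fun d => by
    rw [iDistCong, letterMorphism_eq]
    congr 1
  have hpN : letterSub (pMatCong N) ψ [some 0] = N * ψ [some 0] := by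
    rw [letterSub_singleton, Finset.sum_eq_single (some 0)]
    · simp [pMatCong]
    · intro a _ ha
      cases a with
      | none => simp [pMatCong]
      | some α =>
        have : (0 : ZMod N) ≠ α := fun h => ha (by rw [h])
        simp [pMatCong, this]
    · simp
  have hiN : letterSub (iMatCong N) ψ [some 0] = ∑ α, ψ [some α] := by
    rw [letterSub_singleton, Fintype.sum_option]
    simp [iMatCong]
  have hs : starCong ψ = starSerCong ψ := rfl
  constructor
  · rintro ⟨⟨⟨h1, h2⟩, h3, h4, h5⟩, h6⟩
    have h7 : ψ [some 0] = 0 := by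
      have h8 := congrFun (h6 N dvd_rfl) [some 0]
      have h9 : (∑ α : ZMod N with ∃ β : ZMod N, α = (N : ℕ) * β, X (some α) :
          NCSeries ℚ (CongX N)) [some 0] = 1 := by
        rw [NCSeries.sum_apply]
        simp [X]
      have h10 : letterSub (pMatCong N) ψ [some 0] =
          letterSub (iMatCong N) ψ [some 0] + ψ [some 0] * 1 := by
        rw [← h9, ← hp, ← hi]; exact h8
      rw [hpN, hiN, h2, zero_add, mul_one] at h10
      have h11 : ((N : ℚ) - 1) * ψ [some 0] = 0 := by rw [sub_mul, h10]; ring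
      exact (mul_eq_zero.mp h11).resolve_left hN1
    refine ⟨h1, h2, (isPrimitive_shuffleCoprod_iff ψ).mp h3, fun α => sub_eq_zero.mp (h4 α), ?_,
      fun d hd => ?_⟩
    · rw [← hs]
      exact (isPrimitive_harmonicCong_iff _).mp h5
    · rw [← hp, ← hi, h6 d hd, h7, zero_smul, add_zero]
  · rintro ⟨h1, h2, h3, h4, h5, h6⟩
    have h7 : ψ [some 0] = 0 := by
      have h8 := congrFun (h6 N dvd_rfl) [some 0]
      rw [hpN, hiN, h2] at h8
      exact (mul_eq_zero.mp h8).resolve_left hN0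
    refine ⟨⟨⟨h1, h2⟩, (isPrimitive_shuffleCoprod_iff ψ).mpr h3, fun α => sub_eq_zero.mpr (h4 α), ?_⟩,
      fun d hd => ?_⟩
    · rw [← hs] at h5
      exact (isPrimitive_harmonicCong_iff _).mpr h5
    · rw [hp, hi, h6 d hd, h7, zero_smul, add_zero]

namespace IsDmrdCong

variable {ψ ψ₁ ψ₂ : NCSeries K (CongX N)}

theorem map (hψ : IsDmrdCong ψ) (T : K →ₗ[ℚ] K') : IsDmrdCong (mapCoeff T ψ) where
  apply_none := by rw [mapCoeff_apply, hψ.apply_none, map_zero]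
  sum_apply := by simp only [mapCoeff_apply]; rw [← map_sum, hψ.sum_apply, map_zero]
  shuffle := hψ.shuffle.map T.toAddMonoidHom
  parity ζ := by rw [mapCoeff_apply, hψ.parity, mapCoeff_apply]
  harmonic := by
    have h : starSerCong (mapCoeff T ψ) = fun w => T (starSerCong ψ w) := by
      funext w
      have h1 : starCorrCong (mapCoeff T ψ) w = T (starCorrCong ψ w) := by
        by_cases h : 2 ≤ w.length ∧ ∀ y ∈ w, y.1 = 1
        · rw [starCorrCong, starCorrCong, if_pos h, if_pos h, map_sum]
          refine Finset.sum_congr rfl fun α _ => ?_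
          have h2 : ∀ x : K, (-1) ^ (w.length - 1) / ((w.length : K) * (N : K) ^ w.length) * x =
              ((-1) ^ (w.length - 1) / ((w.length : ℚ) * (N : ℚ) ^ w.length)) • x := fun x => by
            rw [Algebra.smul_def]; simp
          have h3 : ∀ x : K', (-1) ^ (w.length - 1) / ((w.length : K') * (N : K') ^ w.length) * x =
              ((-1) ^ (w.length - 1) / ((w.length : ℚ) * (N : ℚ) ^ w.length)) • x := fun x => by
            rw [Algebra.smul_def]; simp
          rw [mapCoeff_apply, h2, map_smul, h3]
        · rw [starCorrCong_of_ne h, starCorrCong_of_ne h, map_zero]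
      rw [starSerCong, starSerCong, h1, map_add]; rfl
    rw [h]
    exact hψ.harmonic.map T.toAddMonoidHom
  distribution d hd := by
    have h := hψ.distribution d hd
    refine NCSeries.ext fun w => ?_
    have h1 := congrArg T (congrFun h w)
    exact (map_wordSub T _ _ ψ w).symm.trans (h1.trans (map_wordSub T _ _ ψ w))

theorem zero : IsDmrdCong (0 : NCSeries K (CongX N)) where
  apply_none := rfl
  sum_apply := by simp
  shuffle := ⟨rfl, fun u v _ _ => qsum_zero _ _ _⟩
  parity _ := rfl
  harmonic := by
    have h : starSerCong (0 : NCSeries K (CongX N)) = fun _ => 0 := by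
      funext w; simp [starSerCong, starCorrCong, flatCong]
    rw [h]
    exact ⟨rfl, fun u v _ _ => qsum_zero _ _ _⟩
  distribution d _ := by rw [letterSub_zero, letterSub_zero]

theorem add (h₁ : IsDmrdCong ψ₁) (h₂ : IsDmrdCong ψ₂) : IsDmrdCong (ψ₁ + ψ₂) where
  apply_none := by rw [NCSeries.add_apply, h₁.apply_none, h₂.apply_none, add_zero]
  sum_apply := by
    simp only [NCSeries.add_apply]
    rw [Finset.sum_add_distrib, h₁.sum_apply, h₂.sum_apply, add_zero]
  shuffle := h₁.shuffle.add h₂.shuffle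
  parity ζ := by rw [NCSeries.add_apply, NCSeries.add_apply, h₁.parity, h₂.parity]
  harmonic := by
    have h : starSerCong (ψ₁ + ψ₂) = fun w => starSerCong ψ₁ w + starSerCong ψ₂ w := by
      funext w
      have h1 : starCorrCong (ψ₁ + ψ₂) w = starCorrCong ψ₁ w + starCorrCong ψ₂ w := by
        by_cases h : 2 ≤ w.length ∧ ∀ y ∈ w, y.1 = 1
        · rw [starCorrCong, starCorrCong, starCorrCong, if_pos h, if_pos h, if_pos h,
            ← Finset.sum_add_distrib]
          exact Finset.sum_congr rfl fun α _ => by rw [NCSeries.add_apply, mul_add]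
        · simp only [starCorrCong_of_ne h, add_zero]
      rw [starSerCong, starSerCong, starSerCong, h1, flatCong, NCSeries.add_apply, flatCong,
        flatCong]
      ring
    rw [h]
    exact h₁.harmonic.add h₂.harmonic
  distribution d hd := by
    rw [letterSub_add, letterSub_add, h₁.distribution d hd, h₂.distribution d hd]

end IsDmrdCong

end CongDistribution

/-! ### The pairing of `μ_N` and `ℤ/N` -/

section Pairing

open NCSeries

variable (N : ℕ) [NeZero N]

/-- The isomorphism `ℤ/N ≃ μ_N`, `m ↦ ζ_N^m`. -/
noncomputable def muHom : ZMod N →+ Additive (Mu N) :=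
  ZMod.lift N ⟨zmultiplesHom (Additive (Mu N)) (Additive.ofMul (zetaMu N)), by
    have h : zetaMu N ^ N = 1 := by
      have := (zetaMu N).2
      exact Subtype.ext this
    rw [zmultiplesHom_apply, natCast_zsmul, ← ofMul_pow, h]; rfl⟩

theorem muHom_natCast (m : ℕ) : muHom N m = Additive.ofMul (zetaMu N ^ m) := by
  have h := ZMod.lift_coe N (A := Additive (Mu N)) ⟨zmultiplesHom (Additive (Mu N))
    (Additive.ofMul (zetaMu N)), by
    have h : zetaMu N ^ N = 1 := Subtype.ext (zetaMu N).2
    rw [zmultiplesHom_apply, natCast_zsmul, ← ofMul_pow, h]; rfl⟩ m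
  rw [Int.cast_natCast] at h
  refine h.trans ?_
  simp [zmultiplesHom_apply]

theorem muHom_bijective : Function.Bijective (muHom N) := by
  rw [Fintype.bijective_iff_injective_and_card]
  constructor
  · rw [injective_iff_map_eq_zero]
    intro a ha
    rw [← ZMod.natCast_zmod_val a, muHom_natCast] at ha
    have h1 : zetaMu N ^ a.val = 1 := ha
    have h2 : IsPrimitiveRoot (Complex.exp (2 * Real.pi * Complex.I / N)) N :=
      Complex.isPrimitiveRoot_exp N (NeZero.ne N)
    have h3 : Complex.exp (2 * Real.pi * Complex.I / N) ^ a.val = 1 := by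
      have h4 := congrArg (fun η : Mu N => ((η : ℂˣ) : ℂ)) h1
      simpa [zetaMu] using h4
    have h4 := h2.dvd_of_pow_eq_one _ h3
    have h5 := Nat.eq_zero_of_dvd_of_lt h4 (ZMod.val_lt a)
    exact (ZMod.val_eq_zero a).mp h5
  · rw [ZMod.card]
    rw [Fintype.card_congr (Additive.toMul (α := Mu N))]
    have h := Complex.card_rootsOfUnity N
    exact h.symm.trans Nat.card_eq_fintype_card

/-- The index `m` of `ζ_N^m ∈ μ_N`. -/
noncomputable def muIdx : Mu N ≃ ZMod N :=
  Additive.ofMul.trans (AddEquiv.ofBijective (muHom N) (muHom_bijective N)).symm.toEquiv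

variable {N}

theorem muIdx_mul (η ω : Mu N) : muIdx N (η * ω) = muIdx N η + muIdx N ω :=
  map_add (AddEquiv.ofBijective (muHom N) (muHom_bijective N)).symm (Additive.ofMul η)
    (Additive.ofMul ω)

@[simp] theorem muIdx_one : muIdx N 1 = 0 :=
  map_zero (AddEquiv.ofBijective (muHom N) (muHom_bijective N)).symm

theorem muIdx_inv (η : Mu N) : muIdx N η⁻¹ = -muIdx N η := by
  rw [eq_neg_iff_add_eq_zero, ← muIdx_mul, inv_mul_cancel, muIdx_one]

theorem muIdx_pow (η : Mu N) (d : ℕ) : muIdx N (η ^ d) = d * muIdx N η := by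
  induction d with
  | zero => simp
  | succ d ih => rw [pow_succ, muIdx_mul, ih]; push_cast; ring

theorem muIdx_zetaMu_pow (m : ℕ) : muIdx N (zetaMu N ^ m) = m := by
  have h := muHom_natCast N m
  have h2 := congrArg (AddEquiv.ofBijective (muHom N) (muHom_bijective N)).symm h
  refine h2.symm.trans ?_
  exact (AddEquiv.ofBijective (muHom N) (muHom_bijective N)).symm_apply_apply (m : ZMod N)

theorem muIdx_eq_zero {η : Mu N} : muIdx N η = 0 ↔ η = 1 := by
  rw [← muIdx_one, (muIdx N).apply_eq_iff_eq]

theorem exists_mul_self_ne_one (hN : 3 ≤ N) : ∃ g : Mu N, g ≠ 1 ∧ g * g ≠ 1 := by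
  refine ⟨zetaMu N, fun h => ?_, fun h => ?_⟩
  · have := muIdx_zetaMu_pow (N := N) 1
    rw [pow_one, h, muIdx_one] at this
    have := (ZMod.natCast_eq_zero_iff 1 N).mp this.symm
    have := Nat.le_of_dvd one_pos this
    omega
  · have := muIdx_zetaMu_pow (N := N) 2
    rw [pow_two, h, muIdx_one] at this
    have := (ZMod.natCast_eq_zero_iff 2 N).mp this.symm
    have := Nat.le_of_dvd two_pos this
    omega

variable (N)

/-- The additive character `a ↦ ζ_N^a` of `ℤ/N`. -/
noncomputable def zetaChar : AddChar (ZMod N) (CycField N) :=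
  AddChar.zmodChar N (zetaField_primitive N).pow_eq_one

variable {N}

theorem zetaChar_natCast (m : ℕ) : zetaChar N m = zetaField N ^ m := AddChar.zmodChar_apply' _ m

theorem zetaChar_isPrimitive : (zetaChar N).IsPrimitive :=
  AddChar.zmodChar_primitive_of_primitive_root N (zetaField_primitive N)

theorem sum_zetaChar (b : ZMod N) :
    ∑ a, zetaChar N (a * b) = if b = 0 then (N : CycField N) else 0 := by
  have h := AddChar.sum_mulShift (ψ := zetaChar N) b zetaChar_isPrimitive
  rw [h, ZMod.card]
  split_ifs <;> simp

theorem sum_zetaChar_muIdx (b : ZMod N) :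
    ∑ η : Mu N, zetaChar N (muIdx N η * b) = if b = 0 then (N : CycField N) else 0 := by
  rw [← sum_zetaChar]
  exact Fintype.sum_equiv (muIdx N) _ _ fun _ => rfl

theorem zetaChar_eq_one_iff (a : ZMod N) : zetaChar N a = 1 ↔ a = 0 :=
  AddChar.IsPrimitive.zmod_char_eq_one_iff N zetaChar_isPrimitive a

theorem natCast_cycField_ne_zero : (N : CycField N) ≠ 0 := Nat.cast_ne_zero.mpr (NeZero.ne N)

/-- The kernel of the multiplication by `d` on `ℤ/N` consists of the multiples of `N/d`. -/
theorem mul_eq_zero_iff_exists {d e : ℕ} (hde : d * e = N) (β : ZMod N) :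
    (d : ZMod N) * β = 0 ↔ ∃ k < d, β = ((e * k : ℕ) : ZMod N) := by
  have hN := NeZero.ne N
  have hd : 0 < d := Nat.pos_of_ne_zero fun h => hN (by rw [← hde, h, zero_mul])
  constructor
  · intro h
    have h1 : ((d * β.val : ℕ) : ZMod N) = 0 := by
      rw [Nat.cast_mul, ZMod.natCast_zmod_val, h]
    rw [ZMod.natCast_eq_zero_iff] at h1
    obtain ⟨k, hk⟩ := Nat.dvd_of_mul_dvd_mul_left hd ((dvd_of_eq hde).trans h1)
    have h2 := ZMod.val_lt β
    refine ⟨k, ?_, by rw [← hk, ZMod.natCast_zmod_val]⟩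
    rw [hk] at h2
    by_contra h3
    have h4 : e * d ≤ e * k := Nat.mul_le_mul_left e (by omega)
    have h5 : e * d = N := by rw [mul_comm, hde]
    omega
  · rintro ⟨k, -, rfl⟩
    rw [← Nat.cast_mul, ← mul_assoc, hde, Nat.cast_mul, ZMod.natCast_self, zero_mul]

theorem card_mul_eq_zero {d : ℕ} (hd : d ∣ N) :
    (Finset.univ.filter fun β : ZMod N => (d : ZMod N) * β = 0).card = d := by
  obtain ⟨e, hde⟩ := hd
  have hN := NeZero.ne N
  have he : 0 < e := Nat.pos_of_ne_zero fun h => hN (by rw [hde, h, mul_zero])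
  have h : (Finset.univ.filter fun β : ZMod N => (d : ZMod N) * β = 0) =
      (Finset.range d).image fun k => ((e * k : ℕ) : ZMod N) := by
    ext β
    simp only [Finset.mem_filter, Finset.mem_univ, true_and, Finset.mem_image, Finset.mem_range,
      mul_eq_zero_iff_exists hde.symm]
    exact exists_congr fun k => and_congr_right fun _ => eq_comm
  rw [h, Finset.card_image_of_injOn, Finset.card_range]
  intro k hk l hl hkl
  simp only [Finset.coe_range, Set.mem_Iio] at hk hl
  have hlt : ∀ k, k < d → e * k < N := fun k hk => by
    rw [hde, mul_comm d e]; exact Nat.mul_lt_mul_of_pos_left hk he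
  have h1 := congrArg ZMod.val hkl
  simp only [] at h1
  rw [ZMod.val_natCast_of_lt (hlt k hk), ZMod.val_natCast_of_lt (hlt l hl)] at h1
  exact Nat.eq_of_mul_eq_mul_left he h1

theorem card_mul_eq_mul {d : ℕ} (hd : d ∣ N) (α : ZMod N) :
    (Finset.univ.filter fun β : ZMod N => (d : ZMod N) * β = d * α).card = d := by
  refine Eq.trans ?_ (card_mul_eq_zero hd)
  refine Finset.card_bij (fun β _ => β - α) (fun β hβ => ?_) (fun β _ γ _ h => by simpa using h)
    fun γ hγ => ⟨γ + α, ?_, by ring⟩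
  · simp only [Finset.mem_filter, Finset.mem_univ, true_and] at hβ ⊢
    rw [mul_sub, hβ, sub_self]
  · simp only [Finset.mem_filter, Finset.mem_univ, true_and] at hγ ⊢
    rw [mul_add, hγ, zero_add]

/-- Poisson summation for the multiplication by `d`. -/
theorem sum_zetaChar_of_mul_eq (d : ℕ) (α w : ZMod N) :
    ∑ m : ZMod N, (if (d : ZMod N) * m = w then zetaChar N (-(m * α)) else 0) =
      ∑ β : ZMod N, if (d : ZMod N) * β = α then zetaChar N (-(w * β)) else 0 := by
  have hN := natCast_cycField_ne_zero (N := N)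
  have h1 : ∀ x y : ZMod N, ∑ β : ZMod N, zetaChar N (β * (x - y)) =
      if x = y then (N : CycField N) else 0 := by
    intro x y
    rw [sum_zetaChar]
    simp only [sub_eq_zero]
  have h2 : ∀ (P : Prop) [Decidable P] (x : CycField N), (N : CycField N) * (if P then x else 0) =
      (if P then (N : CycField N) else 0) * x := by
    intro P _ x; split_ifs <;> simp
  refine mul_left_cancel₀ hN ?_
  rw [Finset.mul_sum, Finset.mul_sum]
  simp only [h2, ← h1, Finset.sum_mul]
  rw [Finset.sum_comm]
  refine Finset.sum_congr rfl fun β _ => Finset.sum_congr rfl fun m _ => ?_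
  rw [← AddChar.map_add_eq_mul, ← AddChar.map_add_eq_mul]
  congr 1
  ring

theorem sum_zetaChar_of_mul_eq_mul {d e : ℕ} (hde : d * e = N) (α w : ZMod N) :
    ∑ β : ZMod N, (if (d : ZMod N) * β = d * α then zetaChar N (-(w * β)) else 0) =
      if (e : ZMod N) * w = 0 then (d : CycField N) * zetaChar N (-(w * α)) else 0 := by
  split_ifs with h
  · have h1 : ∀ β : ZMod N, (if (d : ZMod N) * β = d * α then zetaChar N (-(w * β)) else 0) =
        if (d : ZMod N) * β = d * α then zetaChar N (-(w * α)) else 0 := by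
      intro β
      split_ifs with h2
      · have h3 : (d : ZMod N) * (β - α) = 0 := by rw [mul_sub, h2, sub_self]
        obtain ⟨k, -, hk⟩ := (mul_eq_zero_iff_exists hde _).mp h3
        have h4 : w * β = w * α := by
          have h5 : w * (β - α) = 0 := by
            rw [hk, Nat.cast_mul, ← mul_assoc, mul_comm w, h, zero_mul]
          rw [mul_sub] at h5
          exact sub_eq_zero.mp h5
        rw [h4]
      · rfl
    rw [Finset.sum_congr rfl fun β _ => h1 β, ← Finset.sum_filter, Finset.sum_const,
      card_mul_eq_mul ⟨e, hde.symm⟩, nsmul_eq_mul]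
  · set S := ∑ β : ZMod N, (if (d : ZMod N) * β = d * α then zetaChar N (-(w * β)) else 0) with hS
    have h1 : S = zetaChar N (-(w * e)) * S := by
      rw [hS, Finset.mul_sum]
      refine Fintype.sum_equiv (Equiv.subRight (e : ZMod N)) _ _ fun β => ?_
      have h2 : (d : ZMod N) * (β - e) = d * β := by
        rw [mul_sub, ← Nat.cast_mul, hde, ZMod.natCast_self, sub_zero]
      simp only [Equiv.subRight_apply, h2, mul_ite, mul_zero, ← AddChar.map_add_eq_mul]
      congr 2
      ring
    have h3 : zetaChar N (-(w * e)) ≠ 1 := by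
      rw [Ne, zetaChar_eq_one_iff, neg_eq_zero, mul_comm]; exact h
    have h4 : (zetaChar N (-(w * e)) - 1) * S = 0 := by rw [sub_mul, ← h1]; ring
    exact (mul_eq_zero.mp h4).resolve_left (sub_ne_zero.mpr h3)

end Pairing

/-! ### The comparison map as a Fourier transform -/

section Fourier

open NCSeries

variable {N : ℕ} [NeZero N]

/-- The matrix of `ℱ`. -/
noncomputable def fMat : CongX N → CycX N → CycField N
  | none, none => 1
  | some α, some η => zetaChar N (-(muIdx N η * α))
  | none, some _ => 0
  | some _, none => 0

/-- The inverse of the matrix of `ℱ`. -/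
noncomputable def fInv : CycX N → CongX N → CycField N
  | none, none => 1
  | some η, some α => (N : CycField N)⁻¹ * zetaChar N (muIdx N η * α)
  | none, some _ => 0
  | some _, none => 0

theorem fMat_mul_fInv (a a' : CongX N) :
    ∑ b, fMat a b * fInv b a' = if a = a' then 1 else 0 := by
  have hN := natCast_cycField_ne_zero (N := N)
  rw [Fintype.sum_option]
  cases a <;> cases a' <;> simp only [fMat, fInv, mul_one, mul_zero, zero_mul,
    Finset.sum_const_zero, add_zero, zero_add, if_true, reduceCtorEq, if_false, Option.some.injEq]
  rename_i α α'
  have h : ∀ η : Mu N, zetaChar N (-(muIdx N η * α)) * ((N : CycField N)⁻¹ *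
      zetaChar N (muIdx N η * α')) = (N : CycField N)⁻¹ * zetaChar N (muIdx N η * (α' - α)) := by
    intro η
    rw [mul_left_comm, ← AddChar.map_add_eq_mul]
    congr 2; ring
  rw [Finset.sum_congr rfl fun η _ => h η, ← Finset.mul_sum, sum_zetaChar_muIdx]
  simp only [sub_eq_zero, eq_comm (a := α')]
  split_ifs <;> simp [hN]

theorem fInv_mul_fMat (b b' : CycX N) :
    ∑ a, fInv b a * fMat a b' = if b = b' then 1 else 0 := by
  have hN := natCast_cycField_ne_zero (N := N)
  rw [Fintype.sum_option]
  cases b <;> cases b' <;> simp only [fMat, fInv, mul_one, mul_zero, zero_mul,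
    Finset.sum_const_zero, add_zero, zero_add, if_true, reduceCtorEq, if_false, Option.some.injEq]
  rename_i η η'
  have h : ∀ α : ZMod N, (N : CycField N)⁻¹ * zetaChar N (muIdx N η * α) *
      zetaChar N (-(muIdx N η' * α)) =
      (N : CycField N)⁻¹ * zetaChar N (α * (muIdx N η - muIdx N η')) := by
    intro α
    rw [mul_assoc, ← AddChar.map_add_eq_mul]
    congr 2; ring
  rw [Finset.sum_congr rfl fun α _ => h α, ← Finset.mul_sum, sum_zetaChar]
  simp only [sub_eq_zero, (muIdx N).apply_eq_iff_eq]
  split_ifs <;> simp [hN]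

theorem letterSub_fInv_fMat (f : NCSeries (CycField N) (CongX N)) :
    letterSub fInv (letterSub fMat f) = f := by
  rw [letterSub_letterSub]
  simp only [fMat_mul_fInv]
  exact letterSub_one f

theorem letterSub_fMat_fInv (f : NCSeries (CycField N) (CycX N)) :
    letterSub fMat (letterSub fInv f) = f := by
  rw [letterSub_letterSub]
  simp only [fInv_mul_fMat]
  exact letterSub_one f

theorem comparison_eq (f : NCSeries (CycField N) (CongX N)) :
    comparison N f = letterSub fMat f := by
  classical
  rw [comparison, letterMorphism_eq]
  congr 1
  funext a b
  rcases a with _ | α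
  · cases b <;> simp [fMat]
  rcases b with _ | η
  · simp [fMat]
  simp only [Option.some.injEq, fMat]
  have hlt := ZMod.val_lt (-muIdx N η)
  have hcast : ((N - (-muIdx N η).val : ℕ) : ZMod N) = muIdx N η := by
    rw [Nat.cast_sub hlt.le, ZMod.natCast_self, ZMod.natCast_zmod_val]; simp
  rw [Finset.sum_eq_single (N - (-muIdx N η).val)]
  · rw [if_pos]
    · rw [zpow_neg, ← Nat.cast_mul, zpow_natCast, ← zetaChar_natCast, AddChar.map_neg_eq_inv,
        Nat.cast_mul, hcast, ZMod.natCast_zmod_val]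
    · rw [← (muIdx N).apply_eq_iff_eq, muIdx_zetaMu_pow, hcast]
  · intro m hm hne
    refine if_neg fun h => hne ?_
    rw [h, muIdx_zetaMu_pow] at hcast
    rw [h, muIdx_zetaMu_pow]
    rw [h, muIdx_zetaMu_pow] at hlt
    rw [ZMod.natCast_eq_natCast_iff] at hcast
    refine (Nat.ModEq.eq_of_abs_lt hcast ?_).symm
    rw [Finset.mem_Icc] at hm
    rw [abs_lt]
    omega
  · intro h
    rw [Finset.mem_Icc] at h
    omega

theorem letterSub_fMat_some_one (f : NCSeries (CycField N) (CongX N)) :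
    letterSub fMat f [some 1] = ∑ α, f [some α] := by
  rw [letterSub_singleton, Fintype.sum_option]
  simp [fMat]

/-- The series `f`, with its homogeneous components scaled according to their index. -/
noncomputable def indexTwist (η : Mu N) (f : NCSeries (CycField N) (CongX N)) :
    NCSeries (CycField N) (CongX N) :=
  fun u => zetaChar N (muIdx N η * totalIndex u) * f u

/-- Under `ℱ`, the automorphism `t_η` with `η = ζ_N^m` corresponds to the scaling of the letters by the
values of the character `α ↦ ζ_N^{mα}`. -/
theorem tCyc_letterSub_fMat (η : Mu N) (f : NCSeries (CycField N) (CongX N)) :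
    tCyc η (letterSub fMat f) = letterSub fMat (indexTwist η f) := by
  refine NCSeries.ext fun w => ?_
  rw [tCyc_apply]
  induction w generalizing f with
  | nil =>
    change f [] = zetaChar N (muIdx N η * totalIndex []) * f []
    simp [totalIndex]
  | cons b w ih =>
    rw [List.map_cons, letterSub_cons, letterSub_cons]
    refine Finset.sum_congr rfl fun a _ => ?_
    have h1 : tail [a] (indexTwist η f) =
        zetaChar N (muIdx N η * a.getD 0) • indexTwist η (tail [a] f) := by
      refine NCSeries.ext fun u => ?_
      change zetaChar N (muIdx N η * totalIndex (a :: u)) * f (a :: u) =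
        zetaChar N (muIdx N η * a.getD 0) * (zetaChar N (muIdx N η * totalIndex u) * f (a :: u))
      rw [← mul_assoc, ← AddChar.map_add_eq_mul, ← mul_add]
      simp [totalIndex]
    have h2 : fMat a (b.map (η⁻¹ * ·)) = zetaChar N (muIdx N η * a.getD 0) * fMat a b := by
      cases a <;> cases b <;> simp only [fMat, Option.map_some, Option.map_none, Option.getD_some,
        Option.getD_none, mul_zero, AddChar.map_zero_eq_one, mul_one]
      rw [← AddChar.map_add_eq_mul, muIdx_mul, muIdx_inv]
      congr 1; ring
    rw [ih, h1, letterSub_smul', h2, NCSeries.smul_apply, smul_eq_mul, smul_eq_mul]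
    ring

theorem TCong_eq_sum_indexTwist (α : ZMod N) (f : NCSeries (CycField N) (CongX N)) :
    TCong α f = (N : CycField N)⁻¹ • ∑ η : Mu N, zetaChar N (-(muIdx N η * α)) • indexTwist η f := by
  have hN := natCast_cycField_ne_zero (N := N)
  refine NCSeries.ext fun u => ?_
  rw [TCong_apply, NCSeries.smul_apply, NCSeries.sum_apply]
  have h : ∀ η : Mu N, (zetaChar N (-(muIdx N η * α)) • indexTwist η f) u =
      zetaChar N (muIdx N η * (totalIndex u - α)) * f u := by
    intro η
    rw [NCSeries.smul_apply, indexTwist, ← mul_assoc, ← AddChar.map_add_eq_mul]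
    congr 2; ring
  rw [Finset.sum_congr rfl fun η _ => h η, ← Finset.sum_mul, sum_zetaChar_muIdx]
  simp only [sub_eq_zero]
  split_ifs <;> simp [hN]

/-- Under `ℱ`, the projection `T̃_α` corresponds to an average of the automorphisms `t_η`. -/
theorem letterSub_fMat_TCong (α : ZMod N) (f : NCSeries (CycField N) (CongX N)) :
    letterSub fMat (TCong α f) = (N : CycField N)⁻¹ •
      ∑ η : Mu N, zetaChar N (-(muIdx N η * α)) • tCyc η (letterSub fMat f) := by
  rw [TCong_eq_sum_indexTwist, letterSub_smul', letterSub_sum]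
  simp only [letterSub_smul', tCyc_letterSub_fMat]

theorem letterSub_fMat_sum_X :
    letterSub fMat (∑ β : ZMod N, X (some β) : NCSeries (CycField N) (CongX N)) =
      (N : CycField N) • X (some 1) := by
  rw [letterSub_sum]
  simp only [letterSub_X]
  rw [Finset.sum_comm, Fintype.sum_option]
  simp only [← Finset.sum_smul]
  have h : ∀ η : Mu N, ∑ β : ZMod N, fMat (some β) (some η) =
      if η = 1 then (N : CycField N) else 0 := by
    intro η
    have h1 : ∀ β : ZMod N, fMat (some β) (some η) = zetaChar N (β * (-muIdx N η)) := by
      intro β; rw [fMat]; congr 1; ring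
    rw [Finset.sum_congr rfl fun β _ => h1 β, sum_zetaChar]
    simp only [neg_eq_zero, muIdx_eq_zero]
  simp only [h, ite_smul, zero_smul, Finset.sum_ite_eq', Finset.mem_univ, if_true]
  simp [fMat]

theorem letterSub_fMat_dCong (ψ f : NCSeries (CycField N) (CongX N)) :
    letterSub fMat (dCong ψ f) = dCyc (letterSub fMat ψ) (letterSub fMat f) := by
  have hN := natCast_cycField_ne_zero (N := N)
  refine letterSub_der (fun a => ?_) f
  rw [Fintype.sum_option]
  cases a with
  | none => simp [dCongLetter, dCycLetter, fMat, letterSub_zero]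
  | some α =>
    rw [dCongLetter, letterSub_fMat_TCong, letterSub_sub, letterSub_mul, letterSub_mul,
      letterSub_fMat_sum_X, smul_mul_series, mul_smul_series, ← smul_sub]
    simp only [map_smul, smul_comm _ (N : CycField N), ← Finset.smul_sum]
    rw [smul_smul, mul_inv_cancel₀ hN, one_smul, dCycLetter, smul_zero, zero_add]
    refine Finset.sum_congr rfl fun η _ => ?_
    rw [map_sub, tCyc_mul, tCyc_mul, tCyc_X, Option.map_some, mul_one, dCycLetter, fMat]

/-- `ℱ` is compatible with the brackets. -/
theorem letterSub_fMat_bracketCong (x y : NCSeries (CycField N) (CongX N)) :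
    letterSub fMat (bracketCong x y) = bracketCyc (letterSub fMat x) (letterSub fMat y) := by
  simp only [bracketCong, bracketCyc, letterSub_add, letterSub_sub, letterSub_mul,
    letterSub_fMat_dCong]

end Fourier

/-! ### Comparison of the distribution relations -/

section CompareDistribution

open NCSeries

variable {N : ℕ} [NeZero N]

/-- The matrix of the substitution `x̃ ↦ d x̃`, `x̃_α ↦ ∑_{dβ = α} x̃_β`, which corresponds to `p^d_*`
under `ℱ`. -/
noncomputable def pMatFourier (d : ℕ) : CongX N → CongX N → ℚ
  | none, none => d
  | some α, some β => if (d : ZMod N) * β = α then 1 else 0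
  | none, some _ => 0
  | some _, none => 0

/-- The matrix of the substitution `x̃ ↦ x̃`, `x̃_α ↦ (1/d) ∑_{dβ = dα} x̃_β`, which corresponds to
`i_d^*` under `ℱ`. -/
noncomputable def iMatFourier (d : ℕ) : CongX N → CongX N → ℚ
  | none, none => 1
  | some α, some β => if (d : ZMod N) * β = d * α then (d : ℚ)⁻¹ else 0
  | none, some _ => 0
  | some _, none => 0

/-- The matrix of the substitution `x̃ ↦ x̃`, `x̃_α ↦ (1/d) ∑_{dβ = α} x̃_β`. -/
noncomputable def divMat (d : ℕ) : CongX N → CongX N → ℚ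
  | none, none => 1
  | some α, some β => if (d : ZMod N) * β = α then (d : ℚ)⁻¹ else 0
  | none, some _ => 0
  | some _, none => 0

theorem cast_ne_zero_of_dvd {d : ℕ} (hd : d ∣ N) : (d : ℚ) ≠ 0 := by
  have : d ≠ 0 := fun h => NeZero.ne N (by rw [h, zero_dvd_iff] at hd; exact hd)
  exact_mod_cast this

theorem pMatCong_mul_divMat {d : ℕ} (hd : d ∣ N) (a b : CongX N) :
    ∑ c, pMatCong d a c * divMat d c b = pMatFourier d a b := by
  classical
  have hd0 := cast_ne_zero_of_dvd hd
  rw [Fintype.sum_option]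
  cases a <;> cases b <;> try simp [pMatCong, divMat, pMatFourier]
  rename_i α β
  by_cases h : (d : ZMod N) * β = α
  · have h2 : ∃ γ : ZMod N, α = d * γ := ⟨β, h.symm⟩
    simp [h, h2, hd0]
  · simp [h]

theorem iMatCong_mul_divMat {d : ℕ} (a b : CongX N) :
    ∑ c, iMatCong d a c * divMat d c b = iMatFourier d a b := by
  classical
  rw [Fintype.sum_option]
  cases a <;> cases b <;> simp [iMatCong, divMat, iMatFourier]

theorem pMatFourier_mul_iMatCong {d : ℕ} (hd : d ∣ N) (a b : CongX N) :
    ∑ c, pMatFourier d a c * iMatCong d c b = pMatCong d a b := by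
  classical
  rw [Fintype.sum_option]
  cases a <;> cases b <;> try simp [iMatCong, pMatFourier, pMatCong]
  rename_i α γ
  by_cases h : ∃ β : ZMod N, α = d * β
  · obtain ⟨β, rfl⟩ := h
    have h1 : ∀ δ : ZMod N, (if γ = (d : ZMod N) * δ then
        (if (d : ZMod N) * δ = d * β then (1 : ℚ) else 0) else 0) =
        if (d : ZMod N) * δ = d * β then (if γ = (d : ZMod N) * β then (1 : ℚ) else 0) else 0 := by
      intro δ; split_ifs <;> simp_all
    rw [Finset.sum_congr rfl fun δ _ => h1 δ, ← Finset.sum_filter, Finset.sum_const,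
      card_mul_eq_mul hd]
    simp
  · rw [if_neg fun h2 => h h2.1]
    refine Finset.sum_eq_zero fun δ _ => ?_
    rw [if_neg (c := (d : ZMod N) * δ = α) fun h2 => h ⟨δ, h2.symm⟩, ite_self]

theorem iMatFourier_mul_iMatCong {d : ℕ} (hd : d ∣ N) (a b : CongX N) :
    ∑ c, iMatFourier d a c * iMatCong d c b = iMatCong d a b := by
  classical
  have hd0 := cast_ne_zero_of_dvd hd
  rw [Fintype.sum_option]
  cases a <;> cases b <;> try simp [iMatCong, iMatFourier]
  rename_i α γ
  have h1 : ∀ δ : ZMod N, (if γ = (d : ZMod N) * δ then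
      (if (d : ZMod N) * δ = d * α then (d : ℚ)⁻¹ else 0) else 0) =
      if (d : ZMod N) * δ = d * α then
        (if γ = (d : ZMod N) * α then (d : ℚ)⁻¹ else 0) else 0 := by
    intro δ; split_ifs <;> simp_all
  rw [Finset.sum_congr rfl fun δ _ => h1 δ, ← Finset.sum_filter, Finset.sum_const,
    card_mul_eq_mul hd]
  split_ifs <;> simp [hd0]

theorem fMat_mul_pMat (d : ℕ) (a : CongX N) (b : CycX N) :
    ∑ c, fMat a c * algebraMap ℚ (CycField N) (pMat d c b) =
      ∑ c, algebraMap ℚ (CycField N) (pMatFourier d a c) * fMat c b := by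
  classical
  rw [Fintype.sum_option, Fintype.sum_option]
  cases a <;> cases b <;> try simp [pMat, pMatFourier, fMat]
  rename_i α ω
  rw [← sum_zetaChar_of_mul_eq]
  refine Fintype.sum_equiv (muIdx N) _ _ fun η => ?_
  simp only [← muIdx_pow, (muIdx N).apply_eq_iff_eq, eq_comm (a := ω)]

theorem fMat_mul_iMat {d : ℕ} (hd : d ∣ N) (a : CongX N) (b : CycX N) :
    ∑ c, fMat a c * algebraMap ℚ (CycField N) (iMat d c b) =
      ∑ c, algebraMap ℚ (CycField N) (iMatFourier d a c) * fMat c b := by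
  classical
  have hd0 := cast_ne_zero_of_dvd hd
  have hd1 : (d : CycField N) ≠ 0 := by exact_mod_cast hd0
  rw [Fintype.sum_option, Fintype.sum_option]
  cases a <;> cases b <;> try simp [iMat, iMatFourier, fMat]
  rename_i α ω
  have hde : d * (N / d) = N := Nat.mul_div_cancel' hd
  have h := sum_zetaChar_of_mul_eq_mul hde α (muIdx N ω)
  simp only [← muIdx_pow, muIdx_eq_zero] at h
  have h1 : ∀ β : ZMod N, ((if (d : ZMod N) * β = d * α then (d : ℚ)⁻¹ else 0 : ℚ) : CycField N) *
      zetaChar N (-(muIdx N ω * β)) =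
      (d : CycField N)⁻¹ * if (d : ZMod N) * β = d * α then zetaChar N (-(muIdx N ω * β)) else 0 := by
    intro β; split_ifs <;> simp
  rw [Finset.sum_congr rfl fun β _ => h1 β, ← Finset.mul_sum, h, Finset.sum_eq_single ω]
  · by_cases h2 : ω ^ (N / d) = 1 <;> simp [h2, hd1]
  · intro η _ hη
    rw [if_neg fun h => hη h.2.symm]
  · simp

theorem letterSub_pMat_fMat (d : ℕ) (f : NCSeries (CycField N) (CongX N)) :
    letterSub (pMat d) (letterSub fMat f) = letterSub fMat (letterSub (pMatFourier d) f) := by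
  rw [← letterSub_algebraMap (pMat d), ← letterSub_algebraMap (pMatFourier d), letterSub_letterSub,
    letterSub_letterSub]
  simp only [fMat_mul_pMat]

theorem letterSub_iMat_fMat {d : ℕ} (hd : d ∣ N) (f : NCSeries (CycField N) (CongX N)) :
    letterSub (iMat d) (letterSub fMat f) = letterSub fMat (letterSub (iMatFourier d) f) := by
  rw [← letterSub_algebraMap (iMat d), ← letterSub_algebraMap (iMatFourier d), letterSub_letterSub,
    letterSub_letterSub]
  simp only [fMat_mul_iMat hd]

/-- The distribution relations on both sides correspond to each other under `ℱ`.  The two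
substitutions on the cyclotomic side correspond to the compositions with `divMat d` of those on the
congruent side, which are recovered by composition with `ĩ_d^*`. -/
theorem distribution_iff {d : ℕ} (hd : d ∣ N) (f : NCSeries (CycField N) (CongX N)) :
    letterSub (pMat d) (letterSub fMat f) = letterSub (iMat d) (letterSub fMat f) ↔
      letterSub (pMatCong d) f = letterSub (iMatCong d) f := by
  have hp1 : letterSub (divMat d) (letterSub (pMatCong d) f) = letterSub (pMatFourier d) f := by
    rw [letterSub_letterSub]; simp only [pMatCong_mul_divMat hd]
  have hi1 : letterSub (divMat d) (letterSub (iMatCong d) f) = letterSub (iMatFourier d) f := by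
    rw [letterSub_letterSub]; simp only [iMatCong_mul_divMat]
  have hp2 : letterSub (iMatCong d) (letterSub (pMatFourier d) f) = letterSub (pMatCong d) f := by
    rw [letterSub_letterSub]; simp only [pMatFourier_mul_iMatCong hd]
  have hi2 : letterSub (iMatCong d) (letterSub (iMatFourier d) f) = letterSub (iMatCong d) f := by
    rw [letterSub_letterSub]; simp only [iMatFourier_mul_iMatCong hd]
  rw [letterSub_pMat_fMat, letterSub_iMat_fMat hd]
  constructor
  · intro h
    have h1 := congrArg (letterSub fInv) h
    rw [letterSub_fInv_fMat, letterSub_fInv_fMat] at h1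
    rw [← hp2, h1, hi2]
  · intro h
    rw [← hp1, h, hi1]

end CompareDistribution

/-! ### Comparison of the harmonic coproducts -/

section CompareHarmonic

open NCSeries

variable {N : ℕ} [NeZero N]

/-- The Fourier transform of a function on the words in `ỹ_{k,α}`: its coefficient at a word in
`y_{k,η}` is obtained by the substitution `y_{k,η} ↦ ∑_α ζ_N^{-mα} ỹ_{k,α}`, for `η = ζ_N^m`. -/
noncomputable def yFourier (f : List (CongY N) → CycField N) : List (CycY N) → CycField N :=
  wordSub (fun y α => (y.1, α)) (fun y α => zetaChar N (-(muIdx N y.2 * α))) f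

/-- The inverse of `yFourier`. -/
noncomputable def yFourierInv (f : List (CycY N) → CycField N) : List (CongY N) → CycField N :=
  wordSub (fun y η => (y.1, η))
    (fun y η => (N : CycField N)⁻¹ * zetaChar N (muIdx N η * y.2)) f

theorem yFourier_cons (f : List (CongY N) → CycField N) (y : CycY N) (w : List (CycY N)) :
    yFourier f (y :: w) = ∑ α, zetaChar N (-(muIdx N y.2 * α)) •
      yFourier (fun u => f ((y.1, α) :: u)) w := rfl

theorem yFourier_sum_mul {S : Type*} [Fintype S] (c : S → CycField N)
    (f : S → List (CongY N) → CycField N) (w : List (CycY N)) :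
    yFourier (fun u => ∑ x, c x * f x u) w = ∑ x, c x * yFourier (f x) w := by
  refine (wordSub_sum Finset.univ _ _ (fun x u => c x • f x u) w).trans ?_
  exact Finset.sum_congr rfl fun x _ => wordSub_smul _ _ _ _ _

theorem yFourierInv_yFourier (f : List (CongY N) → CycField N) : yFourierInv (yFourier f) = f := by
  classical
  have hN := natCast_cycField_ne_zero (N := N)
  funext v
  have h : ∀ (z : CongY N) (g : CongY N → CycField N), ∑ η : Mu N,
      ((N : CycField N)⁻¹ * zetaChar N (muIdx N η * z.2)) •
        ∑ α, zetaChar N (-(muIdx N η * α)) • g (z.1, α) =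
      ∑ _k : Unit, (1 : CycField N) • g z := by
    intro z g
    have h1 : ∀ (η : Mu N) (α : ZMod N), ((N : CycField N)⁻¹ * zetaChar N (muIdx N η * z.2)) •
        zetaChar N (-(muIdx N η * α)) • g (z.1, α) =
        ((N : CycField N)⁻¹ * g (z.1, α)) * zetaChar N (muIdx N η * (z.2 - α)) := by
      intro η α
      have h2 : muIdx N η * (z.2 - α) = muIdx N η * z.2 + -(muIdx N η * α) := by ring
      rw [h2, AddChar.map_add_eq_mul, smul_eq_mul, smul_eq_mul]
      ring
    simp only [Finset.smul_sum, h1]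
    rw [Finset.sum_comm]
    simp only [← Finset.mul_sum, sum_zetaChar_muIdx, sub_eq_zero]
    simp [hN, mul_comm]
  have h' := wordSub_wordSub (ι := fun (y : CycY N) (α : ZMod N) => ((y.1, α) : CongY N))
    (c := fun y α => zetaChar N (-(muIdx N y.2 * α)))
    (ι' := fun (y : CongY N) (η : Mu N) => ((y.1, η) : CycY N))
    (c' := fun y η => (N : CycField N)⁻¹ * zetaChar N (muIdx N η * y.2))
    (ι'' := fun z (_ : Unit) => z) (c'' := fun _ _ => (1 : CycField N)) h f v
  have h'' := wordSub_id (ι := fun (z : CongY N) (_ : Unit) => z)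
    (c := fun _ _ => (1 : CycField N)) (fun z (g : CongY N → CycField N) => by simp) f v
  rw [yFourierInv, yFourier, h', h'']

theorem isPrim_yFourier_iff (f : List (CongY N) → CycField N) :
    IsPrim yMul (yFourier f) ↔ IsPrim congMul f := by
  have hN := natCast_cycField_ne_zero (N := N)
  constructor
  · intro h
    rw [← yFourierInv_yFourier f]
    refine IsPrim.wordSub (fun b b' g => ?_) h
    have h1 : ∀ η ω : Mu N, ((N : CycField N)⁻¹ * zetaChar N (muIdx N η * b.2)) •
        ((N : CycField N)⁻¹ * zetaChar N (muIdx N (η⁻¹ * ω) * b'.2)) • g (b.1 + b'.1, ω) =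
        ((N : CycField N)⁻¹ * (N : CycField N)⁻¹ * zetaChar N (muIdx N ω * b'.2) *
          g (b.1 + b'.1, ω)) * zetaChar N (muIdx N η * (b.2 - b'.2)) := by
      intro η ω
      have h2 : muIdx N (η⁻¹ * ω) * b'.2 = muIdx N ω * b'.2 + -(muIdx N η * b'.2) := by
        rw [muIdx_mul, muIdx_inv]; ring
      have h3 : muIdx N η * (b.2 - b'.2) = muIdx N η * b.2 + -(muIdx N η * b'.2) := by ring
      rw [h2, h3, AddChar.map_add_eq_mul, AddChar.map_add_eq_mul, smul_eq_mul, smul_eq_mul]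
      ring
    have h4 : ∀ η : Mu N, ∑ η' : Mu N,
        ((N : CycField N)⁻¹ * zetaChar N (muIdx N η' * b'.2)) • (yMul (b.1, η) (b'.1, η')).elim 0 g =
        ∑ ω : Mu N, ((N : CycField N)⁻¹ * zetaChar N (muIdx N (η⁻¹ * ω) * b'.2)) •
          g (b.1 + b'.1, ω) := by
      intro η
      refine Fintype.sum_equiv (Equiv.mulLeft η) _ _ fun η' => ?_
      simp [yMul]
    simp only [h4, Finset.smul_sum, h1]
    rw [Finset.sum_comm]
    simp only [← Finset.mul_sum, sum_zetaChar_muIdx, sub_eq_zero]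
    by_cases hb : b.2 = b'.2
    · simp only [congMul, hb, if_true, Option.elim_some, smul_eq_mul]
      refine Finset.sum_congr rfl fun ω _ => ?_
      field_simp
    · simp [congMul, hb]
  · refine IsPrim.wordSub fun b b' g => ?_
    simp only [yMul, Option.elim_some]
    refine Finset.sum_congr rfl fun α _ => ?_
    rw [Finset.sum_eq_single α]
    · rw [congMul, if_pos rfl, Option.elim_some, smul_smul, ← AddChar.map_add_eq_mul, muIdx_mul]
      congr 2; ring
    · intro β _ hβ
      rw [congMul, if_neg (Ne.symm hβ), Option.elim_none, smul_zero]
    · simp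

/-- The index of the first letter of a word. -/
def headIdx : List (CongY N) → ZMod N
  | [] => 0
  | y :: _ => y.2

theorem qWord_yWord_cons (y : CongY N) (u : List (CongY N)) : qWord (yWord (y :: u)) =
    List.replicate ((y.1 : ℕ) - 1) none ++ some (y.2 - headIdx u) :: qWord (yWord u) := by
  have h1 : ∀ n (w : List (CongX N)), qWord (List.replicate n none ++ w) =
      List.replicate n none ++ qWord w := by
    intro n w
    induction n with
    | zero => rfl
    | succ n ih => simp [List.replicate_succ, qWord, ih]
  have h2 : ∀ n (w : List (CongX N)), (List.replicate n none ++ w).reduceOption = w.reduceOption := by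
    intro n w
    induction n with
    | zero => rfl
    | succ n ih => rw [List.replicate_succ, List.cons_append, List.reduceOption_cons_of_none, ih]
  have h3 : (yWord u).reduceOption.headD 0 = headIdx u := by
    cases u with
    | nil => rfl
    | cons z u => rw [yWord_cons, h2, List.reduceOption_cons_of_some]; rfl
  rw [yWord_cons, h1, qWord, h3]

theorem letterSub_fMat_replicate (f : NCSeries (CycField N) (CongX N)) (n : ℕ) (w : List (CycX N)) :
    letterSub fMat f (List.replicate n none ++ w) =
      letterSub fMat (tail (List.replicate n none) f) w := by
  induction n generalizing f with
  | zero => rfl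
  | succ n ih =>
    rw [List.replicate_succ, List.cons_append, letterSub_cons, Fintype.sum_option]
    simp only [fMat, zero_smul, Finset.sum_const_zero, add_zero, one_smul]
    rw [ih]; rfl

/-- The permutation `𝐩` on the cyclotomic side corresponds to `𝐪̃` on the congruent side. -/
theorem letterSub_fMat_pyWord (f : NCSeries (CycField N) (CongX N)) (ζ : Mu N)
    (w : List (CycY N)) : letterSub fMat f (pyWord ζ w) =
      yFourier (fun u => zetaChar N (-(muIdx N ζ * headIdx u)) * f (qWord (yWord u))) w := by
  induction w generalizing f ζ with
  | nil =>
    change f [] = zetaChar N (-(muIdx N ζ * 0)) * f []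
    simp
  | cons y w ih =>
    rw [pyWord_cons, letterSub_fMat_replicate, letterSub_cons, Fintype.sum_option]
    simp only [fMat, zero_mul, zero_add, ih, smul_eq_mul]
    rw [yFourier_cons]
    simp only [smul_eq_mul]
    rw [← yFourier_sum_mul, ← yFourier_sum_mul]
    congr 1
    funext u
    refine Fintype.sum_equiv (Equiv.addRight (headIdx u)) _ _ fun α => ?_
    simp only [Equiv.coe_addRight, headIdx, qWord_yWord_cons, add_sub_cancel_right]
    rw [← mul_assoc, ← mul_assoc, ← AddChar.map_add_eq_mul, ← AddChar.map_add_eq_mul, muIdx_mul]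
    refine congrArg₂ (· * ·) (congrArg (zetaChar N) ?_) rfl
    ring

theorem flat_letterSub_fMat (f : NCSeries (CycField N) (CongX N)) :
    flat (letterSub fMat f) = yFourier (flatCong f) := by
  funext w
  rw [flat, letterSub_fMat_pyWord]
  congr 1
  funext u
  simp [flatCong]

/-- The transform of `∑_n C_n (∑_β ỹ_{1,β})^n` is `∑_n N^n C_n y_{1,1}^n`; this identifies the correction
terms of `ψ_*` on both sides. -/
theorem yFourier_ite (C : ℕ → CycField N) (w : List (CycY N)) :
    yFourier (fun u => open Classical in if ∀ y ∈ u, y.1 = 1 then C u.length else 0) w =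
      open Classical in if ∀ y ∈ w, y = ((1, 1) : CycY N) then
        (N : CycField N) ^ w.length * C w.length else 0 := by
  classical
  induction w generalizing C with
  | nil =>
    rw [yFourier, wordSub_nil]
    simp
  | cons y w ih =>
    rw [yFourier_cons]
    have h1 : ∀ α : ZMod N, yFourier (fun u => if ∀ z ∈ ((y.1, α) : CongY N) :: u, z.1 = 1 then
        C (((y.1, α) : CongY N) :: u).length else 0) w = if y.1 = 1 then
        (if ∀ z ∈ w, z = ((1, 1) : CycY N) then
        (N : CycField N) ^ w.length * C (w.length + 1) else 0) else 0 := by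
      intro α
      by_cases hy : y.1 = 1
      · rw [if_pos hy, ← ih fun n => C (n + 1)]
        simp [hy]
      · rw [if_neg hy]
        simp only [List.forall_mem_cons, hy, false_and, if_false]
        exact wordSub_zero _ _ w
    simp only [h1, ← Finset.sum_smul]
    have h2 : ∑ α : ZMod N, zetaChar N (-(muIdx N y.2 * α)) =
        if y.2 = 1 then (N : CycField N) else 0 := by
      have h3 : ∀ α : ZMod N, zetaChar N (-(muIdx N y.2 * α)) = zetaChar N (α * -muIdx N y.2) := by
        intro α; congr 1; ring
      rw [Finset.sum_congr rfl fun α _ => h3 α, sum_zetaChar]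
      simp only [neg_eq_zero, muIdx_eq_zero]
    rw [h2]
    have h4 : (∀ z ∈ y :: w, z = ((1, 1) : CycY N)) ↔
        y.2 = 1 ∧ y.1 = 1 ∧ ∀ z ∈ w, z = ((1, 1) : CycY N) := by
      rw [List.forall_mem_cons, Prod.ext_iff]; tauto
    simp only [h4]
    by_cases h5 : y.2 = 1
    · by_cases h6 : y.1 = 1
      · by_cases h7 : ∀ z ∈ w, z = ((1, 1) : CycY N)
        · rw [if_pos h5, if_pos h6, if_pos h7, if_pos ⟨h5, h6, h7⟩, List.length_cons, smul_eq_mul,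
            pow_succ]
          ring
        · simp only [h7, and_false, if_false, ite_self, smul_zero]
      · simp only [h6, false_and, and_false, if_false, smul_zero]
    · simp only [h5, false_and, if_false, zero_smul]

theorem starCorr_letterSub_fMat (f : NCSeries (CycField N) (CongX N)) :
    starCorr (letterSub fMat f) = yFourier (starCorrCong f) := by
  classical
  have hN := natCast_cycField_ne_zero (N := N)
  funext w
  let C : ℕ → CycField N := fun n => if 2 ≤ n then ∑ α : ZMod N, (-1) ^ (n - 1) /
    ((n : CycField N) * (N : CycField N) ^ n) * f (List.replicate (n - 1) none ++ [some α]) else 0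
  have h1 : starCorrCong f = fun u => if ∀ y ∈ u, y.1 = 1 then C u.length else 0 := by
    funext u
    rw [starCorrCong, ite_and]
    split_ifs with h2 h3
    · exact (if_pos h2).symm
    · rfl
    · exact (if_neg h2).symm
    · rfl
  rw [h1, yFourier_ite]
  change _ = if _ then _ * (if _ then _ else _) else _
  rw [starCorr]
  by_cases h2 : 2 ≤ w.length <;> by_cases h3 : ∀ y ∈ w, y = ((1, 1) : CycY N)
  · rw [if_pos ⟨h2, h3⟩, if_pos h3, if_pos h2, letterSub_fMat_replicate, letterSub_fMat_some_one,
      Finset.mul_sum, Finset.mul_sum]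
    refine Finset.sum_congr rfl fun α _ => ?_
    rw [tail_apply]
    have h4 : (w.length : CycField N) ≠ 0 := by
      have : w.length ≠ 0 := by omega
      exact_mod_cast this
    field_simp
  · rw [if_neg fun h => h3 h.2, if_neg h3]
  · rw [if_neg fun h => h2 h.1, if_pos h3, if_neg h2, mul_zero]
  · rw [if_neg fun h => h3 h.2, if_neg h3]

theorem starSer_letterSub_fMat (f : NCSeries (CycField N) (CongX N)) :
    starSer (letterSub fMat f) = yFourier (starSerCong f) := by
  funext w
  rw [starSer, flat_letterSub_fMat, starCorr_letterSub_fMat]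
  exact (wordSub_add _ _ _ _ w).symm

/-- `ℱ` identifies the conditions defining `𝔡𝔪𝔯𝔡₀^{[N]}` and `𝔡𝔪𝔯𝔡₀^{μ_N}`. -/
theorem isDmrdCyc_letterSub_fMat_iff (f : NCSeries (CycField N) (CongX N)) :
    IsDmrdCyc (letterSub fMat f) ↔ IsDmrdCong f := by
  have hN := natCast_cycField_ne_zero (N := N)
  have hnone : letterSub fMat f [none] = f [none] := by
    rw [letterSub_singleton, Fintype.sum_option]; simp [fMat]
  constructor
  · intro h
    refine ⟨hnone ▸ h.apply_none, letterSub_fMat_some_one f ▸ h.apply_one, ?_, fun α => ?_, ?_,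
      fun d hd => (distribution_iff hd f).mp (h.distribution d hd)⟩
    · rw [← letterSub_fInv_fMat f]
      exact h.shuffle.letterSub
    · rw [← letterSub_fInv_fMat f, letterSub_singleton, letterSub_singleton, Fintype.sum_option,
        Fintype.sum_option]
      congr 1
      refine Fintype.sum_equiv (Equiv.inv (Mu N)) _ _ fun η => ?_
      rw [Equiv.inv_apply, h.parity η, fInv, fInv, muIdx_inv, neg_mul_neg]
    · rw [← isPrim_yFourier_iff, ← starSer_letterSub_fMat]
      exact h.harmonic
  · intro h
    refine ⟨⟨hnone.trans h.apply_none, (letterSub_fMat_some_one f).trans h.sum_apply,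
      h.shuffle.letterSub, fun η => ?_, ?_⟩,
      fun d hd => (distribution_iff hd f).mpr (h.distribution d hd)⟩
    · rw [letterSub_singleton, letterSub_singleton, Fintype.sum_option, Fintype.sum_option]
      congr 1
      refine Fintype.sum_equiv (Equiv.neg (ZMod N)) _ _ fun α => ?_
      rw [Equiv.neg_apply, h.parity α, fMat, fMat, muIdx_inv, neg_mul_neg]
    · rw [starSer_letterSub_fMat, isPrim_yFourier_iff]
      exact h.harmonic

end CompareHarmonic

/-! ### Extension of scalars -/

section Descent

open NCSeries TensorProduct

section General

variable {K A V : Type*} [Field K] [CharZero K] [Algebra ℚ K] [AddCommGroup V] [Module ℚ V]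

/-- The series `f`, viewed over the extension `K` of `ℚ`. -/
def extendCoeff (K : Type*) [Field K] [Algebra ℚ K] (f : NCSeries ℚ A) : NCSeries K A :=
  mapCoeff (Algebra.linearMap ℚ K) f

theorem extendCoeff_apply (f : NCSeries ℚ A) (w : List A) :
    extendCoeff K f w = algebraMap ℚ K (f w) := rfl

theorem extendCoeff_add (f g : NCSeries ℚ A) :
    extendCoeff K (f + g) = extendCoeff K f + extendCoeff K g :=
  NCSeries.ext fun _ => map_add _ _ _

theorem extendCoeff_sub (f g : NCSeries ℚ A) :
    extendCoeff K (f - g) = extendCoeff K f - extendCoeff K g :=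
  NCSeries.ext fun _ => map_sub _ _ _

theorem extendCoeff_sum {S : Type*} (s : Finset S) (f : S → NCSeries ℚ A) :
    extendCoeff K (∑ i ∈ s, f i) = ∑ i ∈ s, extendCoeff K (f i) := by
  refine NCSeries.ext fun w => ?_
  rw [extendCoeff_apply, NCSeries.sum_apply, NCSeries.sum_apply, map_sum]; rfl

theorem extendCoeff_mul (f g : NCSeries ℚ A) :
    extendCoeff K (f * g) = extendCoeff K f * extendCoeff K g := by
  refine NCSeries.ext fun w => ?_
  rw [extendCoeff_apply, NCSeries.mul_apply, NCSeries.mul_apply, map_sum]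
  exact Finset.sum_congr rfl fun i _ => map_mul _ _ _

theorem extendCoeff_X (a : A) : extendCoeff K (X a : NCSeries ℚ A) = X a := by
  classical
  refine NCSeries.ext fun w => ?_
  rw [extendCoeff_apply, X, X]
  split_ifs <;> simp

theorem extendCoeff_der [Fintype A] (c : A → NCSeries ℚ A) (f : NCSeries ℚ A) :
    extendCoeff K (der c f) = der (fun a => extendCoeff K (c a)) (extendCoeff K f) := by
  refine NCSeries.ext fun w => ?_
  rw [extendCoeff_apply, der_apply, der_apply, map_sum]
  refine Finset.sum_congr rfl fun i _ => ?_
  rw [map_sum]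
  refine Finset.sum_congr rfl fun a _ => ?_
  exact congrFun (extendCoeff_mul (K := K) (c a) (tail (w.take i ++ [a]) f)) _

theorem smul_extendCoeff (r : K) (f : NCSeries ℚ A) :
    r • extendCoeff K f = mapCoeff (LinearMap.toSpanSingleton ℚ K r) f := by
  refine NCSeries.ext fun w => ?_
  rw [NCSeries.smul_apply, extendCoeff_apply, mapCoeff_apply, LinearMap.toSpanSingleton_apply,
    Algebra.smul_def, mul_comm]

variable (j : V →ₗ[ℚ] NCSeries ℚ A)

/-- The map `K ⊗ V → K⟨⟨A⟩⟩` induced by a linear map `V → ℚ⟨⟨A⟩⟩`. -/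
def extendMap : K ⊗[ℚ] V →ₗ[K] NCSeries K A := scalarExt K A ∘ₗ j.baseChange K

theorem extendMap_tmul (r : K) (v : V) : extendMap j (r ⊗ₜ[ℚ] v) = r • extendCoeff K (j v) := by
  rw [extendMap, LinearMap.comp_apply, LinearMap.baseChange_tmul, scalarExt,
    LinearMap.liftBaseChange_tmul]
  rfl

/-- The contraction `K ⊗ V → V` with a linear form on `K`. -/
def contract (T : K →ₗ[ℚ] ℚ) : K ⊗[ℚ] V →ₗ[ℚ] V :=
  (TensorProduct.lid ℚ V).toLinearMap ∘ₗ T.rTensor V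

theorem contract_tmul (T : K →ₗ[ℚ] ℚ) (r : K) (v : V) : contract T (r ⊗ₜ[ℚ] v) = T r • v := by
  simp [contract]

theorem mapCoeff_extendMap (T : K →ₗ[ℚ] ℚ) (z : K ⊗[ℚ] V) :
    mapCoeff T (extendMap j z) = j (contract T z) := by
  induction z with
  | zero => rw [map_zero, map_zero, map_zero]; exact NCSeries.ext fun w => map_zero T
  | tmul r v =>
    rw [extendMap_tmul, contract_tmul, map_smul]
    refine NCSeries.ext fun w => ?_
    rw [mapCoeff_apply, NCSeries.smul_apply, NCSeries.smul_apply, extendCoeff_apply, mul_comm,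
      ← Algebra.smul_def, map_smul, smul_eq_mul, mul_comm]
  | add x y hx hy =>
    rw [map_add, map_add, map_add, ← hx, ← hy]
    exact NCSeries.ext fun w => map_add T _ _

theorem sum_tmul_contract {ι : Type*} [Fintype ι] (b : Module.Basis ι ℚ K) (z : K ⊗[ℚ] V) :
    ∑ i, b i ⊗ₜ[ℚ] contract (b.coord i) z = z := by
  induction z with
  | zero => simp
  | tmul r v =>
    simp only [contract_tmul, TensorProduct.tmul_smul, TensorProduct.smul_tmul', Module.Basis.coord_apply]
    rw [← TensorProduct.sum_tmul, b.sum_repr]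
  | add x y hx hy =>
    simp only [map_add, TensorProduct.tmul_add, Finset.sum_add_distrib, hx, hy]

variable [FiniteDimensional ℚ K]

theorem extendMap_injective (hj : Function.Injective j) :
    Function.Injective (extendMap (K := K) j) := by
  intro z z' h
  let b := Module.finBasis ℚ K
  rw [← sum_tmul_contract b z, ← sum_tmul_contract b z']
  refine Finset.sum_congr rfl fun i _ => ?_
  rw [hj (by rw [← mapCoeff_extendMap, h, mapCoeff_extendMap] :
    j (contract (b.coord i) z) = j (contract (b.coord i) z'))]

/-- A series which all linear forms on `K` map to the image of `V` belongs to the image of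
`K ⊗ V`. -/
theorem mem_range_extendMap {ψ : NCSeries K A}
    (h : ∀ T : K →ₗ[ℚ] ℚ, mapCoeff T ψ ∈ LinearMap.range j) :
    ψ ∈ LinearMap.range (extendMap (K := K) j) := by
  let b := Module.finBasis ℚ K
  choose v hv using fun i => h (b.coord i)
  refine ⟨∑ i, b i ⊗ₜ v i, NCSeries.ext fun w => ?_⟩
  rw [map_sum, NCSeries.sum_apply]
  conv_rhs => rw [← b.sum_repr (ψ w)]
  refine Finset.sum_congr rfl fun i _ => ?_
  rw [extendMap_tmul, hv i, NCSeries.smul_apply, extendCoeff_apply, mapCoeff_apply,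
    Algebra.smul_def, mul_comm]; rfl

/-- A property of series which is stable under linear changes of coefficients and under sums holds
for all elements of the image of `K ⊗ V`. -/
theorem extendMap_induction {P : NCSeries K A → Prop} (zero : P 0)
    (add : ∀ f g, P f → P g → P (f + g))
    (h : ∀ (T : ℚ →ₗ[ℚ] K) (v : V), P (mapCoeff T (j v))) (z : K ⊗[ℚ] V) : P (extendMap j z) := by
  induction z with
  | zero => rw [map_zero]; exact zero
  | tmul r v => rw [extendMap_tmul, smul_extendCoeff]; exact h _ v
  | add x y hx hy => rw [map_add]; exact add _ _ hx hy

end General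

section Brackets

variable {K : Type*} [Field K] [CharZero K] [Algebra ℚ K] {N : ℕ} [NeZero N]

theorem extendCoeff_tCyc (ζ : Mu N) (f : NCSeries ℚ (CycX N)) :
    extendCoeff K (tCyc ζ f) = tCyc ζ (extendCoeff K f) := rfl

theorem extendCoeff_TCong (α : ZMod N) (f : NCSeries ℚ (CongX N)) :
    extendCoeff K (TCong α f) = TCong α (extendCoeff K f) := by
  classical
  refine NCSeries.ext fun w => ?_
  rw [extendCoeff_apply, TCong_apply, TCong_apply]
  split_ifs
  · rfl
  · exact map_zero _

theorem extendCoeff_bracketCyc (x y : NCSeries ℚ (CycX N)) :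
    extendCoeff K (bracketCyc x y) = bracketCyc (extendCoeff K x) (extendCoeff K y) := by
  have h : ∀ ψ f : NCSeries ℚ (CycX N),
      extendCoeff K (dCyc ψ f) = dCyc (extendCoeff K ψ) (extendCoeff K f) := by
    intro ψ f
    rw [dCyc, extendCoeff_der, dCyc]
    congr 2
    funext a
    cases a with
    | none => exact NCSeries.ext fun w => map_zero _
    | some ζ => simp only [dCycLetter, extendCoeff_sub, extendCoeff_mul, extendCoeff_X,
        extendCoeff_tCyc]
  simp only [bracketCyc, extendCoeff_add, extendCoeff_sub, extendCoeff_mul, h]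

theorem extendCoeff_bracketCong (x y : NCSeries ℚ (CongX N)) :
    extendCoeff K (bracketCong x y) = bracketCong (extendCoeff K x) (extendCoeff K y) := by
  have h : ∀ ψ f : NCSeries ℚ (CongX N),
      extendCoeff K (dCong ψ f) = dCong (extendCoeff K ψ) (extendCoeff K f) := by
    intro ψ f
    rw [dCong, extendCoeff_der, dCong]
    congr 2
    funext a
    cases a with
    | none => exact NCSeries.ext fun w => map_zero _
    | some ζ => simp only [dCongLetter, extendCoeff_TCong, extendCoeff_sub, extendCoeff_mul,
        extendCoeff_sum, extendCoeff_X]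
  simp only [bracketCong, extendCoeff_add, extendCoeff_sub, extendCoeff_mul, h]

theorem bracketCyc_smul_smul (r s : K) (x y : NCSeries K (CycX N)) :
    bracketCyc (r • x) (s • y) = (r * s) • bracketCyc x y := by
  have h : (⁅r • CycLie.toSeries.symm x, s • CycLie.toSeries.symm y⁆ : CycLie K N) =
      (r * s) • ⁅CycLie.toSeries.symm x, CycLie.toSeries.symm y⁆ := by
    rw [smul_lie, lie_smul, smul_smul]
  exact congrArg CycLie.toSeries h

theorem bracketCyc_add_left (x y z : NCSeries K (CycX N)) :
    bracketCyc (x + y) z = bracketCyc x z + bracketCyc y z :=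
  congrArg CycLie.toSeries (add_lie (CycLie.toSeries.symm x) (CycLie.toSeries.symm y)
    (CycLie.toSeries.symm z))

theorem bracketCyc_add_right (x y z : NCSeries K (CycX N)) :
    bracketCyc x (y + z) = bracketCyc x y + bracketCyc x z :=
  congrArg CycLie.toSeries (lie_add (CycLie.toSeries.symm x) (CycLie.toSeries.symm y)
    (CycLie.toSeries.symm z))

theorem bracketCong_smul_smul (r s : K) (x y : NCSeries K (CongX N)) :
    bracketCong (r • x) (s • y) = (r * s) • bracketCong x y := by
  have h : (⁅r • CongLie.toSeries.symm x, s • CongLie.toSeries.symm y⁆ : CongLie K N) =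
      (r * s) • ⁅CongLie.toSeries.symm x, CongLie.toSeries.symm y⁆ := by
    rw [smul_lie, lie_smul, smul_smul]
  exact congrArg CongLie.toSeries h

theorem bracketCong_add_left (x y z : NCSeries K (CongX N)) :
    bracketCong (x + y) z = bracketCong x z + bracketCong y z :=
  congrArg CongLie.toSeries (add_lie (CongLie.toSeries.symm x) (CongLie.toSeries.symm y)
    (CongLie.toSeries.symm z))

theorem bracketCong_add_right (x y z : NCSeries K (CongX N)) :
    bracketCong x (y + z) = bracketCong x y + bracketCong x z :=
  congrArg CongLie.toSeries (lie_add (CongLie.toSeries.symm x) (CongLie.toSeries.symm y)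
    (CongLie.toSeries.symm z))

/-- The extension of scalars of a Lie algebra with a map to series which is compatible with a
bilinear bracket. -/
theorem extendMap_lie {A L : Type*} [LieRing L] [LieAlgebra ℚ L] {j : L →ₗ[ℚ] NCSeries ℚ A}
    {B : NCSeries K A → NCSeries K A → NCSeries K A}
    (hadd : ∀ x y z, B (x + y) z = B x z + B y z) (hadd' : ∀ x y z, B x (y + z) = B x y + B x z)
    (hsmul : ∀ (r s : K) x y, B (r • x) (s • y) = (r * s) • B x y)
    (hj : ∀ x y, extendCoeff K (j ⁅x, y⁆) = B (extendCoeff K (j x)) (extendCoeff K (j y)))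
    (x y : K ⊗[ℚ] L) : extendMap j ⁅x, y⁆ = B (extendMap j x) (extendMap j y) := by
  have h0 : ∀ y, B 0 y = 0 := fun y => by simpa using hsmul 0 1 0 y
  have h0' : ∀ x, B x 0 = 0 := fun x => by simpa using hsmul 1 0 x 0
  induction x with
  | zero => rw [zero_lie, map_zero, h0]
  | add x x' hx hx' => rw [add_lie, map_add, map_add, hadd, hx, hx']
  | tmul r x =>
    induction y with
    | zero => rw [lie_zero, map_zero, h0']
    | add y y' hy hy' => rw [lie_add, map_add, map_add, hadd', hy, hy']
    | tmul s y =>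
      rw [LieAlgebra.ExtendScalars.bracket_tmul, extendMap_tmul, extendMap_tmul, extendMap_tmul,
        hsmul, hj]

end Brackets

section Algebras

variable {N : ℕ} [NeZero N]

instance finiteDimensional_cycField : FiniteDimensional ℚ (CycField N) := by
  have hN := NeZero.pos N
  have : Finite {z : ℂ | z ^ N = 1} := by
    refine Set.Finite.subset (Polynomial.nthRoots N (1 : ℂ)).toFinset.finite_toSet fun z hz => ?_
    simpa [Polynomial.mem_nthRoots hN] using hz
  exact IntermediateField.finiteDimensional_adjoin fun z hz =>
    IsIntegral.of_pow hN (hz.symm ▸ isIntegral_one)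

/-- `𝔡𝔪𝔯𝔡₀^{[N]}` is closed under the bracket. -/
theorem IsDmrdCong.bracketCong {x y : NCSeries ℚ (CongX N)} (hx : IsDmrdCong x)
    (hy : IsDmrdCong y) (hN : 3 ≤ N) : IsDmrdCong (bracketCong x y) := by
  -- The bracket is computed over `ℚ(μ_N)`, where `ℱ` reduces the claim to the cyclotomic side.
  have h1 := ((isDmrdCyc_letterSub_fMat_iff _).mpr (hx.map (Algebra.linearMap ℚ (CycField N)))).bracketCyc
    ((isDmrdCyc_letterSub_fMat_iff _).mpr (hy.map (Algebra.linearMap ℚ (CycField N))))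
    (exists_mul_self_ne_one hN)
  rw [← letterSub_fMat_bracketCong, isDmrdCyc_letterSub_fMat_iff] at h1
  have h2 : IsDmrdCong (extendCoeff (CycField N) (_root_.bracketCong x y)) := by
    rw [extendCoeff_bracketCong]; exact h1
  obtain ⟨T, hT⟩ := LinearMap.exists_leftInverse_of_injective (Algebra.linearMap ℚ (CycField N))
    (LinearMap.ker_eq_bot.mpr (algebraMap ℚ (CycField N)).injective)
  have h3 := h2.map T
  have h4 : mapCoeff T (extendCoeff (CycField N) (_root_.bracketCong x y)) =
      _root_.bracketCong x y := NCSeries.ext fun w => LinearMap.congr_fun hT _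
  rwa [h4] at h3

/-- The Lie algebra `𝔡𝔪𝔯𝔡₀^{[N]}`. -/
def dmrdCongLie (hN : 3 ≤ N) : LieSubalgebra ℚ (CongLie ℚ N) where
  carrier := {ψ | IsDmrdCong (CongLie.toSeries ψ)}
  add_mem' h₁ h₂ := IsDmrdCong.add h₁ h₂
  zero_mem' := IsDmrdCong.zero
  smul_mem' r ψ h := by
    change IsDmrdCong (mapCoeff (r • LinearMap.id) (CongLie.toSeries ψ))
    exact IsDmrdCong.map h _
  lie_mem' h₁ h₂ := IsDmrdCong.bracketCong h₁ h₂ hN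

/-- The Lie algebra `𝔡𝔪𝔯𝔡₀^{μ_N}`. -/
def dmrdCycLie (hN : 3 ≤ N) : LieSubalgebra ℚ (CycLie ℚ N) where
  carrier := {ψ | IsDmrdCyc (CycLie.toSeries ψ)}
  add_mem' h₁ h₂ := IsDmrdCyc.add h₁ h₂
  zero_mem' := IsDmrdCyc.zero
  smul_mem' r ψ h := by
    change IsDmrdCyc (mapCoeff (r • LinearMap.id) (CycLie.toSeries ψ))
    exact IsDmrdCyc.map h _
  lie_mem' h₁ h₂ := IsDmrdCyc.bracketCyc h₁ h₂ (exists_mul_self_ne_one hN)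

/-- The image of `ℚ(μ_N) ⊗ 𝔡𝔪𝔯𝔡₀^{[N]}` consists of the series over `ℚ(μ_N)` which satisfy the
defining conditions. -/
theorem mem_range_extendCong (hN : 3 ≤ N) (ψ : NCSeries (CycField N) (CongX N)) :
    ψ ∈ LinearMap.range (CongLie.extend (dmrdCongLie hN)) ↔ IsDmrdCong ψ := by
  constructor
  · rintro ⟨z, rfl⟩
    exact extendMap_induction _ IsDmrdCong.zero (fun _ _ h₁ h₂ => h₁.add h₂)
      (fun T v => IsDmrdCong.map v.2 T) z
  · intro h
    exact mem_range_extendMap _ fun T => ⟨⟨CongLie.toSeries.symm (mapCoeff T ψ), h.map T⟩, rfl⟩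

/-- The image of `ℚ(μ_N) ⊗ 𝔡𝔪𝔯𝔡₀^{μ_N}` consists of the series over `ℚ(μ_N)` which satisfy the
defining conditions. -/
theorem mem_range_extendCyc (hN : 3 ≤ N) (ψ : NCSeries (CycField N) (CycX N)) :
    ψ ∈ LinearMap.range (CycLie.extend (dmrdCycLie hN)) ↔ IsDmrdCyc ψ := by
  constructor
  · rintro ⟨z, rfl⟩
    exact extendMap_induction _ IsDmrdCyc.zero (fun _ _ h₁ h₂ => h₁.add h₂)
      (fun T v => IsDmrdCyc.map v.2 T) z
  · intro h
    exact mem_range_extendMap _ fun T => ⟨⟨CycLie.toSeries.symm (mapCoeff T ψ), h.map T⟩, rfl⟩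

theorem extendCong_injective (L : LieSubalgebra ℚ (CongLie ℚ N)) :
    Function.Injective (CongLie.extend L) :=
  extendMap_injective _ fun _ _ h => Subtype.ext (CongLie.toSeries.injective h)

theorem extendCyc_injective (L : LieSubalgebra ℚ (CycLie ℚ N)) :
    Function.Injective (CycLie.extend L) :=
  extendMap_injective _ fun _ _ h => Subtype.ext (CycLie.toSeries.injective h)

theorem extendCong_lie (L : LieSubalgebra ℚ (CongLie ℚ N)) (x y : CycField N ⊗[ℚ] L) :
    CongLie.extend L ⁅x, y⁆ = bracketCong (CongLie.extend L x) (CongLie.extend L y) :=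
  extendMap_lie bracketCong_add_left bracketCong_add_right bracketCong_smul_smul
    (fun _ _ => extendCoeff_bracketCong _ _) x y

theorem extendCyc_lie (L : LieSubalgebra ℚ (CycLie ℚ N)) (x y : CycField N ⊗[ℚ] L) :
    CycLie.extend L ⁅x, y⁆ = bracketCyc (CycLie.extend L x) (CycLie.extend L y) :=
  extendMap_lie bracketCyc_add_left bracketCyc_add_right bracketCyc_smul_smul
    (fun _ _ => extendCoeff_bracketCyc _ _) x y

/-- The morphism `ℱ`, as a linear map. -/
noncomputable def fourierMap :
    NCSeries (CycField N) (CongX N) →ₗ[CycField N] NCSeries (CycField N) (CycX N) where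
  toFun := letterSub fMat
  map_add' := letterSub_add fMat
  map_smul' := letterSub_smul' fMat

end Algebras

end Descent

/-! ### The isomorphism of Lie algebras -/

theorem mainTheorem3 (N : ℕ) [NeZero N] (hN : 3 ≤ N) :
    ∃ (Lcong : LieSubalgebra ℚ (CongLie ℚ N)) (Lcyc : LieSubalgebra ℚ (CycLie ℚ N)),
      (∀ ψ : CongLie ℚ N, ψ ∈ Lcong ↔ CongLie.toSeries ψ ∈ dmrdCong N) ∧
      (∀ ψ : CycLie ℚ N, ψ ∈ Lcyc ↔ CycLie.toSeries ψ ∈ dmrdCyc N) ∧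
      ∃ e : (CycField N ⊗[ℚ] Lcong) ≃ₗ⁅CycField N⁆ (CycField N ⊗[ℚ] Lcyc),
        ∀ z : CycField N ⊗[ℚ] Lcong,
          CycLie.extend Lcyc (e z) = comparison N (CongLie.extend Lcong z) := by
  refine ⟨dmrdCongLie hN, dmrdCycLie hN, fun ψ => (mem_dmrdCong_iff (by omega) _).symm,
    fun ψ => (mem_dmrdCyc_iff _).symm, ?_⟩
  have hinj : Function.Injective (fourierMap ∘ₗ CongLie.extend (dmrdCongLie hN)) := by
    have h : Function.Injective (fourierMap (N := N)) := fun f g h => by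
      rw [← letterSub_fInv_fMat f, ← letterSub_fInv_fMat g]
      exact congrArg (letterSub fInv) h
    exact h.comp (extendCong_injective _)
  have hrange : LinearMap.range (fourierMap ∘ₗ CongLie.extend (dmrdCongLie hN)) =
      LinearMap.range (CycLie.extend (dmrdCycLie hN)) := by
    refine Submodule.ext fun ψ => ?_
    rw [mem_range_extendCyc, LinearMap.range_comp, Submodule.mem_map]
    constructor
    · rintro ⟨f, hf, rfl⟩
      exact (isDmrdCyc_letterSub_fMat_iff f).mpr ((mem_range_extendCong hN f).mp hf)
    · intro h
      refine ⟨letterSub fInv ψ, (mem_range_extendCong hN _).mpr ?_, letterSub_fMat_fInv ψ⟩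
      rw [← isDmrdCyc_letterSub_fMat_iff, letterSub_fMat_fInv]
      exact h
  let e₀ := (LinearEquiv.ofInjective _ hinj).trans ((LinearEquiv.ofEq _ _ hrange).trans
    (LinearEquiv.ofInjective _ (extendCyc_injective (dmrdCycLie hN))).symm)
  have he : ∀ z, CycLie.extend (dmrdCycLie hN) (e₀ z) =
      letterSub fMat (CongLie.extend (dmrdCongLie hN) z) := fun z =>
    congrArg Subtype.val ((LinearEquiv.ofInjective _ (extendCyc_injective (dmrdCycLie hN))).apply_symm_apply
      (LinearEquiv.ofEq _ _ hrange (LinearEquiv.ofInjective _ hinj z)))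
  refine ⟨{ e₀ with map_lie' := fun {x y} => ?_ }, fun z => (he z).trans (comparison_eq _).symm⟩
  refine extendCyc_injective (dmrdCycLie hN) ?_
  refine (he _).trans ?_
  rw [extendCong_lie, letterSub_fMat_bracketCong, ← he, ← he]
  exact (extendCyc_lie _ _ _).symm
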